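/- Let $\Omega\subset\mathbb{R}^n$ be a bounded open set and let $\Sigma\subset\Omega$ be an embedded $C^\infty$ hypersurface which is closed in $\Omega$. For $s\in\mathbb{R}$ let ${}^\infty H_s^{\mathrm{loc}}(\Omega)$ be the space of complex-valued distributions $u\in\mathcal{D}'(\Omega)$ such that for every $\chi\in C_0^\infty(\Omega)$ $$\sup_{j\ge 0}\Big(\int_{X_j}(1+|\xi|^2)^{s}\,|\widehat{\chi u}(\xi)|^2\,d\xi\Big)^{1/2}<\infty,\qquad X_0=\{|\xi|<1\},\quad X_j=\{2^{j-1}\le|\xi|<2^j\}\ (j\ge1),$$ where $\widehat{\chi u}(\xi)=\langle \chi u, e^{-i\langle\cdot,\xi\rangle}\rangle$. For $\mu\in\mathbb{R}$ let $I^{\mu}(\Omega,\Sigma)$ be the space of conormal distributions of order $\mu$, that is, of all $u\in\mathcal{D}'(\Omega)$ such that $V_1V_2\cdots V_N u\in{}^\infty H^{\mathrm{loc}}_{-\mu-n/4}(\Omega)$ for all integers $N\ge0$ and all $C^\infty$ vector fields $V_1,\dots,V_N$ on $\Omega$ that are tangent to $\Sigma$. For $m<-1$ let $k(m)$ be the unique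 non-negative integer with $-m-2\le k(m)<-m-1$, and let $\stackrel{o}{I}{}^{m-\frac n4+\frac12}(\Omega,\Sigma)$ (Piriou's space) be the space of those $u\in I^{m-\frac n4+\frac12}(\Omega,\Sigma)$ that are given by a function of class $C^{k(m)}$ on $\Omega$ all of whose derivatives of order at most $k(m)$ vanish at every point of $\Sigma$. Proposition. If $m<-1$ and $u\in\stackrel{o}{I}{}^{m-\frac n4+\frac12}(\Omega,\Sigma)$, then $u$ is given by a continuous function on $\Omega$, and the powers $u^j$ of this function satisfy $$u^j\in I^{m-(j-1)k(m)-\frac n4+\frac12}(\Omega,\Sigma)\qquad\text{for all integers } j\ge0.$$ -/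

import Mathlib

open MeasureTheory TopologicalSpace Set
open scoped Distributions LineDeriv ContDiff

noncomputable section

namespace Conormal

/-- The Euclidean space `ℝⁿ`. -/
abbrev Rn (n : ℕ) : Type := EuclideanSpace ℝ (Fin n)

variable {n : ℕ} {Ω : Opens (Rn n)}

/-! ### Multiplication of test functions and distributions by smooth functions on `Ω` -/

theorem contDiff_mul_of_tsupport_subset {χ a : Rn n → ℝ} (hχ : ContDiff ℝ ∞ χ)
    (hsupp : tsupport χ ⊆ Ω) (ha : ContDiffOn ℝ ∞ a Ω) : ContDiff ℝ ∞ (fun x => χ x * a x) := by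
  rw [contDiff_iff_contDiffAt]
  intro x
  by_cases hx : x ∈ tsupport χ
  · exact hχ.contDiffAt.mul (ha.contDiffAt (Ω.isOpen.mem_nhds (hsupp hx)))
  · have h0 : (fun x => χ x * a x) =ᶠ[nhds x] fun _ => (0 : ℝ) := by
      filter_upwards [(isClosed_tsupport χ).isOpen_compl.mem_nhds hx] with y hy
      rw [image_eq_zero_of_notMem_tsupport hy, zero_mul]
    exact contDiffAt_const.congr_of_eventuallyEq h0

theorem exists_cutoff (K : Compacts (Rn n)) (hK : (K : Set (Rn n)) ⊆ Ω) :
    ∃ χ : Rn n → ℝ, ContDiff ℝ ∞ χ ∧ tsupport χ ⊆ Ω ∧ ∀ x ∈ K, χ x = 1 := by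
  obtain ⟨δ, hδ, hsub⟩ := K.isCompact.exists_cthickening_subset_open Ω.isOpen hK
  obtain ⟨χ, h1, -, h2, h3⟩ := exists_contMDiff_support_eq_eq_one_iff
    (modelWithCornersSelf ℝ (Rn n)) (Metric.isOpen_thickening (δ := δ) (E := (K : Set (Rn n))))
    K.isCompact.isClosed (Metric.self_subset_thickening hδ _)
  refine ⟨χ, h1.contDiff, ?_, fun x hx => (h3 x).1 hx⟩
  rw [tsupport, h2]
  exact (Metric.closure_thickening_subset_cthickening _ _).trans hsub

/-- The product `a φ` of a test function `φ` on `Ω` with a function `a` that is smooth on `Ω`. -/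
def mulTest (a : Rn n → ℝ) (ha : ContDiffOn ℝ ∞ a Ω) (φ : 𝓓(Ω, ℝ)) : 𝓓(Ω, ℝ) where
  toFun x := φ x * a x
  contDiff' := contDiff_mul_of_tsupport_subset φ.contDiff φ.tsupport_subset ha
  hasCompactSupport' := φ.hasCompactSupport.mul_right
  tsupport_subset' := (tsupport_mul_subset_left).trans φ.tsupport_subset

@[simp]
theorem mulTest_apply (a : Rn n → ℝ) (ha : ContDiffOn ℝ ∞ a Ω) (φ : 𝓓(Ω, ℝ)) (x : Rn n) :
    mulTest a ha φ x = φ x * a x := rfl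

/-- Multiplication by a function that is smooth on `Ω` is a continuous operator on test
functions. -/
def mulTestCLM (a : Rn n → ℝ) (ha : ContDiffOn ℝ ∞ a Ω) : 𝓓(Ω, ℝ) →L[ℝ] 𝓓(Ω, ℝ) :=
  TestFunction.mkCLM ℝ (mulTest a ha)
    (fun f g => by ext x; simp [add_mul])
    (fun c f => by ext x; simp [mul_assoc])
    (fun K hK => by
      obtain ⟨χ, hχ, hsupp, hone⟩ := exists_cutoff K hK
      have hb : ContDiff ℝ ((⊤ : ℕ∞) : ℕ∞ω) (fun x => χ x * a x) :=
        contDiff_mul_of_tsupport_subset hχ hsupp ha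
      have hc := (TestFunction.continuous_ofSupportedIn (n := ⊤) (F := ℝ) hK).comp
        (ContDiffMapSupportedIn.bilinLeftCLM (n := ⊤) (K := K)
          (ContinuousLinearMap.mul ℝ ℝ) hb).continuous
      refine hc.congr fun f => ?_
      ext x
      by_cases hx : x ∈ K
      · simp [hone x hx]
      · simp [f.zero_on_compl hx])

@[simp]
theorem mulTestCLM_apply (a : Rn n → ℝ) (ha : ContDiffOn ℝ ∞ a Ω) (φ : 𝓓(Ω, ℝ)) :
    mulTestCLM a ha φ = mulTest a ha φ := rfl

/-- The product `a u` of a distribution `u` on `Ω` with a function `a` that is smooth on `Ω`: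
`⟨a u, φ⟩ = ⟨u, a φ⟩`. -/
def mulDist (a : Rn n → ℝ) (ha : ContDiffOn ℝ ∞ a Ω) (u : 𝓓'(Ω, ℂ)) : 𝓓'(Ω, ℂ) :=
  (mulTestCLM a ha).precompCompactConvergenceCLM ℂ u

theorem mulDist_apply (a : Rn n → ℝ) (ha : ContDiffOn ℝ ∞ a Ω) (u : 𝓓'(Ω, ℂ)) (φ : 𝓓(Ω, ℝ)) :
    mulDist a ha u φ = u (mulTest a ha φ) := rfl

/-- The distribution `φ ↦ ∫ φ f` on `Ω` given by a locally integrable function `f` on `Ω`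
(only used for functions that are continuous on `Ω`). -/
def ofFunction (Ω : Opens (Rn n)) (f : Rn n → ℂ) : 𝓓'(Ω, ℂ) :=
  (TestFunction.integralAgainstBilinCLM (ContinuousLinearMap.lsmul ℝ ℝ) volume f :
    𝓓(Ω, ℝ) →L[ℝ] ℂ)

theorem ofFunction_apply {f : Rn n → ℂ} (hf : ContinuousOn f Ω) (φ : 𝓓(Ω, ℝ)) :
    ofFunction Ω f φ = ∫ x, φ x • f x :=
  TestFunction.integralAgainstBilinCLM_eq_integral
    (hf.locallyIntegrableOn Ω.isOpen.measurableSet)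

/-! ### The local Besov spaces `^∞H_s^loc(Ω)` -/

theorem contDiffOn_cos_inner (ξ : Rn n) :
    ContDiffOn ℝ ∞ (fun x : Rn n => Real.cos (inner ℝ x ξ)) Ω :=
  (Real.contDiff_cos.comp (contDiff_id.inner ℝ contDiff_const)).contDiffOn

theorem contDiffOn_sin_inner (ξ : Rn n) :
    ContDiffOn ℝ ∞ (fun x : Rn n => Real.sin (inner ℝ x ξ)) Ω :=
  (Real.contDiff_sin.comp (contDiff_id.inner ℝ contDiff_const)).contDiffOn

/-- For a test function `χ` on `Ω`, the Fourier transform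
`ξ ↦ ⟨χ u, e^{-i⟨·, ξ⟩}⟩ = ⟨u, χ cos⟨·, ξ⟩⟩ - i ⟨u, χ sin⟨·, ξ⟩⟩`
of the compactly supported distribution `χ u`. -/
def fourierCutoff (u : 𝓓'(Ω, ℂ)) (χ : 𝓓(Ω, ℝ)) (ξ : Rn n) : ℂ :=
  u (mulTest (fun x => Real.cos (inner ℝ x ξ)) (contDiffOn_cos_inner ξ) χ) -
    Complex.I * u (mulTest (fun x => Real.sin (inner ℝ x ξ)) (contDiffOn_sin_inner ξ) χ)

/-- The dyadic shells `{|ξ| < 1}` and `{2^(j-1) ≤ |ξ| < 2^j}`, `j ≥ 1`. -/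
def dyadicShell (n : ℕ) : ℕ → Set (Rn n)
  | 0 => {ξ | ‖ξ‖ < 1}
  | j + 1 => {ξ | (2 : ℝ) ^ j ≤ ‖ξ‖ ∧ ‖ξ‖ < (2 : ℝ) ^ (j + 1)}

/-- `u ∈ ^∞H_s^loc(Ω)`: for every cutoff `χ`, the Besov norm
`sup_j (∫_{X_j} (1 + |ξ|²)^s |(χu)^(ξ)|² dξ)^(1/2)` over the dyadic shells `X_j` is finite. -/
def MemBesovLoc (s : ℝ) (u : 𝓓'(Ω, ℂ)) : Prop :=
  ∀ χ : 𝓓(Ω, ℝ), (⨆ j : ℕ, (∫⁻ ξ in dyadicShell n j,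
    ENNReal.ofReal ((1 + ‖ξ‖ ^ 2) ^ s * ‖fourierCutoff u χ ξ‖ ^ 2)) ^ (1 / 2 : ℝ)) < ⊤

/-! ### Hypersurfaces and tangent vector fields -/

/-- `g` is a smooth defining function of `S` in the open set `U`. -/
structure IsDefiningFunction (S U : Set (Rn n)) (g : Rn n → ℝ) : Prop where
  isOpen : IsOpen U
  contDiffOn : ContDiffOn ℝ ∞ g U
  mem_iff : ∀ x ∈ U, x ∈ S ↔ g x = 0
  fderiv_ne_zero : ∀ x ∈ U, x ∈ S → fderiv ℝ g x ≠ 0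

/-- `S` is an embedded `C^∞` hypersurface of `Ω`, closed in `Ω`. -/
structure IsHypersurface (Ω : Opens (Rn n)) (S : Set (Rn n)) : Prop where
  subset : S ⊆ Ω
  closed_in : closure S ∩ Ω ⊆ S
  exists_defining : ∀ p ∈ S, ∃ U g, p ∈ U ∧ IsDefiningFunction S U g

/-- Smooth (real) vector fields on `Ω`; values outside `Ω` are irrelevant. -/
structure SmoothVectorField (Ω : Opens (Rn n)) where
  toFun : Rn n → Rn n
  contDiffOn : ContDiffOn ℝ ∞ toFun Ω

theorem SmoothVectorField.contDiffOn_coord (V : SmoothVectorField Ω) (i : Fin n) :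
    ContDiffOn ℝ ∞ (fun x => V.toFun x i) Ω :=
  (contDiffOn_piLp _).1 V.contDiffOn i

/-- `V` is tangent to the hypersurface `S`: `V(p) ∈ T_p S = ker dg(p)` at every `p ∈ S`, where `g`
is a defining function of `S` near `p`. -/
def SmoothVectorField.IsTangent (V : SmoothVectorField Ω) (S : Set (Rn n)) : Prop :=
  ∀ p ∈ S, ∀ U g, p ∈ U → IsDefiningFunction S U g → fderiv ℝ g p (V.toFun p) = 0

/-- The action `V u = ∑ i, V_i ∂_i u` of a vector field on a distribution. -/
def SmoothVectorField.act (V : SmoothVectorField Ω) (u : 𝓓'(Ω, ℂ)) : 𝓓'(Ω, ℂ) :=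
  ∑ i : Fin n, mulDist (fun x => V.toFun x i) (V.contDiffOn_coord i)
    (∂_{EuclideanSpace.single i (1 : ℝ)} u)

/-! ### Conormal distributions and Piriou's spaces -/

/-- The space `I^μ(Ω, S)` of conormal distributions of order `μ`: all `u` such that
`V_1 ⋯ V_N u ∈ ^∞H_{-μ-n/4}^loc(Ω)` for all `N ≥ 0` and all smooth vector fields
`V_1, …, V_N` tangent to `S`. -/
def conormal (Ω : Opens (Rn n)) (S : Set (Rn n)) (μ : ℝ) : Set 𝓓'(Ω, ℂ) :=
  {u | ∀ L : List (SmoothVectorField Ω), (∀ V ∈ L, V.IsTangent S) →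
    MemBesovLoc (-μ - (n : ℝ) / 4) (L.foldr SmoothVectorField.act u)}

/-- For `m < -1`, the non-negative integer `k(m)` with `-m - 2 ≤ k(m) < -m - 1`. -/
def piriouIndex (m : ℝ) : ℕ := ⌈-m - 2⌉₊

theorem piriouIndex_eq_iff {m : ℝ} (hm : m < -1) (k : ℕ) :
    piriouIndex m = k ↔ -m - 2 ≤ k ∧ (k : ℝ) < -m - 1 := by
  have h1 : -m - 2 ≤ piriouIndex m := Nat.le_ceil _
  have h2 : (piriouIndex m : ℝ) < -m - 1 := by
    have := Nat.ceil_lt_add_one_of_gt_neg_one (a := -m - 2) (by linarith)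
    rw [piriouIndex]
    linarith
  constructor
  · rintro rfl
    exact ⟨h1, h2⟩
  · rintro ⟨h3, h4⟩
    have h5 : (piriouIndex m : ℝ) < k + 1 := by linarith
    have h6 : (k : ℝ) < piriouIndex m + 1 := by linarith
    norm_cast at h5 h6
    omega

/-- Piriou's space `I°^{m-n/4+1/2}(Ω, S)`, for `m < -1`: the `u ∈ I^{m-n/4+1/2}(Ω, S)` that are
given by a function all of whose derivatives of order at most `k(m)` vanish on `S`. -/
def piriou (Ω : Opens (Rn n)) (S : Set (Rn n)) (m : ℝ) : Set 𝓓'(Ω, ℂ) :=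
  {u | u ∈ conormal Ω S (m - (n : ℝ) / 4 + 1 / 2) ∧
    ∃ f : Rn n → ℂ, ContDiffOn ℝ (piriouIndex m) f Ω ∧ u = ofFunction Ω f ∧
      ∀ p ∈ S, ∀ i ≤ piriouIndex m, iteratedFDeriv ℝ i f p = 0}

end Conormal

end

/-! Write k = k(m) and let f be the continuous function giving u. Two things are known: every
V_1⋯V_N f has Besov order s = -m - 1/2, and f vanishes to order k on S. The proof converts this into
a pointwise description, in which products are harmless, and then converts back. The pointwise class
is `IsFlat` with exponent τ: functions smooth off S all of whose tangential derivatives are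
O(dist(·, S)^τ).

From Besov to pointwise. Off S every vector field is locally tangential, so f is smooth there. Near
S, write S as a graph and flatten it by a shear, which preserves Lebesgue measure. Tangential fields
become coordinate derivatives, so the localized Fourier transform decays in each tangential
variable; by Cauchy-Schwarz, integrability then costs only 1/2 in the normal variable, whatever the
dimension (`IsConormalFun.integrable_flatFt`). Hence for τ + 1/2 < s and k < τ ≤ k + 1 there is a
Taylor expansion of degree k in the normal direction with remainder O(|t|^τ). Its polynomial
vanishes at points of S because f vanishes there to order k, so f = O(dist^τ)
(`IsConormalFun.isBigO_graphFun`). The case τ = 0 bounds all tangential derivatives, and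
Landau-Kolmogorov interpolation along flows of tangential fields upgrades these bounds to O(dist^τ)
with an arbitrarily small loss (`isBigO_foldr_vact`).

Products. By the Leibniz rule exponents add, so f^j has exponent jτ (`IsFlat.pow`).

From pointwise to Besov. For exponent σ ≥ 0, iterated differences of step r have size r^σ within
distance O(r) of S. Farther away they decay, because g∂ is tangential and so each normal derivative
costs only one power of the distance. A layer of width r has volume O(r), so the L² norm is O(r^(σ +
1/2)), which gives Besov order σ + 1/2 without loss (`IsFlat.memBesovLoc`). Distributional
tangential derivatives agree with the classical ones (`IsFlat.act_ofFunction`), so this applies to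
all of them.

Arithmetic. The claim for u^j asks for jτ ≥ -m - 1 + (j - 1)k. With τ = (k - m - 1)/2, the midpoint
of k and -m - 1, the difference of the two sides is (j/2 - 1)(-m - 1 - k), which is nonnegative for
j ≥ 2 because k < -m - 1. The case j = 1 is the hypothesis, and for j = 0 the function is constant.
-/

open MeasureTheory TopologicalSpace Set
open scoped Distributions LineDeriv ContDiff

noncomputable section

namespace Conormal

variable {n : ℕ} {Ω : Opens (Rn n)}

/-! ### Pairing distributions with complex test functions -/

/-- The `i`-th standard basis vector. -/
abbrev basisVec (i : Fin n) : Rn n := EuclideanSpace.single i (1 : ℝ)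

/-- Complex-valued test functions on `Ω`, as raw functions. -/
structure IsTest (Ω : Opens (Rn n)) (φ : Rn n → ℂ) : Prop where
  contDiff : ContDiff ℝ ∞ φ
  hasCompactSupport : HasCompactSupport φ
  tsupport_subset : tsupport φ ⊆ Ω

/-- The real part of a complex test function. -/
def IsTest.re {φ : Rn n → ℂ} (h : IsTest Ω φ) : 𝓓(Ω, ℝ) where
  toFun x := (φ x).re
  contDiff' := Complex.reCLM.contDiff.comp h.contDiff
  hasCompactSupport' := h.hasCompactSupport.comp_left (g := Complex.re) Complex.zero_re
  tsupport_subset' := (closure_mono (fun x hx => by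
    simp only [Function.mem_support] at hx ⊢; contrapose! hx; simp [hx])).trans h.tsupport_subset

/-- The imaginary part of a complex test function. -/
def IsTest.im {φ : Rn n → ℂ} (h : IsTest Ω φ) : 𝓓(Ω, ℝ) where
  toFun x := (φ x).im
  contDiff' := Complex.imCLM.contDiff.comp h.contDiff
  hasCompactSupport' := h.hasCompactSupport.comp_left (g := Complex.im) Complex.zero_im
  tsupport_subset' := (closure_mono (fun x hx => by
    simp only [Function.mem_support] at hx ⊢; contrapose! hx; simp [hx])).trans h.tsupport_subset

@[simp] theorem IsTest.re_apply {φ : Rn n → ℂ} (h : IsTest Ω φ) (x : Rn n) :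
    h.re x = (φ x).re := rfl

@[simp] theorem IsTest.im_apply {φ : Rn n → ℂ} (h : IsTest Ω φ) (x : Rn n) :
    h.im x = (φ x).im := rfl

theorem IsTest.zero : IsTest Ω (fun _ => 0) :=
  ⟨contDiff_const, HasCompactSupport.zero, by
    have : tsupport (fun _ : Rn n => (0 : ℂ)) = ∅ := by
      rw [tsupport_eq_empty_iff]; rfl
    rw [this]; exact empty_subset _⟩

theorem IsTest.add {φ ψ : Rn n → ℂ} (h : IsTest Ω φ) (h' : IsTest Ω ψ) :
    IsTest Ω (fun x => φ x + ψ x) :=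
  ⟨h.contDiff.add h'.contDiff, h.hasCompactSupport.add h'.hasCompactSupport,
    (tsupport_add φ ψ).trans (union_subset h.tsupport_subset h'.tsupport_subset)⟩

theorem IsTest.mul_left {φ a : Rn n → ℂ} (h : IsTest Ω φ) (ha : ContDiff ℝ ∞ a) :
    IsTest Ω (fun x => a x * φ x) :=
  ⟨ha.mul h.contDiff, h.hasCompactSupport.mul_left,
    (tsupport_mul_subset_right).trans h.tsupport_subset⟩

theorem IsTest.const_mul {φ : Rn n → ℂ} (h : IsTest Ω φ) (c : ℂ) : IsTest Ω (fun x => c * φ x) :=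
  h.mul_left contDiff_const

theorem IsTest.sum {ι : Type*} (s : Finset ι) {φ : ι → Rn n → ℂ} (h : ∀ i ∈ s, IsTest Ω (φ i)) :
    IsTest Ω (fun x => ∑ i ∈ s, φ i x) := by
  classical
  induction s using Finset.induction_on with
  | empty => simpa using IsTest.zero
  | insert a s ha ih =>
    simp only [Finset.sum_insert ha]
    exact (h a (by simp)).add (ih fun i hi => h i (by simp [hi]))

theorem IsTest.fderiv {φ : Rn n → ℂ} (h : IsTest Ω φ) (v : Rn n) :
    IsTest Ω (fun x => _root_.fderiv ℝ φ x v) :=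
  ⟨(h.contDiff.fderiv_right (m := ∞) (by norm_cast)).clm_apply contDiff_const,
    h.hasCompactSupport.fderiv_apply (𝕜 := ℝ) v,
    (tsupport_fderiv_apply_subset (𝕜 := ℝ) v).trans h.tsupport_subset⟩

theorem IsTest.of_contDiffOn {φ : Rn n → ℂ} (hc : HasCompactSupport φ) (hs : tsupport φ ⊆ Ω)
    (h : ContDiffOn ℝ ∞ φ Ω) : IsTest Ω φ := by
  refine ⟨?_, hc, hs⟩
  rw [contDiff_iff_contDiffAt]
  intro x
  by_cases hx : x ∈ tsupport φ
  · exact h.contDiffAt (Ω.isOpen.mem_nhds (hs hx))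
  · have h0 : φ =ᶠ[nhds x] fun _ => (0 : ℂ) := by
      filter_upwards [(isClosed_tsupport φ).isOpen_compl.mem_nhds hx] with y hy
      exact image_eq_zero_of_notMem_tsupport hy
    exact contDiffAt_const.congr_of_eventuallyEq h0

theorem IsTest.mul_contDiffOn {φ a : Rn n → ℂ} (h : IsTest Ω φ) (ha : ContDiffOn ℝ ∞ a Ω) :
    IsTest Ω (fun x => φ x * a x) :=
  IsTest.of_contDiffOn h.hasCompactSupport.mul_right
    ((tsupport_mul_subset_left).trans h.tsupport_subset) (h.contDiff.contDiffOn.mul ha)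

theorem isTest_coe (χ : 𝓓(Ω, ℝ)) : IsTest Ω (fun x => (χ x : ℂ)) :=
  ⟨Complex.ofRealCLM.contDiff.comp χ.contDiff,
    χ.hasCompactSupport.comp_left (g := Complex.ofReal) Complex.ofReal_zero,
    (closure_mono (fun x hx => by
      simp only [Function.mem_support] at hx ⊢; contrapose! hx; simp [hx])).trans
      χ.tsupport_subset⟩

theorem isTest_coe_mul (χ : 𝓓(Ω, ℝ)) {a : Rn n → ℂ} (ha : ContDiffOn ℝ ∞ a Ω) :
    IsTest Ω (fun x => (χ x : ℂ) * a x) :=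
  (isTest_coe χ).mul_contDiffOn ha

open Classical in
/-- The complex-bilinear extension of the pairing between distributions and test functions. -/
def pair (u : 𝓓'(Ω, ℂ)) (φ : Rn n → ℂ) : ℂ :=
  -- The value 0 off test functions makes `pair u` a total map on raw functions, so its argument can
  -- be rewritten pointwise without transporting a proof.
  if h : IsTest Ω φ then u h.re + Complex.I * u h.im else 0

theorem pair_eq (u : 𝓓'(Ω, ℂ)) {φ : Rn n → ℂ} (h : IsTest Ω φ) :
    pair u φ = u h.re + Complex.I * u h.im := by
  rw [pair, dif_pos h]

theorem pair_add (u : 𝓓'(Ω, ℂ)) {φ ψ : Rn n → ℂ} (h : IsTest Ω φ) (h' : IsTest Ω ψ) :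
    pair u (fun x => φ x + ψ x) = pair u φ + pair u ψ := by
  rw [pair_eq u h, pair_eq u h', pair_eq u (h.add h')]
  have e1 : (h.add h').re = h.re + h'.re := by ext x; simp
  have e2 : (h.add h').im = h.im + h'.im := by ext x; simp
  rw [e1, e2, map_add, map_add]; ring

theorem pair_const_mul (u : 𝓓'(Ω, ℂ)) {φ : Rn n → ℂ} (h : IsTest Ω φ) (c : ℂ) :
    pair u (fun x => c * φ x) = c * pair u φ := by
  rw [pair_eq u h, pair_eq u (h.const_mul c)]
  have e1 : (h.const_mul c).re = c.re • h.re - c.im • h.im := by ext x; simp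
  have e2 : (h.const_mul c).im = c.re • h.im + c.im • h.re := by ext x; simp
  rw [e1, e2, map_add, map_sub, map_smul, map_smul, map_smul, map_smul]
  simp only [Complex.real_smul]
  conv_rhs => rw [← Complex.re_add_im c]
  linear_combination (-(c.im : ℂ) * u h.im) * Complex.I_sq

theorem pair_neg (u : 𝓓'(Ω, ℂ)) {φ : Rn n → ℂ} (h : IsTest Ω φ) :
    pair u (fun x => -φ x) = -pair u φ := by
  simpa using pair_const_mul u h (-1)

theorem pair_zero (u : 𝓓'(Ω, ℂ)) : pair u (fun _ => 0) = 0 := by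
  simpa using pair_const_mul u IsTest.zero 0

theorem pair_sum (u : 𝓓'(Ω, ℂ)) {ι : Type*} (s : Finset ι) {φ : ι → Rn n → ℂ}
    (h : ∀ i ∈ s, IsTest Ω (φ i)) :
    pair u (fun x => ∑ i ∈ s, φ i x) = ∑ i ∈ s, pair u (φ i) := by
  classical
  induction s using Finset.induction_on with
  | empty => simpa using pair_zero u
  | insert a s ha ih =>
    simp only [Finset.sum_insert ha]
    rw [pair_add u (h a (by simp)) (IsTest.sum s fun i hi => h i (by simp [hi])),
      ih fun i hi => h i (by simp [hi])]

theorem ofFunction_apply_of_locallyIntegrableOn {f : Rn n → ℂ} (hf : LocallyIntegrableOn f Ω)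
    (φ : 𝓓(Ω, ℝ)) : ofFunction Ω f φ = ∫ x, φ x • f x :=
  TestFunction.integralAgainstBilinCLM_eq_integral hf

theorem IsTest.integrable_mul {f φ : Rn n → ℂ} (hf : LocallyIntegrableOn f Ω)
    (h : IsTest Ω φ) : Integrable (fun x => φ x * f x) := by
  have h1 := TestFunction.integrable_bilin (ContinuousLinearMap.lsmul ℝ ℝ) hf h.re
  have h2 := TestFunction.integrable_bilin (ContinuousLinearMap.lsmul ℝ ℝ) hf h.im
  refine (h1.add (h2.const_mul Complex.I)).congr (Filter.Eventually.of_forall fun x => ?_)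
  simp only [Pi.add_apply, ContinuousLinearMap.lsmul_apply, IsTest.re_apply, IsTest.im_apply,
    Complex.real_smul]
  conv_rhs => rw [← Complex.re_add_im (φ x)]
  ring

theorem pair_ofFunction {f φ : Rn n → ℂ} (hf : LocallyIntegrableOn f Ω) (h : IsTest Ω φ) :
    pair (ofFunction Ω f) φ = ∫ x, φ x * f x := by
  have h1 := TestFunction.integrable_bilin (ContinuousLinearMap.lsmul ℝ ℝ) hf h.re
  have h2 := TestFunction.integrable_bilin (ContinuousLinearMap.lsmul ℝ ℝ) hf h.im
  rw [pair_eq _ h, ofFunction_apply_of_locallyIntegrableOn hf,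
    ofFunction_apply_of_locallyIntegrableOn hf, ← integral_const_mul]
  refine (integral_add h1 (h2.const_mul Complex.I)).symm.trans ?_
  refine integral_congr_ae (Filter.Eventually.of_forall fun x => ?_)
  simp only [ContinuousLinearMap.lsmul_apply, IsTest.re_apply, IsTest.im_apply, Complex.real_smul]
  conv_rhs => rw [← Complex.re_add_im (φ x)]
  ring

theorem pair_mulDist (a : Rn n → ℝ) (ha : ContDiffOn ℝ ∞ a Ω) (u : 𝓓'(Ω, ℂ)) {φ : Rn n → ℂ}
    (h : IsTest Ω φ) : pair (mulDist a ha u) φ = pair u (fun x => φ x * a x) := by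
  have h' : IsTest Ω (fun x => φ x * (a x : ℂ)) :=
    h.mul_contDiffOn (Complex.ofRealCLM.contDiff.comp_contDiffOn ha)
  rw [pair_eq _ h, pair_eq _ h', mulDist_apply, mulDist_apply]
  congr 2
  · ext x; simp
  · congr 1; ext x; simp

theorem pair_lineDeriv (u : 𝓓'(Ω, ℂ)) (v : Rn n) {φ : Rn n → ℂ} (h : IsTest Ω φ) :
    pair (∂_{v} u) φ = -pair u (fun x => fderiv ℝ φ x v) := by
  rw [pair_eq _ h, pair_eq _ (h.fderiv v), Distribution.lineDerivOp_apply_apply,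
    Distribution.lineDerivOp_apply_apply, map_neg, map_neg]
  have hd : ∀ x, HasLineDerivAt ℝ φ (fderiv ℝ φ x v) x v := fun x =>
    ((h.contDiff.differentiable (by simp)).differentiableAt.hasFDerivAt).hasLineDerivAt v
  have e1 : ∂_{v} h.re = (h.fderiv v).re := by
    ext x
    have : HasLineDerivAt ℝ h.re ((fderiv ℝ φ x v).re) x v :=
      Complex.reCLM.hasFDerivAt.comp_hasDerivAt _ (hd x)
    rw [TestFunction.lineDerivOp_eq_lineDerivCLM ℝ, TestFunction.lineDerivCLM_apply,
      this.lineDeriv]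
    rfl
  have e2 : ∂_{v} h.im = (h.fderiv v).im := by
    ext x
    have : HasLineDerivAt ℝ h.im ((fderiv ℝ φ x v).im) x v :=
      Complex.imCLM.hasFDerivAt.comp_hasDerivAt _ (hd x)
    rw [TestFunction.lineDerivOp_eq_lineDerivCLM ℝ, TestFunction.lineDerivCLM_apply,
      this.lineDeriv]
    rfl
  rw [e1, e2]; ring

theorem pair_finset_sum {ι : Type*} (s : Finset ι) (u : ι → 𝓓'(Ω, ℂ)) (φ : Rn n → ℂ) :
    pair (∑ i ∈ s, u i) φ = ∑ i ∈ s, pair (u i) φ := by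
  by_cases h : IsTest Ω φ
  · simp only [pair_eq _ h, Finset.sum_add_distrib, ← Finset.mul_sum]
    have : ∀ ψ : 𝓓(Ω, ℝ), (∑ i ∈ s, u i) ψ = ∑ i ∈ s, u i ψ := fun ψ => by
      classical
      induction s using Finset.induction_on with
      | empty => rfl
      | insert a s ha ih => rw [Finset.sum_insert ha, Finset.sum_insert ha, ← ih]; rfl
    rw [this, this]
  · simp [pair, h]

theorem SmoothVectorField.contDiffOn_coord_ofReal (V : SmoothVectorField Ω) (i : Fin n) :
    ContDiffOn ℝ ∞ (fun x => (V.toFun x i : ℂ)) Ω :=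
  Complex.ofRealCLM.contDiff.comp_contDiffOn (V.contDiffOn_coord i)

theorem pair_act (V : SmoothVectorField Ω) (u : 𝓓'(Ω, ℂ)) {φ : Rn n → ℂ} (h : IsTest Ω φ) :
    pair (V.act u) φ =
      -∑ i, pair u (fun x => fderiv ℝ (fun y => φ y * V.toFun y i) x (basisVec i)) := by
  rw [SmoothVectorField.act, pair_finset_sum, ← Finset.sum_neg_distrib]
  refine Finset.sum_congr rfl fun i _ => ?_
  rw [pair_mulDist _ _ _ h, pair_lineDeriv _ _ (h.mul_contDiffOn (V.contDiffOn_coord_ofReal i))]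

/-- The divergence `div (χ V)` of the product of a vector field and a test function. -/
def SmoothVectorField.divTest (V : SmoothVectorField Ω) (χ : 𝓓(Ω, ℝ)) : 𝓓(Ω, ℝ) :=
  ∑ i, ∂_{basisVec i} (mulTest (fun x => V.toFun x i) (V.contDiffOn_coord i) χ)

theorem SmoothVectorField.divTest_apply (V : SmoothVectorField Ω) (χ : 𝓓(Ω, ℝ)) (x : Rn n) :
    V.divTest χ x = ∑ i, fderiv ℝ (fun y => χ y * V.toFun y i) x (basisVec i) := by
  have hs : ∀ (s : Finset (Fin n)) (g : Fin n → 𝓓(Ω, ℝ)), (∑ i ∈ s, g i) x = ∑ i ∈ s, g i x := by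
    intro s g
    classical
    induction s using Finset.induction_on with
    | empty => rfl
    | insert a s ha ih => rw [Finset.sum_insert ha, Finset.sum_insert ha, ← ih]; rfl
  rw [divTest, hs]
  refine Finset.sum_congr rfl fun i _ => ?_
  rw [TestFunction.lineDerivOp_eq_lineDerivCLM ℝ, TestFunction.lineDerivCLM_apply]
  have hd : DifferentiableAt ℝ (mulTest (fun x => V.toFun x i) (V.contDiffOn_coord i) χ) x :=
    ((TestFunction.contDiff _).differentiable (by simp)).differentiableAt
  rw [hd.lineDeriv_eq_fderiv]
  rfl

/-- The action of a vector field on functions. -/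
def vact (V : SmoothVectorField Ω) (f : Rn n → ℂ) (x : Rn n) : ℂ := fderiv ℝ f x (V.toFun x)

theorem contDiffOn_vact (V : SmoothVectorField Ω) {f : Rn n → ℂ} {U : Set (Rn n)} (hU : IsOpen U)
    (hUΩ : U ⊆ Ω) (hf : ContDiffOn ℝ ∞ f U) : ContDiffOn ℝ ∞ (vact V f) U :=
  (hf.fderiv_of_isOpen hU (m := ∞) (by norm_cast)).clm_apply (V.contDiffOn.mono hUΩ)

theorem euclidean_eq_sum (v : Rn n) : v = ∑ i, v i • basisVec i := by
  ext j
  simp [basisVec, Finset.sum_apply, Pi.single_apply]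

theorem vact_eq_sum (V : SmoothVectorField Ω) (f : Rn n → ℂ) (x : Rn n) :
    vact V f x = ∑ i, (V.toFun x i : ℂ) * fderiv ℝ f x (basisVec i) := by
  rw [vact]
  conv_lhs => rw [euclidean_eq_sum (V.toFun x)]
  simp [map_sum]

/-- Transposing V and applying the Leibniz rule to div(aχV) keeps cutoff and amplitude apart. The
amplitude will be a character, the Fourier transform of a Schwartz function, a character in
flattened coordinates, or a cutoff around S. -/
theorem pair_act_mul (V : SmoothVectorField Ω) (u : 𝓓'(Ω, ℂ)) (χ : 𝓓(Ω, ℝ)) {a : Rn n → ℂ}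
    (ha : ContDiff ℝ ∞ a) :
    pair (V.act u) (fun x => χ x * a x) =
      -pair u (fun x => χ x * vact V a x) - pair u (fun x => V.divTest χ x * a x) := by
  have hva : ContDiffOn ℝ ∞ (vact V a) Ω := contDiffOn_vact V Ω.isOpen le_rfl ha.contDiffOn
  have h1 := isTest_coe_mul χ ha.contDiffOn
  have h2 := isTest_coe_mul χ hva
  have h3 := isTest_coe_mul (V.divTest χ) ha.contDiffOn
  rw [pair_act V u h1, ← pair_sum, ← neg_add', ← pair_add u h2 h3]
  · congr 2
    ext x
    rw [vact_eq_sum, V.divTest_apply, Finset.mul_sum, Complex.ofReal_sum, Finset.sum_mul,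
      ← Finset.sum_add_distrib]
    refine Finset.sum_congr rfl fun i _ => ?_
    have hd : DifferentiableAt ℝ (fun y => χ y * V.toFun y i) x :=
      ((TestFunction.contDiff (mulTest (fun x => V.toFun x i)
        (V.contDiffOn_coord i) χ)).differentiable (by simp)).differentiableAt
    have e : (fun y => (χ y : ℂ) * a y * (V.toFun y i : ℂ)) =
        fun y => ((χ y * V.toFun y i : ℝ) : ℂ) * a y := by ext y; push_cast; ring
    have had : HasFDerivAt a (fderiv ℝ a x) x :=
      ((ha.differentiable (by simp)).differentiableAt).hasFDerivAt
    have hd' := Complex.ofRealCLM.hasFDerivAt.comp x hd.hasFDerivAt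
    have := (hd'.mul had).fderiv
    rw [e]
    refine (DFunLike.congr_fun this (basisVec i)).trans ?_
    simp
    ring
  · intro i _
    exact (h1.mul_contDiffOn (V.contDiffOn_coord_ofReal i)).fderiv _

theorem fourierCutoff_eq_pair (u : 𝓓'(Ω, ℂ)) (χ : 𝓓(Ω, ℝ)) (ξ : Rn n) :
    fourierCutoff u χ ξ =
      pair u (fun x => χ x * Complex.exp (-(Complex.I * (inner ℝ x ξ : ℝ)))) := by
  have ha : ContDiffOn ℝ ∞ (fun x : Rn n => Complex.exp (-(Complex.I * (inner ℝ x ξ : ℝ)))) Ω := by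
    refine (Complex.contDiff_exp.comp ?_).contDiffOn
    exact (contDiff_const.mul (Complex.ofRealCLM.contDiff.comp
      (contDiff_id.inner ℝ contDiff_const))).neg
  have h := isTest_coe_mul χ ha
  have e : ∀ x, Complex.exp (-(Complex.I * (inner ℝ x ξ : ℝ))) =
      (Real.cos (inner ℝ x ξ) : ℂ) - Real.sin (inner ℝ x ξ) * Complex.I := by
    intro x
    rw [show -(Complex.I * ((inner ℝ x ξ : ℝ) : ℂ)) = ((-(inner ℝ x ξ) : ℝ) : ℂ) * Complex.I by
      push_cast; ring, Complex.exp_mul_I, ← Complex.ofReal_cos, ← Complex.ofReal_sin]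
    simp only [Complex.ofReal_neg, Real.cos_neg, Real.sin_neg, neg_mul, sub_eq_add_neg]
  rw [pair_eq _ h, fourierCutoff]
  have e1 : h.re = mulTest (fun x => Real.cos (inner ℝ x ξ)) (contDiffOn_cos_inner ξ) χ := by
    ext x; simp [e, -Complex.ofReal_cos, -Complex.ofReal_sin]
  have e2 : h.im = -mulTest (fun x => Real.sin (inner ℝ x ξ)) (contDiffOn_sin_inner ξ) χ := by
    ext x; simp [e, -Complex.ofReal_cos, -Complex.ofReal_sin]
  rw [e1, e2, map_neg]; ring

/-! ### Fourier analysis on `L²` -/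

section Fourier

open FourierTransform SchwartzMap

theorem integral_fourier_mul_schwartz {f : Rn n → ℂ} (hf : Integrable f) (ψ : 𝓢(Rn n, ℂ)) :
    ∫ ξ, 𝓕 f ξ * ψ ξ = ∫ x, f x * 𝓕 ψ x := by
  have := VectorFourier.integral_fourierIntegral_smul_eq_flip (μ := (volume : Measure (Rn n)))
    (ν := volume) (L := innerₗ (Rn n)) Real.continuous_fourierChar continuous_inner hf
    ψ.integrable
  simp only [smul_eq_mul, flip_innerₗ] at this
  exact this

/-- By Plancherel, g can be taken to be the inverse L² Fourier transform of H; the identity is the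
duality defining the transform of tempered distributions. -/
theorem MemLp.exists_inverse_fourier {H : Rn n → ℂ} (hH : MemLp H 2) :
    ∃ g : Rn n → ℂ, MemLp g 2 ∧ ∀ ψ : 𝓢(Rn n, ℂ), ∫ ξ, H ξ * ψ ξ = ∫ x, g x * 𝓕 ψ x := by
  set h : Lp ℂ 2 (volume : Measure (Rn n)) := hH.toLp H
  set g : Lp ℂ 2 (volume : Measure (Rn n)) := 𝓕⁻ h with hg
  refine ⟨g, Lp.memLp _, fun ψ => ?_⟩
  have h1 := Lp.fourier_toTemperedDistribution_eq (𝓕⁻ h)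
  rw [FourierTransform.fourier_fourierInv_eq] at h1
  have h2 := DFunLike.congr_fun h1 ψ
  rw [TemperedDistribution.fourier_apply, Lp.toTemperedDistribution_apply,
    Lp.toTemperedDistribution_apply] at h2
  simp only [smul_eq_mul] at h2
  rw [integral_congr_ae (g := fun x => ψ x * h x), ← h2, ← hg]
  · simp only [mul_comm]
  · filter_upwards [hH.coeFn_toLp] with x hx
    rw [hx, mul_comm]

theorem MemLp.locallyIntegrable_two {g : Rn n → ℂ} (hg : MemLp g 2) : LocallyIntegrable g :=
  hg.locallyIntegrable (by norm_num)

theorem ae_eq_of_integral_schwartz {f g : Rn n → ℂ} (hf : LocallyIntegrable f)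
    (hg : LocallyIntegrable g)
    (h : ∀ ψ : 𝓢(Rn n, ℂ), ∫ x, f x * ψ x = ∫ x, g x * ψ x) : f =ᵐ[volume] g := by
  refine ae_eq_of_integral_contDiff_smul_eq hf hg fun ρ hρ hc => ?_
  have h' : HasCompactSupport (fun x => (ρ x : ℂ)) :=
    hc.comp_left (g := Complex.ofReal) Complex.ofReal_zero
  have hs : ContDiff ℝ ∞ (fun x => (ρ x : ℂ)) := Complex.ofRealCLM.contDiff.comp hρ
  have := h (h'.toSchwartzMap hs)
  have e : ∀ x, h'.toSchwartzMap hs x = (ρ x : ℂ) := fun _ => rfl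
  simpa [e, mul_comm] using this

/-- The L² transform and the integral transform agree almost everywhere, since they have the same
integrals against Schwartz functions. Plancherel then applies to the pointwise formula. -/
theorem fourier_memLp_two {f : Rn n → ℂ} (hf : Integrable f) (hf2 : MemLp f 2) :
    MemLp (𝓕 f) 2 ∧ ∫ ξ, ‖𝓕 f ξ‖ ^ 2 = ∫ x, ‖f x‖ ^ 2 := by
  set F : Lp ℂ 2 (volume : Measure (Rn n)) := 𝓕 (hf2.toLp f)
  have hcont : Continuous (𝓕 f) :=
    VectorFourier.fourierIntegral_continuous Real.continuous_fourierChar continuous_inner hf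
  have hae : (F : Rn n → ℂ) =ᵐ[volume] 𝓕 f := by
    refine ae_eq_of_integral_schwartz (MemLp.locallyIntegrable_two (Lp.memLp F))
      hcont.locallyIntegrable fun ψ => ?_
    have h2 := DFunLike.congr_fun (Lp.fourier_toTemperedDistribution_eq (hf2.toLp f)) ψ
    rw [TemperedDistribution.fourier_apply, Lp.toTemperedDistribution_apply,
      Lp.toTemperedDistribution_apply] at h2
    simp only [smul_eq_mul] at h2
    rw [integral_fourier_mul_schwartz hf]
    simp only [mul_comm _ (ψ _)]
    rw [← h2]
    refine integral_congr_ae ?_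
    filter_upwards [hf2.coeFn_toLp] with x hx
    rw [hx, mul_comm]
  have hm : MemLp (𝓕 f) 2 := (memLp_congr_ae hae).1 (Lp.memLp F)
  refine ⟨hm, ?_⟩
  have key : ∀ G : Lp ℂ 2 (volume : Measure (Rn n)), ‖G‖ ^ 2 = ∫ x, ‖G x‖ ^ 2 := by
    intro G
    have := @L2.inner_def _ ℂ ℂ _ _ _ _ _ G G
    rw [inner_self_eq_norm_sq_to_K] at this
    simp only [inner_self_eq_norm_sq_to_K] at this
    rw [← Complex.ofReal_inj, ← integral_complex_ofReal]
    push_cast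
    exact this
  have e1 : ‖F‖ = ‖hf2.toLp f‖ := Lp.norm_fourier_eq _
  have e2 := key F
  rw [e1, key] at e2
  rw [integral_congr_ae (g := fun x => ‖F x‖ ^ 2), ← e2]
  · exact integral_congr_ae (by filter_upwards [hf2.coeFn_toLp] with x hx; rw [hx])
  · filter_upwards [hae] with x hx
    rw [hx]

end Fourier

/-! ### The Fourier transform of localized distributions -/

section FT

open FourierTransform SchwartzMap

/-- The character `x ↦ e^{-2πi⟨x, ξ⟩}`. -/
def expo (ξ x : Rn n) : ℂ := Complex.exp (((-2 * Real.pi * inner ℝ x ξ : ℝ) : ℂ) * Complex.I)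

theorem norm_expo (ξ x : Rn n) : ‖expo ξ x‖ = 1 := Complex.norm_exp_ofReal_mul_I _

theorem contDiff_expo (ξ : Rn n) : ContDiff ℝ ∞ (expo ξ) :=
  Complex.contDiff_exp.comp ((Complex.ofRealCLM.contDiff.comp
    (contDiff_const.mul (contDiff_id.inner ℝ contDiff_const))).mul contDiff_const)

theorem fderiv_expo (ξ x v : Rn n) :
    fderiv ℝ (expo ξ) x v = -(2 * Real.pi * Complex.I * (inner ℝ v ξ : ℝ)) * expo ξ x := by
  have h1 : HasFDerivAt (fun x : Rn n => inner ℝ x ξ) (innerSL ℝ ξ) x := by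
    have := (innerSL ℝ ξ).hasFDerivAt (x := x)
    refine this.congr_of_eventuallyEq (Filter.Eventually.of_forall fun y => ?_)
    simp [real_inner_comm]
  have h2 := (((Complex.ofRealCLM.hasFDerivAt).comp x (h1.const_mul (-2 * Real.pi))).mul_const
    Complex.I).cexp
  refine (DFunLike.congr_fun h2.fderiv v).trans ?_
  simp only [expo, _root_.smul_apply, ContinuousLinearMap.comp_apply,
    Function.comp, Complex.ofRealCLM_apply, innerSL_apply_apply, smul_eq_mul, real_inner_comm]
  push_cast
  ring

theorem fourier_eq_expo (f : Rn n → ℂ) (ξ : Rn n) : 𝓕 f ξ = ∫ x, f x * expo ξ x := by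
  rw [Real.fourier_eq']
  simp only [smul_eq_mul, expo]
  exact integral_congr_ae (Filter.Eventually.of_forall fun x => mul_comm _ _)

/-- The Fourier transform of `χ u`, in Mathlib's normalization. -/
def ft (u : 𝓓'(Ω, ℂ)) (χ : 𝓓(Ω, ℝ)) (ξ : Rn n) : ℂ := pair u (fun x => χ x * expo ξ x)

theorem fourierCutoff_smul (u : 𝓓'(Ω, ℂ)) (χ : 𝓓(Ω, ℝ)) (ξ : Rn n) :
    fourierCutoff u χ ((2 * Real.pi) • ξ) = ft u χ ξ := by
  rw [fourierCutoff_eq_pair, ft]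
  congr 1
  ext x
  rw [expo, inner_smul_right]
  congr 2
  push_cast
  ring

theorem inner_basisVec_left (i : Fin n) (ξ : Rn n) : inner ℝ (basisVec i) ξ = ξ i := by
  simp [basisVec, EuclideanSpace.inner_single_left]

theorem ft_act (V : SmoothVectorField Ω) (u : 𝓓'(Ω, ℂ)) (χ : 𝓓(Ω, ℝ)) (ξ : Rn n) :
    ft (V.act u) χ ξ =
      ∑ i, 2 * Real.pi * Complex.I * ξ i *
        ft u (mulTest (fun x => V.toFun x i) (V.contDiffOn_coord i) χ) ξ -
      ft u (V.divTest χ) ξ := by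
  rw [ft, pair_act_mul V u χ (contDiff_expo ξ)]
  congr 1
  rw [neg_eq_iff_eq_neg, ← Finset.sum_neg_distrib]
  have h : ∀ i, IsTest Ω (fun x =>
      (mulTest (fun x => V.toFun x i) (V.contDiffOn_coord i) χ x : ℂ) * expo ξ x) := fun i =>
    isTest_coe_mul _ (contDiff_expo ξ).contDiffOn
  simp only [ft, ← neg_mul]
  simp only [← pair_const_mul u (h _)]
  rw [← pair_sum u _ fun i _ => (h i).const_mul _]
  congr 1
  ext x
  rw [vact_eq_sum, Finset.mul_sum]
  refine Finset.sum_congr rfl fun i _ => ?_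
  rw [fderiv_expo, inner_basisVec_left]
  simp
  ring

/-- The localizations of `u` have continuous Fourier transforms of polynomial growth, which
represent them. -/
structure FourierRep (u : 𝓓'(Ω, ℂ)) : Prop where
  cont : ∀ χ, Continuous (ft u χ)
  growth : ∀ χ, ∃ N : ℕ, ∃ C : ℝ, ∀ ξ, ‖ft u χ ξ‖ ≤ C * (1 + ‖ξ‖) ^ N
  rep : ∀ χ : 𝓓(Ω, ℝ), ∀ ψ : 𝓢(Rn n, ℂ),
    pair u (fun x => χ x * 𝓕 ψ x) = ∫ ξ, ft u χ ξ * ψ ξ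

theorem integrable_one_add_norm_pow_mul (N : ℕ) (ψ : 𝓢(Rn n, ℂ)) :
    Integrable (fun ξ => (1 + ‖ξ‖) ^ N * ‖ψ ξ‖) := by
  have := ((ψ.integrable_pow_mul volume 0).add (ψ.integrable_pow_mul volume N)).const_mul
    (2 ^ (N - 1))
  refine this.mono' (by fun_prop) (Filter.Eventually.of_forall fun ξ => ?_)
  have h := add_pow_le (zero_le_one (α := ℝ)) (norm_nonneg ξ) N
  rw [Real.norm_of_nonneg (by positivity)]
  simp only [Pi.add_apply, ← add_mul, one_pow, pow_zero, ← mul_assoc] at h ⊢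
  gcongr

theorem FourierRep.integrable {u : 𝓓'(Ω, ℂ)} (h : FourierRep u) (χ : 𝓓(Ω, ℝ))
    (ψ : 𝓢(Rn n, ℂ)) : Integrable (fun ξ => ft u χ ξ * ψ ξ) := by
  obtain ⟨N, C, hC⟩ := h.growth χ
  refine ((integrable_one_add_norm_pow_mul N ψ).const_mul C).mono'
    ((h.cont χ).aestronglyMeasurable.mul ψ.continuous.aestronglyMeasurable)
    (Filter.Eventually.of_forall fun ξ => ?_)
  rw [norm_mul, ← mul_assoc]
  exact mul_le_mul_of_nonneg_right (hC ξ) (norm_nonneg _)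

theorem ft_ofFunction {f : Rn n → ℂ} (hf : LocallyIntegrableOn f Ω) (χ : 𝓓(Ω, ℝ)) (ξ : Rn n) :
    ft (ofFunction Ω f) χ ξ = 𝓕 (fun x => χ x * f x) ξ := by
  rw [ft, pair_ofFunction hf (isTest_coe_mul χ (contDiff_expo ξ).contDiffOn), fourier_eq_expo]
  exact integral_congr_ae (Filter.Eventually.of_forall fun x => by ring)

theorem fourierRep_ofFunction {f : Rn n → ℂ} (hf : LocallyIntegrableOn f Ω) :
    FourierRep (ofFunction Ω f) := by
  have hint : ∀ χ : 𝓓(Ω, ℝ), Integrable (fun x => χ x * f x) := fun χ =>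
    (isTest_coe χ).integrable_mul hf
  refine ⟨fun χ => ?_, fun χ => ⟨0, ∫ x, ‖χ x * f x‖, fun ξ => ?_⟩, fun χ ψ => ?_⟩
  · simp only [funext (ft_ofFunction hf χ)]
    exact VectorFourier.fourierIntegral_continuous Real.continuous_fourierChar continuous_inner
      (hint χ)
  · rw [ft_ofFunction hf, pow_zero, mul_one]
    exact VectorFourier.norm_fourierIntegral_le_integral_norm _ _ _ _ _
  · simp only [ft_ofFunction hf]
    rw [integral_fourier_mul_schwartz (hint χ),
      pair_ofFunction hf (isTest_coe_mul χ (𝓕 ψ).smooth'.contDiffOn)]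
    exact integral_congr_ae (Filter.Eventually.of_forall fun x => by
      simp only [SchwartzMap.fourier_coe]; ring)

/-- On the Fourier side V acts by linear factors in ξ and a change of cutoff, so continuity and
polynomial growth persist. Starting from a function, this makes every V_1⋯V_N f accessible through
its Fourier transforms, with no structure theory of distributions. -/
theorem FourierRep.act {u : 𝓓'(Ω, ℂ)} (h : FourierRep u) (V : SmoothVectorField Ω) :
    FourierRep (V.act u) := by
  refine ⟨fun χ => ?_, fun χ => ?_, fun χ ψ => ?_⟩
  · simp only [funext (ft_act V u χ)]
    refine (continuous_finsetSum _ fun i _ => ?_).sub (h.cont _)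
    exact (continuous_const.mul (Complex.continuous_ofReal.comp (by fun_prop))).mul (h.cont _)
  · choose N C hC using h.growth
    set χ' : Fin n → 𝓓(Ω, ℝ) := fun i =>
      mulTest (fun x => V.toFun x i) (V.contDiffOn_coord i) χ with hχ'
    -- The growth exponents of all cutoffs involved, plus one for the factor ξ_i.
    set M := ∑ i, N (χ' i) + N (V.divTest χ) + 1
    refine ⟨M, ∑ i, 2 * Real.pi * |C (χ' i)| + |C (V.divTest χ)|, fun ξ => ?_⟩
    have hone : (1 : ℝ) ≤ 1 + ‖ξ‖ := by linarith [norm_nonneg ξ]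
    rw [ft_act, add_mul, Finset.sum_mul]
    refine (norm_sub_le _ _).trans (add_le_add ((norm_sum_le _ _).trans
      (Finset.sum_le_sum fun i _ => ?_)) ?_)
    · have h1 := hC (χ' i) ξ
      have h2 : ‖(ξ i : ℂ)‖ ≤ 1 + ‖ξ‖ := by
        have := PiLp.norm_apply_le ξ i
        rw [Complex.norm_real]; linarith
      have h3 : N (χ' i) + 1 ≤ M := by
        have := Finset.single_le_sum (f := fun i => N (χ' i)) (fun _ _ => Nat.zero_le _)
          (Finset.mem_univ i)
        omega
      rw [norm_mul, norm_mul]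
      have h4 : ‖(2 * Real.pi * Complex.I : ℂ)‖ = 2 * Real.pi := by
        simp [abs_of_pos Real.pi_pos]
      rw [h4]
      calc 2 * Real.pi * ‖(ξ i : ℂ)‖ * ‖ft u (χ' i) ξ‖
          ≤ 2 * Real.pi * (1 + ‖ξ‖) * (|C (χ' i)| * (1 + ‖ξ‖) ^ N (χ' i)) := by
            gcongr
            exact h1.trans (by gcongr; exact le_abs_self _)
        _ = 2 * Real.pi * |C (χ' i)| * (1 + ‖ξ‖) ^ (N (χ' i) + 1) := by ring
        _ ≤ _ := by gcongr
    · have h3 : N (V.divTest χ) ≤ M := by omega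
      calc _ ≤ _ := hC _ ξ
        _ ≤ |C (V.divTest χ)| * (1 + ‖ξ‖) ^ N (V.divTest χ) := by gcongr; exact le_abs_self _
        _ ≤ _ := by gcongr
  · set χ' : Fin n → 𝓓(Ω, ℝ) := fun i =>
      mulTest (fun x => V.toFun x i) (V.contDiffOn_coord i) χ with hχ'
    -- Chosen so that the Fourier transform of ψ' i is ∂_i of the Fourier transform of ψ.
    set ψ' : Fin n → 𝓢(Rn n, ℂ) := fun i =>
      -(2 * Real.pi * Complex.I) • smulLeftCLM ℂ (inner ℝ · (basisVec i)) ψ with hψ'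
    have e1 : ∀ i ξ, ψ' i ξ = -(2 * Real.pi * Complex.I * ξ i) * ψ ξ := by
      intro i ξ
      have hg : (fun x : Rn n => inner ℝ x (basisVec i)).HasTemperateGrowth := by fun_prop
      simp only [hψ', _root_.smul_apply]
      rw [smulLeftCLM_apply_apply hg, real_inner_comm, inner_basisVec_left]
      simp
      ring
    have e2 : ∀ i x, fderiv ℝ (𝓕 ψ : 𝓢(Rn n, ℂ)) x (basisVec i) = (𝓕 (ψ' i) : 𝓢(Rn n, ℂ)) x := by
      intro i x
      rw [← SchwartzMap.lineDerivOp_fourier_eq, SchwartzMap.lineDerivOp_apply_eq_fderiv]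
    have hs : ∀ φ : 𝓢(Rn n, ℂ), ContDiff ℝ ∞ φ := fun φ => φ.smooth'
    rw [pair_act_mul V u χ (hs _), h.rep]
    have e3 : (fun x => (χ x : ℂ) * vact V (𝓕 ψ : 𝓢(Rn n, ℂ)) x) =
        fun x => ∑ i, (χ' i x : ℂ) * (𝓕 (ψ' i) : 𝓢(Rn n, ℂ)) x := by
      ext x
      rw [vact_eq_sum, Finset.mul_sum]
      refine Finset.sum_congr rfl fun i _ => ?_
      rw [e2]
      simp [hχ']
      ring
    rw [e3, pair_sum u _ fun i _ => isTest_coe_mul _ (hs _).contDiffOn]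
    simp only [h.rep]
    rw [← integral_finsetSum _ fun i _ => h.integrable _ _, ← integral_neg, ← integral_sub]
    · refine integral_congr_ae (Filter.Eventually.of_forall fun ξ => ?_)
      simp only [ft_act, sub_mul, Finset.sum_mul, e1, ← Finset.sum_neg_distrib, hχ']
      congr 1
      refine Finset.sum_congr rfl fun i _ => ?_
      ring
    · exact (integrable_finsetSum _ fun i _ => h.integrable _ _).neg
    · exact h.integrable _ _

theorem FourierRep.foldr_act {u : 𝓓'(Ω, ℂ)} (h : FourierRep u) (L : List (SmoothVectorField Ω)) :
    FourierRep (L.foldr SmoothVectorField.act u) := by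
  induction L with
  | nil => exact h
  | cons V L ih => exact ih.act V

end FT

/-! ### Distributions with square integrable Fourier transform -/

section L2Rep

open FourierTransform SchwartzMap

/-- A smooth function agrees on any bounded set with a Schwartz function. -/
theorem exists_schwartz_eqOn {K : Set (Rn n)} (hK : IsCompact K) {a : Rn n → ℂ}
    (ha : ContDiff ℝ ∞ a) : ∃ φ : 𝓢(Rn n, ℂ), ∀ x ∈ K, φ x = a x := by
  obtain ⟨R, hR⟩ := hK.isBounded.subset_closedBall (0 : Rn n)
  let b : ContDiffBump (0 : Rn n) := ⟨|R| + 1, |R| + 2, by positivity, by linarith⟩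
  have hb : HasCompactSupport (fun x => (b x : ℂ) * a x) :=
    (b.hasCompactSupport.comp_left (g := Complex.ofReal) Complex.ofReal_zero).mul_right
  have hs : ContDiff ℝ ∞ (fun x => (b x : ℂ) * a x) :=
    (Complex.ofRealCLM.contDiff.comp b.contDiff).mul ha
  refine ⟨hb.toSchwartzMap hs, fun x hx => ?_⟩
  change (b x : ℂ) * a x = a x
  rw [b.one_of_mem_closedBall]
  · simp
  · have := hR hx
    rw [mem_closedBall_zero_iff] at this ⊢
    exact this.trans ((le_abs_self R).trans (by simp [b]))

/-- If the Fourier transform of `χ w` is square integrable and `w` is given by the function `F`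
outside of a null set, then `χ w` is given by `χ F`, and this function is square integrable. -/
theorem FourierRep.memLp_two {w : 𝓓'(Ω, ℂ)} (hw : FourierRep w) (χ : 𝓓(Ω, ℝ))
    (hL2 : MemLp (ft w χ) 2) {O : Set (Rn n)} (hO : IsOpen O) {F : Rn n → ℂ}
    (hF : LocallyIntegrableOn F O)
    (hrep : ∀ φ, IsTest Ω φ → tsupport φ ⊆ O → pair w φ = ∫ x, φ x * F x)
    (hnull : volume (tsupport χ \ O) = 0) :
    MemLp (fun x => χ x * F x) 2 ∧ ∀ a : Rn n → ℂ, ContDiff ℝ ∞ a →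
      pair w (fun x => χ x * a x) = ∫ x, χ x * F x * a x := by
  -- Square integrability excludes a singular part carried by the null set: χ w is the L² function
  -- g, and g equals χ F a.e., as testing shows separately off the support of χ and on O.
  obtain ⟨g, hg, hgrep⟩ := MemLp.exists_inverse_fourier hL2
  have h1 : ∀ φ : 𝓢(Rn n, ℂ), pair w (fun x => χ x * φ x) = ∫ x, g x * φ x := by
    intro φ
    have := hw.rep χ (𝓕⁻ φ)
    rw [hgrep] at this
    simpa using this
  have hgloc := MemLp.locallyIntegrable_two hg
  have hsch : ∀ ρ : Rn n → ℝ, ContDiff ℝ ∞ ρ → HasCompactSupport ρ →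
      pair w (fun x => χ x * (ρ x : ℂ)) = ∫ x, g x * ρ x := by
    intro ρ hρ hc
    have hc' : HasCompactSupport (fun x => (ρ x : ℂ)) :=
      hc.comp_left (g := Complex.ofReal) Complex.ofReal_zero
    have hs : ContDiff ℝ ∞ (fun x => (ρ x : ℂ)) := Complex.ofRealCLM.contDiff.comp hρ
    exact h1 (hc'.toSchwartzMap hs)
  have hχc : Continuous (fun x => (χ x : ℂ)) := Complex.continuous_ofReal.comp χ.continuous
  have hae1 : ∀ᵐ x, x ∈ (tsupport χ)ᶜ → g x = 0 := by
    refine (isClosed_tsupport χ).isOpen_compl.ae_eq_zero_of_integral_contDiff_smul_eq_zero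
      (hgloc.locallyIntegrableOn _) fun ρ hρ hc hs => ?_
    have := hsch ρ hρ hc
    have e : (fun x => (χ x : ℂ) * (ρ x : ℂ)) = fun _ => 0 := by
      ext x
      by_cases hx : x ∈ tsupport χ
      · have : ρ x = 0 := image_eq_zero_of_notMem_tsupport fun h => hs h hx
        simp [this]
      · simp [image_eq_zero_of_notMem_tsupport hx]
    rw [e, pair_zero] at this
    simp only [Complex.real_smul]
    rw [this]
    exact integral_congr_ae (Filter.Eventually.of_forall fun x => mul_comm _ _)
  have hae2 : ∀ᵐ x, x ∈ O → g x - χ x * F x = 0 := by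
    have hFχ : LocallyIntegrableOn (fun x => (χ x : ℂ) * F x) O :=
      hF.continuousOn_mul hχc.continuousOn hO.isLocallyClosed
    refine hO.ae_eq_zero_of_integral_contDiff_smul_eq_zero
      ((hgloc.locallyIntegrableOn _).sub hFχ) fun ρ hρ hc hs => ?_
    have h2 := hsch ρ hρ hc
    have ht : IsTest Ω (fun x => (χ x : ℂ) * (ρ x : ℂ)) :=
      isTest_coe_mul χ (Complex.ofRealCLM.contDiff.comp hρ).contDiffOn
    have hts : tsupport (fun x => (χ x : ℂ) * (ρ x : ℂ)) ⊆ O := by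
      refine (tsupport_mul_subset_right).trans ((closure_mono fun x hx => ?_).trans hs)
      simp only [Function.mem_support] at hx ⊢
      contrapose! hx; simp [hx]
    rw [hrep _ ht hts] at h2
    have hi1 : Integrable (fun x => ρ x • g x) := by
      exact hgloc.integrable_smul_left_of_hasCompactSupport hρ.continuous hc
    have hi2 : Integrable (fun x => ρ x • ((χ x : ℂ) * F x)) := by
      have hFOn := hFχ.integrableOn_compact_subset hs hc
      have := hFOn.continuousOn_mul (K := tsupport ρ)
        (g := fun x => (ρ x : ℂ)) (g' := fun x => (χ x : ℂ) * F x)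
        (Complex.continuous_ofReal.comp hρ.continuous).continuousOn hc
      refine (integrableOn_iff_integrable_of_support_subset (s := tsupport ρ) ?_).1 this
      intro x hx
      apply subset_tsupport
      simp only [Function.mem_support] at hx ⊢
      contrapose! hx; simp [hx]
    simp only [smul_sub]
    rw [integral_sub hi1 hi2, sub_eq_zero]
    simp only [Complex.real_smul]
    calc _ = ∫ x, g x * ρ x := by simp only [mul_comm]
      _ = _ := by rw [← h2]; congr 1; ext x; ring
  have hae : g =ᵐ[volume] fun x => χ x * F x := by
    have h3 : ∀ᵐ x, x ∉ tsupport χ \ O := measure_eq_zero_iff_ae_notMem.1 hnull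
    filter_upwards [hae1, hae2, h3] with x ha hb hc
    by_cases hx : x ∈ tsupport χ
    · have : x ∈ O := by_contra fun h => hc ⟨hx, h⟩
      exact sub_eq_zero.1 (hb this)
    · rw [ha hx, image_eq_zero_of_notMem_tsupport hx]; simp
  refine ⟨(memLp_congr_ae hae).1 hg, fun a ha => ?_⟩
  -- Only the values of a on the support of χ matter, so a may be replaced by a Schwartz function.
  obtain ⟨φ, hφ⟩ := exists_schwartz_eqOn χ.hasCompactSupport ha
  have e : (fun x => (χ x : ℂ) * a x) = fun x => (χ x : ℂ) * φ x := by
    ext x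
    by_cases hx : x ∈ tsupport χ
    · rw [hφ x hx]
    · simp [image_eq_zero_of_notMem_tsupport hx]
  rw [e, h1]
  refine integral_congr_ae ?_
  filter_upwards [hae] with x hx
  rw [hx]
  by_cases hx : x ∈ tsupport χ
  · rw [hφ x hx]
  · simp [image_eq_zero_of_notMem_tsupport hx]

end L2Rep

/-! ### From Besov to Sobolev regularity -/

section Besov

open scoped ENNReal

theorem measurableSet_dyadicShell (j : ℕ) : MeasurableSet (dyadicShell n j) := by
  cases j with
  | zero => exact measurableSet_lt measurable_norm measurable_const
  | succ j =>
    exact (measurableSet_le measurable_const measurable_norm).inter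
      (measurableSet_lt measurable_norm measurable_const)

theorem iUnion_dyadicShell : (⋃ j, dyadicShell n j) = univ := by
  refine eq_univ_of_forall fun ξ => mem_iUnion.2 ?_
  by_cases h : ‖ξ‖ < 1
  · exact ⟨0, h⟩
  · obtain ⟨j, hj⟩ := exists_nat_pow_near (not_lt.1 h) (one_lt_two)
    exact ⟨j + 1, hj⟩

theorem exists_dyadicShell_bound {s : ℝ} {u : 𝓓'(Ω, ℂ)} (h : MemBesovLoc s u) (χ : 𝓓(Ω, ℝ)) :
    ∃ C : ℝ≥0∞, C < ⊤ ∧ ∀ j, ∫⁻ ξ in dyadicShell n j,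
      ENNReal.ofReal ((1 + ‖ξ‖ ^ 2) ^ s * ‖fourierCutoff u χ ξ‖ ^ 2) ≤ C := by
  refine ⟨_, ENNReal.rpow_lt_top_of_nonneg (y := 2) (by norm_num) (h χ).ne, fun j => ?_⟩
  have := le_iSup (fun j : ℕ => (∫⁻ ξ in dyadicShell n j,
    ENNReal.ofReal ((1 + ‖ξ‖ ^ 2) ^ s * ‖fourierCutoff u χ ξ‖ ^ 2)) ^ (1 / 2 : ℝ)) j
  have := ENNReal.rpow_le_rpow (z := 2) this (by norm_num)
  rwa [← ENNReal.rpow_mul, show (1 / 2 * 2 : ℝ) = 1 by norm_num, ENNReal.rpow_one] at this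

/-- The Besov norm is a supremum over shells, the Sobolev norm a sum. Giving up δ = s - s'
derivatives gains the factor r^j = 2^(-2δj) on the j-th shell, and the geometric series converges.
-/
theorem lintegral_sobolev_lt_top {s s' : ℝ} (hs : s' < s) {u : 𝓓'(Ω, ℂ)} (h : MemBesovLoc s u)
    (χ : 𝓓(Ω, ℝ)) :
    ∫⁻ ξ, ENNReal.ofReal ((1 + ‖ξ‖ ^ 2) ^ s' * ‖fourierCutoff u χ ξ‖ ^ 2) < ⊤ := by
  obtain ⟨C, hC, hb⟩ := exists_dyadicShell_bound h χ
  set δ := s - s' with hδ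
  have hδ0 : 0 < δ := sub_pos.2 hs
  set r : ℝ := 2 ^ (-(2 * δ)) with hr
  have hr0 : 0 < r := by positivity
  have hr1 : r < 1 := Real.rpow_lt_one_of_one_lt_of_neg (by norm_num) (by linarith)
  -- For j ≥ 1 the shell lies in |ξ| ≥ 2^(j-1), one power short of 2^j; this is the factor r⁻¹.
  have hw : ∀ j, ∀ ξ ∈ dyadicShell n j, (1 + ‖ξ‖ ^ 2) ^ s' ≤
      r⁻¹ * r ^ j * (1 + ‖ξ‖ ^ 2) ^ s := by
    intro j ξ hξ
    have hp : (0 : ℝ) < 1 + ‖ξ‖ ^ 2 := by positivity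
    have e : (1 + ‖ξ‖ ^ 2) ^ s' = (1 + ‖ξ‖ ^ 2) ^ (-δ) * (1 + ‖ξ‖ ^ 2) ^ s := by
      rw [← Real.rpow_add hp]; congr 1; rw [hδ]; ring
    rw [e]
    gcongr
    cases j with
    | zero =>
      rw [pow_zero, mul_one]
      have h1 : (1 + ‖ξ‖ ^ 2) ^ (-δ) ≤ 1 :=
        Real.rpow_le_one_of_one_le_of_nonpos (by nlinarith [sq_nonneg ‖ξ‖]) (by linarith)
      exact h1.trans (one_le_inv_iff₀.2 ⟨hr0, hr1.le⟩)
    | succ j =>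
      rw [pow_succ' r j]
      rw [inv_mul_cancel_left₀ hr0.ne']
      have h2 : ((2 : ℝ) ^ j) ^ 2 ≤ 1 + ‖ξ‖ ^ 2 := by
        have : ((2 : ℝ) ^ j) ^ 2 ≤ ‖ξ‖ ^ 2 := by gcongr; exact hξ.1
        linarith
      have h3 : (1 + ‖ξ‖ ^ 2) ^ (-δ) ≤ (((2 : ℝ) ^ j) ^ 2) ^ (-δ) :=
        Real.rpow_le_rpow_of_nonpos (by positivity) h2 (by linarith)
      refine h3.trans (le_of_eq ?_)
      rw [hr, ← Real.rpow_natCast, ← Real.rpow_natCast, ← Real.rpow_natCast,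
        ← Real.rpow_mul (by norm_num), ← Real.rpow_mul (by norm_num),
        ← Real.rpow_mul (by norm_num)]
      congr 1
      push_cast; ring
  have hle : ∀ j, ∫⁻ ξ in dyadicShell n j,
      ENNReal.ofReal ((1 + ‖ξ‖ ^ 2) ^ s' * ‖fourierCutoff u χ ξ‖ ^ 2) ≤
      ENNReal.ofReal (r⁻¹ * r ^ j) * C := by
    intro j
    refine le_trans ?_ (mul_le_mul_right (hb j) _)
    rw [← lintegral_const_mul' _ _ ENNReal.ofReal_ne_top]
    refine setLIntegral_mono' (measurableSet_dyadicShell j) fun ξ hξ => ?_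
    rw [← ENNReal.ofReal_mul (by positivity)]
    refine ENNReal.ofReal_le_ofReal ?_
    rw [← mul_assoc]
    gcongr
    exact hw j ξ hξ
  calc _ = ∫⁻ ξ in ⋃ j, dyadicShell n j,
        ENNReal.ofReal ((1 + ‖ξ‖ ^ 2) ^ s' * ‖fourierCutoff u χ ξ‖ ^ 2) := by
        rw [iUnion_dyadicShell, Measure.restrict_univ]
    _ ≤ ∑' j, ∫⁻ ξ in dyadicShell n j,
        ENNReal.ofReal ((1 + ‖ξ‖ ^ 2) ^ s' * ‖fourierCutoff u χ ξ‖ ^ 2) :=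
        lintegral_iUnion_le _ _
    _ ≤ ∑' j, ENNReal.ofReal (r⁻¹ * r ^ j) * C := ENNReal.tsum_le_tsum hle
    _ = ENNReal.ofReal (∑' j, r⁻¹ * r ^ j) * C := by
        rw [ENNReal.tsum_mul_right, ENNReal.ofReal_tsum_of_nonneg (fun j => by positivity)
          ((summable_geometric_of_lt_one hr0.le hr1).mul_left _)]
    _ < ⊤ := ENNReal.mul_lt_top ENNReal.ofReal_lt_top hC

theorem FourierRep.integrable_sobolev {s s' : ℝ} (hs' : 0 ≤ s') (hs : s' < s) {u : 𝓓'(Ω, ℂ)}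
    (hu : FourierRep u) (h : MemBesovLoc s u) (χ : 𝓓(Ω, ℝ)) :
    Integrable (fun ξ => (1 + ‖ξ‖ ^ 2) ^ s' * ‖ft u χ ξ‖ ^ 2) := by
  have hpi : (2 * Real.pi : ℝ) ≠ 0 := by positivity
  have e : ∀ ξ, fourierCutoff u χ ξ = ft u χ ((2 * Real.pi)⁻¹ • ξ) := fun ξ => by
    rw [← fourierCutoff_smul, smul_smul, mul_inv_cancel₀ hpi, one_smul]
  have hcw : Continuous (fun ξ : Rn n => (1 + ‖ξ‖ ^ 2) ^ s') :=
    (by fun_prop : Continuous fun ξ : Rn n => 1 + ‖ξ‖ ^ 2).rpow_const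
      fun ξ => Or.inr hs'
  have hc : Continuous (fun ξ => (1 + ‖ξ‖ ^ 2) ^ s' * ‖fourierCutoff u χ ξ‖ ^ 2) := by
    refine hcw.mul ?_
    simp only [e]
    exact (((hu.cont χ).comp (continuous_const_smul _)).norm).pow 2
  have hi : Integrable (fun ξ => (1 + ‖ξ‖ ^ 2) ^ s' * ‖fourierCutoff u χ ξ‖ ^ 2) := by
    refine ⟨hc.aestronglyMeasurable, ?_⟩
    rw [hasFiniteIntegral_iff_ofReal (Filter.Eventually.of_forall fun ξ => by positivity)]
    exact lintegral_sobolev_lt_top hs h χ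
  -- `ft` is `fourierCutoff` at 2πξ; since 2π ≥ 1 and s' ≥ 0, the weight at 2πξ dominates the weight
  -- at ξ.
  have hi2 := hi.comp_smul hpi
  simp only [fourierCutoff_smul] at hi2
  refine hi2.mono' (hcw.mul ((hu.cont χ).norm.pow 2)).aestronglyMeasurable
    (Filter.Eventually.of_forall fun ξ => ?_)
  rw [Real.norm_of_nonneg (by positivity)]
  gcongr
  rw [norm_smul, Real.norm_of_nonneg (by positivity)]
  have := Real.pi_gt_three
  nlinarith [norm_nonneg ξ]

end Besov

/-! ### Smoothness away from the hypersurface -/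

section Smooth

open FourierTransform

theorem contDiff_of_integrable_fourier {g : Rn n → ℂ} (hc : Continuous g) (hg : Integrable g)
    (h : ∀ N : ℕ, Integrable (fun ξ => ‖ξ‖ ^ N * ‖𝓕 g ξ‖)) : ContDiff ℝ ∞ g := by
  have hcont : Continuous (𝓕 g) :=
    VectorFourier.fourierIntegral_continuous Real.continuous_fourierChar continuous_inner hg
  have h0 : Integrable (𝓕 g) := by
    rw [← integrable_norm_iff hcont.aestronglyMeasurable]
    simpa using h 0
  have h1 := hc.fourierInv_fourier_eq hg h0
  have h2 : ContDiff ℝ ∞ (𝓕 (𝓕 g)) := Real.contDiff_fourier (N := ⊤) fun N _ => h N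
  rw [← h1, Real.fourierInv_eq_fourier_comp_neg]
  have h3 : (𝓕 fun x => 𝓕 g (-x)) = fun x => 𝓕 (𝓕 g) (-x) := by
    ext x
    rw [← Real.fourierInv_eq_fourier_neg, Real.fourierInv_eq_fourier_comp_neg]
  rw [h3]
  exact h2.comp contDiff_neg

theorem sq_norm_le_two_mul (a b : ℂ) : ‖a + b‖ ^ 2 ≤ 2 * (‖a‖ ^ 2 + ‖b‖ ^ 2) := by
  have := norm_add_le a b
  nlinarith [norm_nonneg (a + b), norm_nonneg a, norm_nonneg b, sq_nonneg (‖a‖ - ‖b‖)]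

theorem SmoothVectorField.tsupport_divTest_subset (V : SmoothVectorField Ω) (χ : 𝓓(Ω, ℝ)) :
    tsupport (V.divTest χ) ⊆ tsupport χ := by
  refine closure_minimal (fun x hx => ?_) (isClosed_tsupport χ)
  by_contra hx'
  apply hx
  rw [V.divTest_apply]
  refine Finset.sum_eq_zero fun i _ => ?_
  have h0 : (fun y => χ y * V.toFun y i) =ᶠ[nhds x] fun _ => (0 : ℝ) := by
    filter_upwards [(isClosed_tsupport χ).isOpen_compl.mem_nhds hx'] with y hy
    rw [image_eq_zero_of_notMem_tsupport hy, zero_mul]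
  rw [h0.fderiv_eq]
  simp

theorem ft_zero (u : 𝓓'(Ω, ℂ)) (ξ : Rn n) : ft u 0 ξ = 0 := by
  rw [ft, ← pair_zero u]
  congr 1
  ext x
  simp

/-- The Fourier transform intertwines vector fields that are constant near the support of the
cutoff with multiplications. -/
theorem ft_act_of_eq_basisVec (V : SmoothVectorField Ω) (u : 𝓓'(Ω, ℂ)) (χ : 𝓓(Ω, ℝ)) (i : Fin n)
    (hV : ∀ x ∈ tsupport χ, V.toFun x = basisVec i) (ξ : Rn n) :
    2 * Real.pi * Complex.I * ξ i * ft u χ ξ = ft (V.act u) χ ξ + ft u (V.divTest χ) ξ := by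
  rw [ft_act, sub_add_cancel]
  have : ∀ j, mulTest (fun x => V.toFun x j) (V.contDiffOn_coord j) χ = if j = i then χ else 0 := by
    intro j
    ext x
    rw [mulTest_apply]
    by_cases hx : x ∈ tsupport χ
    · rw [hV x hx]
      split_ifs with h <;> simp [h, basisVec]
    · rw [image_eq_zero_of_notMem_tsupport hx]
      split_ifs <;> simp [image_eq_zero_of_notMem_tsupport hx]
  simp only [this]
  rw [Finset.sum_eq_single i]
  · simp
  · intro j _ hj
    simp [hj, ft_zero]
  · simp

/-- A bump function as a test function. -/
def bumpTest {q : Rn n} (b : ContDiffBump q) (h : Metric.closedBall q b.rOut ⊆ Ω) : 𝓓(Ω, ℝ) where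
  toFun := b
  contDiff' := b.contDiff
  hasCompactSupport' := b.hasCompactSupport
  tsupport_subset' := by rw [b.tsupport_eq]; exact h

/-- The product of a smooth function and a constant vector, as a vector field. -/
def smulField (Ω : Opens (Rn n)) (a : Rn n → ℝ) (ha : ContDiff ℝ ∞ a) (v : Rn n) :
    SmoothVectorField Ω where
  toFun x := a x • v
  contDiffOn := (ha.smul contDiff_const).contDiffOn

/-- Induction on N: multiplying by ξ_i replaces w by V_i w or the cutoff by div(χ V_i). Both are
covered by the induction hypothesis because L and χ are quantified inside it. -/
theorem integrable_sq_norm_mul_ft_sq {s : ℝ} (hs : 0 < s) {f : Rn n → ℂ}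
    (hf : LocallyIntegrableOn f Ω) {S : Set (Rn n)}
    (h : ∀ L : List (SmoothVectorField Ω), (∀ V ∈ L, V.IsTangent S) →
      MemBesovLoc s (L.foldr SmoothVectorField.act (ofFunction Ω f)))
    {B : Set (Rn n)} (V : Fin n → SmoothVectorField Ω) (hVS : ∀ i, (V i).IsTangent S)
    (hV : ∀ i, ∀ x ∈ B, (V i).toFun x = basisVec i) (N : ℕ) :
    ∀ L : List (SmoothVectorField Ω), (∀ V ∈ L, V.IsTangent S) → ∀ χ : 𝓓(Ω, ℝ), tsupport χ ⊆ B →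
      Integrable (fun ξ => (‖ξ‖ ^ 2) ^ N *
        ‖ft (L.foldr SmoothVectorField.act (ofFunction Ω f)) χ ξ‖ ^ 2) := by
  have hrep := fun L => (fourierRep_ofFunction hf).foldr_act L
  induction N with
  | zero =>
    intro L hL χ _
    simpa using (hrep L).integrable_sobolev le_rfl hs (h L hL) χ
  | succ N ih =>
    intro L hL χ hχ
    set w := L.foldr SmoothVectorField.act (ofFunction Ω f) with hw
    have h1 : ∀ i, Integrable (fun ξ => 2 * ((‖ξ‖ ^ 2) ^ N * ‖ft ((V i).act w) χ ξ‖ ^ 2 +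
        (‖ξ‖ ^ 2) ^ N * ‖ft w ((V i).divTest χ) ξ‖ ^ 2)) := fun i =>
      ((ih (V i :: L) (by simpa using ⟨hVS i, hL⟩) χ hχ).add
        (ih L hL _ (((V i).tsupport_divTest_subset χ).trans hχ))).const_mul 2
    refine (integrable_finsetSum Finset.univ fun i _ => h1 i).mono'
      (((by fun_prop : Continuous fun ξ : Rn n => (‖ξ‖ ^ 2) ^ (N + 1)).mul
        (((hrep L).cont χ).norm.pow 2)).aestronglyMeasurable)
      (Filter.Eventually.of_forall fun ξ => ?_)
    rw [Real.norm_of_nonneg (by positivity)]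
    have h2 : ‖ξ‖ ^ 2 = ∑ i, (ξ i) ^ 2 := by
      rw [EuclideanSpace.norm_sq_eq]; simp
    rw [pow_succ, mul_assoc, h2, Finset.sum_mul, ← h2, Finset.mul_sum]
    refine Finset.sum_le_sum fun i _ => ?_
    rw [← mul_add, ← mul_assoc, mul_comm 2, mul_assoc ((‖ξ‖ ^ 2) ^ N),
      mul_assoc ((‖ξ‖ ^ 2) ^ N)]
    refine mul_le_mul_of_nonneg_left ?_ (by positivity)
    have h3 := ft_act_of_eq_basisVec (V i) w χ i (fun x hx => hV i x (hχ hx)) ξ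
    have h4 := sq_norm_le_two_mul (ft ((V i).act w) χ ξ) (ft w ((V i).divTest χ) ξ)
    rw [← h3] at h4
    refine le_trans ?_ (h4.trans_eq (mul_comm _ _))
    rw [norm_mul, norm_mul, mul_pow, mul_pow]
    have h5 : ‖(2 * Real.pi * Complex.I : ℂ)‖ = 2 * Real.pi := by
      simp [abs_of_pos Real.pi_pos]
    rw [h5, Complex.norm_real, Real.norm_eq_abs, sq_abs]
    have h6 : 1 ≤ (2 * Real.pi) ^ 2 := by nlinarith [Real.pi_gt_three]
    nlinarith [mul_nonneg (sq_nonneg (ξ i)) (sq_nonneg ‖ft w χ ξ‖)]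

/-- A distribution that is regular along all vector fields is smooth. -/
theorem contDiffAt_of_conormal {s : ℝ} (hs : 0 < s) {f : Rn n → ℂ} (hf : ContinuousOn f Ω)
    {S : Set (Rn n)}
    (h : ∀ L : List (SmoothVectorField Ω), (∀ V ∈ L, V.IsTangent S) →
      MemBesovLoc s (L.foldr SmoothVectorField.act (ofFunction Ω f)))
    {q : Rn n} (hq : q ∈ Ω) (hqS : ∀ᶠ x in nhds q, x ∉ S) : ContDiffAt ℝ ∞ f q := by
  obtain ⟨r, hr, hball⟩ := Metric.eventually_nhds_iff_ball.1
    ((Ω.isOpen.eventually_mem hq).and hqS)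
  have hloc := hf.locallyIntegrableOn (μ := volume) Ω.isOpen.measurableSet
  let κ : ContDiffBump q := ⟨r / 3, r / 2, by positivity, by linarith⟩
  let b : ContDiffBump q := ⟨r / 4, r / 3, by positivity, by linarith⟩
  have hbΩ : Metric.closedBall q b.rOut ⊆ Ω := fun x hx =>
    (hball x (Metric.closedBall_subset_ball (show r / 3 < r by linarith) hx)).1
  let χ : 𝓓(Ω, ℝ) := bumpTest b hbΩ
  have hχ : tsupport χ ⊆ Metric.closedBall q (r / 3) := b.tsupport_eq.subset
  let V : Fin n → SmoothVectorField Ω := fun i => smulField Ω κ κ.contDiff (basisVec i)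
  have key := integrable_sq_norm_mul_ft_sq hs hloc h V
    (fun i p hp U g _ _ => by
      have : κ p = 0 := κ.zero_of_le_dist (by
        by_contra hlt
        exact (hball p (Metric.mem_ball.2 ((not_le.1 hlt).trans
          (show r / 2 < r by linarith)))).2 hp)
      simp [V, smulField, this])
    (B := Metric.closedBall q (r / 3))
    (fun i x hx => by simp [V, smulField, κ.one_of_mem_closedBall hx])
  have hgc : Continuous (fun x => (χ x : ℂ) * f x) := by
    rw [← continuousOn_univ]
    intro x _
    by_cases hx : x ∈ tsupport χ
    · exact ((Complex.continuous_ofReal.comp χ.continuous).continuousAt.mul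
        (hf.continuousAt (Ω.isOpen.mem_nhds (χ.tsupport_subset hx)))).continuousWithinAt
    · have h0 : (fun x => (χ x : ℂ) * f x) =ᶠ[nhds x] fun _ => (0 : ℂ) := by
        filter_upwards [(isClosed_tsupport χ).isOpen_compl.mem_nhds hx] with y hy
        rw [image_eq_zero_of_notMem_tsupport hy]; simp
      exact (continuousAt_const.congr h0.symm).continuousWithinAt
  have hgi : Integrable (fun x => (χ x : ℂ) * f x) := (isTest_coe χ).integrable_mul hloc
  have hfc : Continuous (𝓕 fun x => (χ x : ℂ) * f x) :=
    VectorFourier.fourierIntegral_continuous Real.continuous_fourierChar continuous_inner hgi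
  have hsm : ContDiff ℝ ∞ (fun x => (χ x : ℂ) * f x) := by
    refine contDiff_of_integrable_fourier hgc hgi fun N => ?_
    have hk := fun M => key M [] (by simp) χ hχ
    simp only [List.foldr_nil, funext (ft_ofFunction hloc χ)] at hk
    set G := 𝓕 fun x => (χ x : ℂ) * f x
    have hJ : Integrable (fun ξ : Rn n => (1 + ‖ξ‖ ^ 2) ^ (-((2 * (n + 1) : ℕ) : ℝ) / 2)) :=
      integrable_rpow_neg_one_add_norm_sq (by simp [finrank_euclideanSpace]; linarith)
    have hS := hJ.add (((hk N).add (hk (n + 1 + N))).const_mul (2 ^ n))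
    refine hS.mono' ((by fun_prop : Continuous fun ξ : Rn n => ‖ξ‖ ^ N).mul
      hfc.norm).aestronglyMeasurable (Filter.Eventually.of_forall fun ξ => ?_)
    rw [Real.norm_of_nonneg (by positivity)]
    have e1 : (1 + ‖ξ‖ ^ 2) ^ (-((2 * (n + 1) : ℕ) : ℝ) / 2) = ((1 + ‖ξ‖ ^ 2) ^ (n + 1))⁻¹ := by
      rw [← Real.rpow_natCast (1 + ‖ξ‖ ^ 2), ← Real.rpow_neg (by positivity)]
      congr 1; push_cast; ring
    have e2 := add_pow_le (zero_le_one (α := ℝ)) (sq_nonneg ‖ξ‖) (n + 1)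
    simp only [Pi.add_apply, e1]
    set J := (1 + ‖ξ‖ ^ 2) ^ (n + 1) with hJdef
    have hJ0 : 0 < J := by positivity
    -- A substitute for Cauchy-Schwarz: t ≤ J⁻¹ + J t², with J⁻¹ integrable and J t² controlled by
    -- the L² moments.
    have e3 : ‖ξ‖ ^ N * ‖G ξ‖ ≤ J⁻¹ + J * ((‖ξ‖ ^ 2) ^ N * ‖G ξ‖ ^ 2) := by
      have e4 : J * ((‖ξ‖ ^ 2) ^ N * ‖G ξ‖ ^ 2) = J * (‖ξ‖ ^ N * ‖G ξ‖) ^ 2 := by ring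
      rw [e4]
      set t := ‖ξ‖ ^ N * ‖G ξ‖
      have e5 : J * (J⁻¹ + J * t ^ 2 - t) = (J * t - 1 / 2) ^ 2 + 3 / 4 := by
        field_simp; ring
      have e6 : 0 < J⁻¹ + J * t ^ 2 - t := by
        refine pos_of_mul_pos_right (a := J) ?_ hJ0.le
        rw [e5]; positivity
      linarith
    refine e3.trans (add_le_add le_rfl ?_)
    calc J * ((‖ξ‖ ^ 2) ^ N * ‖G ξ‖ ^ 2)
        ≤ (2 ^ n * (1 + (‖ξ‖ ^ 2) ^ (n + 1))) * ((‖ξ‖ ^ 2) ^ N * ‖G ξ‖ ^ 2) := by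
          gcongr; simpa using e2
      _ = _ := by ring
  refine hsm.contDiffAt.congr_of_eventuallyEq ?_
  filter_upwards [b.eventuallyEq_one] with x hx
  have : χ x = 1 := hx
  simp [this]

end Smooth

/-! ### Shears -/

section Shear

/-- Data of a global shear: a smooth function `h` that does not depend on the coordinate `i₀`. -/
structure IsShear (i₀ : Fin n) (h : Rn n → ℝ) : Prop where
  contDiff : ContDiff ℝ ∞ h
  invariant : ∀ (x : Rn n) (t : ℝ), h (x + t • basisVec i₀) = h x

variable {i₀ : Fin n} {h : Rn n → ℝ}

/-- The shear `y ↦ y + h(y) e`. -/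
def shear (i₀ : Fin n) (h : Rn n → ℝ) (y : Rn n) : Rn n := y + h y • basisVec i₀

theorem IsShear.neg (hh : IsShear i₀ h) : IsShear i₀ (fun x => -h x) :=
  ⟨hh.contDiff.neg, fun x t => by simp [hh.invariant]⟩

theorem IsShear.contDiff_shear (hh : IsShear i₀ h) : ContDiff ℝ ∞ (shear i₀ h) :=
  contDiff_id.add (hh.contDiff.smul contDiff_const)

theorem IsShear.shear_neg_shear (hh : IsShear i₀ h) (y : Rn n) :
    shear i₀ (fun x => -h x) (shear i₀ h y) = y := by
  simp [shear, hh.invariant]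

theorem IsShear.shear_shear_neg (hh : IsShear i₀ h) (y : Rn n) :
    shear i₀ h (shear i₀ (fun x => -h x) y) = y := by
  have := hh.neg.shear_neg_shear y
  simpa using this

theorem IsShear.shear_add (hh : IsShear i₀ h) (y : Rn n) (t : ℝ) :
    shear i₀ h (y + t • basisVec i₀) = shear i₀ h y + t • basisVec i₀ := by
  simp only [shear, hh.invariant]
  abel

theorem IsShear.apply_shear (hh : IsShear i₀ h) (y : Rn n) : h (shear i₀ h y) = h y :=
  hh.invariant _ _

theorem IsShear.fderiv_basisVec (hh : IsShear i₀ h) (x : Rn n) :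
    fderiv ℝ h x (basisVec i₀) = 0 := by
  have h1 : HasLineDerivAt ℝ h (fderiv ℝ h x (basisVec i₀)) x (basisVec i₀) :=
    ((hh.contDiff.differentiable (by simp)).differentiableAt.hasFDerivAt).hasLineDerivAt _
  have h2 : HasLineDerivAt ℝ h 0 x (basisVec i₀) := by
    simp only [HasLineDerivAt, hh.invariant]
    exact hasDerivAt_const _ _
  exact HasDerivAt.unique h1 h2

theorem IsShear.hasFDerivAt_shear (hh : IsShear i₀ h) (x : Rn n) :
    HasFDerivAt (shear i₀ h)
      (ContinuousLinearMap.id ℝ (Rn n) + (fderiv ℝ h x).smulRight (basisVec i₀)) x :=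
  (hasFDerivAt_id x).add
    (((hh.contDiff.differentiable (by simp)).differentiableAt.hasFDerivAt).smul_const _)

/-- The derivative of a shear is a transvection, since dh annihilates the shearing direction; its
determinant is 1. -/
theorem IsShear.measurePreserving (hh : IsShear i₀ h) :
    MeasurePreserving (shear i₀ h) volume volume := by
  have hm : Measurable (shear i₀ h) := hh.contDiff_shear.continuous.measurable
  refine ⟨hm, Measure.ext fun s hs => ?_⟩
  rw [Measure.map_apply hm hs]
  have e : shear i₀ h ⁻¹' s = shear i₀ (fun x => -h x) '' s := by
    ext y
    constructor
    · intro hy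
      exact ⟨_, hy, hh.shear_neg_shear y⟩
    · rintro ⟨x, hx, rfl⟩
      rw [mem_preimage, hh.shear_shear_neg]
      exact hx
  rw [e, ← lintegral_abs_det_fderiv_eq_addHaar_image volume hs
    (fun x _ => (hh.neg.hasFDerivAt_shear x).hasFDerivWithinAt)
    (Function.LeftInverse.injective hh.shear_shear_neg).injOn]
  have hdet : ∀ x, (ContinuousLinearMap.id ℝ (Rn n) +
      (fderiv ℝ (fun x => -h x) x).smulRight (basisVec i₀)).det = 1 := by
    intro x
    have : ((ContinuousLinearMap.id ℝ (Rn n) +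
        (fderiv ℝ (fun x => -h x) x).smulRight (basisVec i₀) : Rn n →L[ℝ] Rn n) :
        Rn n →ₗ[ℝ] Rn n) = LinearMap.transvection
          ((fderiv ℝ (fun x => -h x) x : Rn n →L[ℝ] ℝ) : Rn n →ₗ[ℝ] ℝ) (basisVec i₀) := by
      ext v
      simp [LinearMap.transvection.apply]
    rw [ContinuousLinearMap.det, this, LinearMap.transvection.det]
    simp [hh.fderiv_basisVec]
  simp only [hdet]
  simp

theorem IsShear.measurableEmbedding (hh : IsShear i₀ h) : MeasurableEmbedding (shear i₀ h) :=
  (MeasurableEquiv.mk ⟨shear i₀ h, shear i₀ (fun x => -h x), hh.shear_neg_shear,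
    hh.shear_shear_neg⟩ hh.contDiff_shear.continuous.measurable
    hh.neg.contDiff_shear.continuous.measurable).measurableEmbedding

/-- The function `x ↦ x_{i₀} - h(x)`, which defines the graph of `h`. -/
def graphFun (i₀ : Fin n) (h : Rn n → ℝ) (x : Rn n) : ℝ := x i₀ - h x

theorem contDiff_coord (i : Fin n) : ContDiff ℝ ∞ (fun x : Rn n => x i) :=
  (EuclideanSpace.proj (𝕜 := ℝ) i).contDiff

theorem IsShear.contDiff_graphFun (hh : IsShear i₀ h) : ContDiff ℝ ∞ (graphFun i₀ h) :=
  (contDiff_coord i₀).sub hh.contDiff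

theorem IsShear.graphFun_shear (hh : IsShear i₀ h) (y : Rn n) :
    graphFun i₀ h (shear i₀ h y) = y i₀ := by
  rw [graphFun, hh.apply_shear]
  simp [shear, basisVec]

theorem IsShear.graphFun_add (hh : IsShear i₀ h) (x : Rn n) (t : ℝ) :
    graphFun i₀ h (x + t • basisVec i₀) = graphFun i₀ h x + t := by
  simp [graphFun, hh.invariant, basisVec]
  ring

theorem shear_neg_apply (x : Rn n) : shear i₀ (fun x => -h x) x i₀ = graphFun i₀ h x := by
  simp [shear, graphFun, basisVec, sub_eq_add_neg]

theorem IsShear.fderiv_graphFun (hh : IsShear i₀ h) (x v : Rn n) :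
    fderiv ℝ (graphFun i₀ h) x v = v i₀ - fderiv ℝ h x v := by
  have h1 : HasFDerivAt (fun x : Rn n => x i₀) (EuclideanSpace.proj (𝕜 := ℝ) i₀) x :=
    (EuclideanSpace.proj (𝕜 := ℝ) i₀).hasFDerivAt
  have := h1.sub ((hh.contDiff.differentiable (by simp)).differentiableAt (x := x)).hasFDerivAt
  refine (DFunLike.congr_fun this.fderiv v).trans ?_
  simp

theorem IsShear.fderiv_graphFun_basisVec (hh : IsShear i₀ h) (x : Rn n) :
    fderiv ℝ (graphFun i₀ h) x (basisVec i₀) = 1 := by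
  rw [hh.fderiv_graphFun, hh.fderiv_basisVec]
  simp [basisVec]

theorem IsShear.volume_graph (hh : IsShear i₀ h) : volume {x : Rn n | graphFun i₀ h x = 0} = 0 := by
  have h1 : volume {y : Rn n | y i₀ = 0} = 0 := by
    have := Measure.addHaar_submodule volume
      (LinearMap.ker (EuclideanSpace.proj (𝕜 := ℝ) i₀ : Rn n →L[ℝ] ℝ).toLinearMap) (by
        intro htop
        have : basisVec i₀ ∈ LinearMap.ker
            (EuclideanSpace.proj (𝕜 := ℝ) i₀ : Rn n →L[ℝ] ℝ).toLinearMap := by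
          rw [htop]; trivial
        simp [basisVec] at this)
    convert! this using 2
  have hms : MeasurableSet {y : Rn n | y i₀ = 0} :=
    ((contDiff_coord i₀).continuous.measurable) (measurableSet_singleton 0)
  rw [← hh.neg.measurePreserving.measure_preimage hms.nullMeasurableSet] at h1
  convert! h1 using 2
  ext x
  simp [shear_neg_apply]

/-- The vector field `∂_i + (∂_i h) ∂_{i₀}`. -/
def graphField (i₀ : Fin n) (h : Rn n → ℝ) (i : Fin n) (x : Rn n) : Rn n :=
  basisVec i + (fderiv ℝ h x (basisVec i)) • basisVec i₀

theorem IsShear.contDiff_graphField (hh : IsShear i₀ h) (i : Fin n) :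
    ContDiff ℝ ∞ (graphField i₀ h i) :=
  contDiff_const.add (((hh.contDiff.fderiv_right (m := ∞) (by norm_cast)).clm_apply
    contDiff_const).smul contDiff_const)

/-- The inverse shear flattens the graph and turns these tangential fields into coordinate fields,
which the Fourier transform diagonalizes. -/
theorem IsShear.fderiv_shear_neg_graphField (hh : IsShear i₀ h) (i : Fin n) (x : Rn n) :
    fderiv ℝ (shear i₀ (fun x => -h x)) x (graphField i₀ h i x) = basisVec i := by
  rw [(hh.neg.hasFDerivAt_shear x).fderiv]
  simp [graphField, hh.fderiv_basisVec]

end Shear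

/-! ### Graph charts of hypersurfaces -/

/-- Near `p`, the hypersurface `S` is the graph of `h` over the coordinates other than `i₀`. -/
structure IsGraphChart (S U : Set (Rn n)) (i₀ : Fin n) (h : Rn n → ℝ) : Prop extends
    IsShear i₀ h where
  isOpen : IsOpen U
  mem_iff : ∀ x ∈ U, x ∈ S ↔ graphFun i₀ h x = 0

theorem IsGraphChart.isDefiningFunction {S U : Set (Rn n)} {i₀ : Fin n} {h : Rn n → ℝ}
    (hc : IsGraphChart S U i₀ h) : IsDefiningFunction S U (graphFun i₀ h) :=
  ⟨hc.isOpen, hc.contDiff_graphFun.contDiffOn, hc.mem_iff, fun x _ _ h0 => by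
    have := hc.fderiv_graphFun_basisVec x
    rw [h0] at this
    simp at this⟩

/-- The implicit function theorem, obtained by inverting the map F that replaces the coordinate i₀
by g: it carries S to the hyperplane y_{i₀} = 0. The graph function is the i₀-th coordinate of the
inverse, composed with the projection π along e so that it is invariant in that direction. -/
theorem exists_graphChart {S U : Set (Rn n)} {g : Rn n → ℝ} (hg : IsDefiningFunction S U g)
    {p : Rn n} (hpU : p ∈ U) (hpS : p ∈ S) :
    ∃ (i₀ : Fin n) (h : Rn n → ℝ) (U' : Set (Rn n)), p ∈ U' ∧ U' ⊆ U ∧ IsGraphChart S U' i₀ h := by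
  have hi : ∃ i₀, fderiv ℝ g p (basisVec i₀) ≠ 0 := by
    by_contra! hcon
    refine hg.fderiv_ne_zero p hpU hpS ?_
    ext v
    conv_lhs => rw [euclidean_eq_sum v]
    simp [map_sum, hcon]
  obtain ⟨i₀, hi₀⟩ := hi
  set e := basisVec i₀ with he
  have hei : e i₀ = 1 := by simp [he, basisVec]
  have hgp : g p = 0 := (hg.mem_iff p hpU).1 hpS
  set F : Rn n → Rn n := fun x => x + (g x - x i₀) • e with hF
  have hgd : ∀ x ∈ U, HasFDerivAt g (fderiv ℝ g x) x := fun x hx =>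
    ((hg.contDiffOn.contDiffAt (hg.isOpen.mem_nhds hx)).differentiableAt (by simp)).hasFDerivAt
  have hFc : ∀ x ∈ U, ContDiffAt ℝ ∞ F x := fun x hx =>
    contDiffAt_id.add (((hg.contDiffOn.contDiffAt (hg.isOpen.mem_nhds hx)).sub
      (contDiff_coord i₀).contDiffAt).smul contDiffAt_const)
  have hFd : ∀ x ∈ U, fderiv ℝ g x e ≠ 0 → ∃ A : Rn n ≃L[ℝ] Rn n,
      HasFDerivAt F (A : Rn n →L[ℝ] Rn n) x := by
    intro x hx hne
    set A₀ : Rn n →L[ℝ] Rn n := ContinuousLinearMap.id ℝ (Rn n) +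
      (fderiv ℝ g x - EuclideanSpace.proj (𝕜 := ℝ) i₀).smulRight e with hA₀
    have hinj : Function.Injective A₀.toLinearMap := by
      rw [injective_iff_map_eq_zero]
      intro v hv
      have hv' : v + (fderiv ℝ g x v - v i₀) • e = 0 := by simpa [hA₀] using hv
      have hve : v = (v i₀ - fderiv ℝ g x v) • e := by
        rw [← sub_eq_zero, ← hv', sub_eq_add_neg, ← neg_smul, neg_sub]
      set c := v i₀ - fderiv ℝ g x v with hc
      have h1 : v i₀ = c := by rw [hve]; simp [hei]
      have h2 : fderiv ℝ g x v = 0 := by linarith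
      rw [hve, map_smul, smul_eq_mul] at h2
      rw [hve, (mul_eq_zero.1 h2).resolve_right hne, zero_smul]
    refine ⟨(LinearEquiv.ofInjectiveEndo A₀.toLinearMap hinj).toContinuousLinearEquiv, ?_⟩
    have h1 : HasFDerivAt F A₀ x := (hasFDerivAt_id x).add
      (((hgd x hx).sub (EuclideanSpace.proj (𝕜 := ℝ) i₀).hasFDerivAt).smul_const e)
    convert! h1 using 1
  obtain ⟨A, hA⟩ := hFd p hpU hi₀
  set φ := (hFc p hpU).toOpenPartialHomeomorph F hA (by simp) with hφ
  have hφF : ∀ x, φ x = F x := fun _ => rfl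
  have hpφ : p ∈ φ.source := (hFc p hpU).mem_toOpenPartialHomeomorph_source hA (by simp)
  -- the projection along `e`
  set π : Rn n → Rn n := fun x => x - x i₀ • e with hπ
  have hπc : ContDiff ℝ ∞ π := contDiff_id.sub ((contDiff_coord i₀).smul contDiff_const)
  have hFp : F p = π p := by simp only [hF, hπ, hgp]; rw [zero_sub, neg_smul, sub_eq_add_neg]
  have hpt : π p ∈ φ.target := by rw [← hFp]; exact φ.map_source hpφ
  have hsp : φ.symm (π p) = p := by rw [← hFp]; exact φ.left_inv hpφ
  -- a neighbourhood of `π p` on which the inverse is smooth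
  have hne : ∀ᶠ x in nhds p, x ∈ U ∧ fderiv ℝ g x e ≠ 0 := by
    refine (hg.isOpen.eventually_mem hpU).and ?_
    have hcont : ContinuousAt (fun x => fderiv ℝ g x e) p :=
      (((hg.contDiffOn.continuousOn_fderiv_of_isOpen hg.isOpen (by simp)).continuousAt
        (hg.isOpen.mem_nhds hpU))).clm_apply continuousAt_const
    exact hcont.eventually_ne hi₀
  have hev : ∀ᶠ z in nhds (π p), z ∈ φ.target ∧ (φ.symm z ∈ U ∧ fderiv ℝ g (φ.symm z) e ≠ 0) := by
    refine (φ.open_target.eventually_mem hpt).and ?_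
    have := φ.continuousAt_symm hpt
    rw [ContinuousAt, hsp] at this
    exact this.eventually hne
  obtain ⟨r, hr, hball⟩ := Metric.eventually_nhds_iff_ball.1 hev
  have hsmooth : ∀ z ∈ Metric.ball (π p) r, ContDiffAt ℝ ∞ φ.symm z := by
    intro z hz
    obtain ⟨h1, h2, h3⟩ := hball z hz
    obtain ⟨A', hA'⟩ := hFd _ h2 h3
    exact φ.contDiffAt_symm h1 hA' (hFc _ h2)
  let κ : ContDiffBump (π p) := ⟨r / 3, r / 2, by positivity, by linarith⟩
  -- The local inverse is smooth only near π p; the bump makes h globally smooth, so that the shear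
  -- is defined on the whole space.
  set h₀ : Rn n → ℝ := fun z => κ z * φ.symm z i₀ with hh₀
  have hh₀c : ContDiff ℝ ∞ h₀ := by
    rw [contDiff_iff_contDiffAt]
    intro z
    by_cases hz : z ∈ Metric.ball (π p) r
    · exact κ.contDiffAt.mul ((contDiff_coord i₀).contDiffAt.comp z (hsmooth z hz))
    · have hz' : z ∈ (tsupport κ)ᶜ := fun h => by
        rw [κ.tsupport_eq] at h
        exact hz (Metric.closedBall_subset_ball (show r / 2 < r by linarith) h)
      have h0 : h₀ =ᶠ[nhds z] fun _ => (0 : ℝ) := by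
        filter_upwards [(isClosed_tsupport κ).isOpen_compl.mem_nhds hz'] with y hy
        rw [hh₀]
        simp only
        rw [image_eq_zero_of_notMem_tsupport hy, zero_mul]
      exact contDiffAt_const.congr_of_eventuallyEq h0
  have hπe : ∀ x (t : ℝ), π (x + t • e) = π x := by
    intro x t
    simp only [hπ, PiLp.add_apply, PiLp.smul_apply, hei, smul_eq_mul, mul_one, add_smul]
    abel
  have hev2 : ∀ᶠ x in nhds p, x ∈ U ∧ x ∈ φ.source ∧ π x ∈ Metric.ball (π p) (r / 3) := by
    refine (hg.isOpen.eventually_mem hpU).and ((φ.open_source.eventually_mem hpφ).and ?_)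
    exact hπc.continuous.continuousAt.eventually (Metric.ball_mem_nhds _ (by positivity))
  obtain ⟨r', hr', hball'⟩ := Metric.eventually_nhds_iff_ball.1 hev2
  refine ⟨i₀, fun x => h₀ (π x), Metric.ball p r', Metric.mem_ball_self hr',
    fun x hx => (hball' x hx).1, ⟨hh₀c.comp hπc, fun x t => by
      rw [← he, hπe]⟩, Metric.isOpen_ball, fun x hx => ?_⟩
  obtain ⟨hxU, hxs, hxπ⟩ := hball' x hx
  have hκ : κ (π x) = 1 := κ.one_of_mem_closedBall (Metric.ball_subset_closedBall hxπ)
  rw [hg.mem_iff x hxU, graphFun, hh₀]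
  simp only [hκ, one_mul]
  have hxt : π x ∈ φ.target := (hball _ (Metric.ball_subset_ball (by linarith) hxπ)).1
  constructor
  · intro h0
    have : F x = π x := by simp only [hF, hπ, h0]; rw [zero_sub, neg_smul, sub_eq_add_neg]
    rw [← this, ← hφF, φ.left_inv hxs, sub_self]
  · intro h0
    set z := φ.symm (π x) with hz
    have hFz : F z = π x := φ.right_inv hxt
    have hzx : z = x := by
      have h1 : z + (g z - z i₀) • e = x - x i₀ • e := hFz
      have h2 := congrArg (fun v : Rn n => v i₀) h1
      simp only [PiLp.add_apply, PiLp.sub_apply, PiLp.smul_apply, hei, smul_eq_mul, mul_one] at h2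
      have h3 : g z - z i₀ = -x i₀ := by linarith
      rw [h3, neg_smul, ← sub_eq_add_neg] at h1
      exact sub_left_injective h1
    have h1 : z + (g z - z i₀) • e = x - x i₀ • e := hFz
    have h2 := congrArg (fun v : Rn n => v i₀) h1
    simp only [PiLp.add_apply, PiLp.sub_apply, PiLp.smul_apply, hei, smul_eq_mul, mul_one] at h2
    rw [← hzx]
    linarith

/-- Near a point of a hypersurface, tangent vector fields differentiate the defining function to
multiples of it. -/
theorem IsGraphChart.fderiv_graphFun_isBigO {S U : Set (Rn n)} {i₀ : Fin n} {h : Rn n → ℝ}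
    (hc : IsGraphChart S U i₀ h) {V : SmoothVectorField Ω} (hV : V.IsTangent S) {p : Rn n}
    (hp : p ∈ S) (hpU : p ∈ U) (hpΩ : p ∈ Ω) :
    ∃ C : ℝ, ∀ᶠ x in nhds p, |fderiv ℝ (graphFun i₀ h) x (V.toFun x)| ≤ C * |graphFun i₀ h x| := by
  set a : Rn n → ℝ := fun x => fderiv ℝ (graphFun i₀ h) x (V.toFun x) with ha
  have hac : ContDiffAt ℝ 1 a p := by
    have h1 : ContDiffAt ℝ ∞ a p :=
      ((hc.contDiff_graphFun.fderiv_right (m := ∞) (by norm_cast)).contDiffAt).clm_apply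
        (V.contDiffOn.contDiffAt (Ω.isOpen.mem_nhds hpΩ))
    exact h1.of_le (by norm_cast)
  obtain ⟨K, t, ht, hK⟩ := hac.exists_lipschitzOnWith
  have hcont : Continuous (fun x => x - graphFun i₀ h x • basisVec i₀) :=
    continuous_id.sub (hc.contDiff_graphFun.continuous.smul continuous_const)
  have hgp : graphFun i₀ h p = 0 := (hc.mem_iff p hpU).1 hp
  have hlim : Filter.Tendsto (fun x => x - graphFun i₀ h x • basisVec i₀) (nhds p) (nhds p) := by
    have := hcont.tendsto p
    simpa [hgp] using this
  refine ⟨K, ?_⟩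
  filter_upwards [ht, hlim.eventually ht, hlim.eventually (hc.isOpen.eventually_mem hpU)]
    with x h1 h2 h3
  -- x' is the point of S reached from x along the direction i₀. It is at distance |g(x)|, and the
  -- Lipschitz function V g vanishes there.
  set x' := x - graphFun i₀ h x • basisVec i₀ with hx'
  have h4 : graphFun i₀ h x' = 0 := by
    have := hc.graphFun_add x (-graphFun i₀ h x)
    rw [neg_smul, ← sub_eq_add_neg] at this
    rw [hx', this]; ring
  have h5 : a x' = 0 := hV x' ((hc.mem_iff x' h3).2 h4) U _ h3 hc.isDefiningFunction
  have h6 := hK.dist_le_mul x h1 x' h2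
  rw [h5, Real.dist_eq, sub_zero] at h6
  refine h6.trans_eq ?_
  rw [dist_eq_norm, hx', sub_sub_cancel, norm_smul, Real.norm_eq_abs]
  simp [basisVec]

/-- A vector field as in the definition of `graphField`, cut off to a chart. -/
def cutoffField (Ω : Opens (Rn n)) (κ : Rn n → ℝ) (hκ : ContDiff ℝ ∞ κ) {i₀ : Fin n}
    {h : Rn n → ℝ} (hh : IsShear i₀ h) (i : Fin n) : SmoothVectorField Ω where
  toFun x := κ x • graphField i₀ h i x
  contDiffOn := (hκ.smul (hh.contDiff_graphField i)).contDiffOn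

theorem IsGraphChart.isTangent_cutoffField {S U : Set (Rn n)} {i₀ : Fin n} {h : Rn n → ℝ}
    (hc : IsGraphChart S U i₀ h) {κ : Rn n → ℝ} (hκ : ContDiff ℝ ∞ κ)
    (hκU : ∀ x, κ x ≠ 0 → x ∈ U) {i : Fin n} (hi : i ≠ i₀) :
    (cutoffField Ω κ hκ hc.toIsShear i).IsTangent S := by
  intro p hp U' g hpU' hg
  change fderiv ℝ g p (κ p • graphField i₀ h i p) = 0
  by_cases h0 : κ p = 0
  · simp [h0]
  rw [map_smul]
  have hpU := hκU p h0
  have hgp : graphFun i₀ h p = 0 := (hc.mem_iff p hpU).1 hp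
  have hei : basisVec i i₀ = 0 := by simp [basisVec, hi.symm]
  -- Tangency has to be tested against an arbitrary defining function g. The curve c stays in S near
  -- p and has the field as its velocity at p, so g ∘ c = 0 can be differentiated.
  set c : ℝ → Rn n := fun s =>
    p + s • basisVec i + (h (p + s • basisVec i) - h p) • basisVec i₀ with hcdef
  have hc0 : c 0 = p := by simp [hcdef]
  have hder : HasDerivAt c (graphField i₀ h i p) 0 := by
    have h1 : HasDerivAt (fun s : ℝ => p + s • basisVec i) (basisVec i) 0 := by
      simpa using ((hasDerivAt_id (0 : ℝ)).smul_const (basisVec i)).const_add p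
    have h2 : HasDerivAt (fun s : ℝ => h (p + s • basisVec i)) (fderiv ℝ h p (basisVec i)) 0 := by
      have h3 : HasFDerivAt h (fderiv ℝ h p) (p + (0 : ℝ) • basisVec i) := by
        rw [zero_smul, add_zero]
        exact (hc.contDiff.differentiable (by simp)).differentiableAt.hasFDerivAt
      exact h3.comp_hasDerivAt 0 h1
    exact h1.add ((h2.sub_const (h p)).smul_const _)
  have hccont : Filter.Tendsto c (nhds 0) (nhds p) := by
    have := hder.continuousAt.tendsto
    rwa [hc0] at this
  have hzero : (fun s => g (c s)) =ᶠ[nhds 0] fun _ => 0 := by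
    filter_upwards [hccont.eventually (hc.isOpen.eventually_mem hpU),
      hccont.eventually (hg.isOpen.eventually_mem hpU')] with s h1 h2
    rw [← hg.mem_iff _ h2, hc.mem_iff _ h1, hcdef]
    simp only
    rw [hc.graphFun_add]
    simp only [graphFun, PiLp.add_apply, PiLp.smul_apply, hei] at hgp ⊢
    simp only [smul_zero, add_zero]
    linarith
  have hgd : HasFDerivAt g (fderiv ℝ g p) (c 0) := by
    rw [hc0]
    exact ((hg.contDiffOn.contDiffAt (hg.isOpen.mem_nhds hpU')).differentiableAt
      (by simp)).hasFDerivAt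
  have h3 := hgd.comp_hasDerivAt 0 hder
  have h4 : HasDerivAt (g ∘ c) 0 0 := (hasDerivAt_const (0 : ℝ) (0 : ℝ)).congr_of_eventuallyEq hzero
  rw [h3.unique h4, smul_zero]

theorem IsGraphChart.isTangent_smulField {S U : Set (Rn n)} {i₀ : Fin n} {h : Rn n → ℝ}
    (hc : IsGraphChart S U i₀ h) {κ : Rn n → ℝ} (hκ : ContDiff ℝ ∞ κ)
    (hκU : ∀ x, κ x ≠ 0 → x ∈ U) (v : Rn n) :
    (smulField Ω (fun x => κ x * graphFun i₀ h x) (hκ.mul hc.contDiff_graphFun) v).IsTangent S := by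
  intro p hp U' g _ _
  change fderiv ℝ g p ((κ p * graphFun i₀ h p) • v) = 0
  by_cases h0 : κ p = 0
  · simp [h0]
  · simp [(hc.mem_iff p (hκU p h0)).1 hp]

/-! ### Differences and Fourier transforms of sheared functions -/

section Difference

open FourierTransform
open scoped ENNReal

/-- The difference operator in direction `v`. -/
def diffOp (v : Rn n) (f : Rn n → ℂ) (x : Rn n) : ℂ := f (x + v) - f x

theorem integrable_diffOp (v : Rn n) {f : Rn n → ℂ} (hf : Integrable f) : Integrable (diffOp v f) :=
  (hf.comp_add_right v).sub hf

theorem memLp_diffOp (v : Rn n) {f : Rn n → ℂ} (hf : MemLp f 2) : MemLp (diffOp v f) 2 :=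
  (hf.comp_measurePreserving (measurePreserving_add_right volume v)).sub hf

theorem fourier_diffOp (v : Rn n) {f : Rn n → ℂ} (hf : Integrable f) (ξ : Rn n) :
    𝓕 (diffOp v f) ξ = (Complex.exp (Complex.I * (2 * Real.pi * inner ℝ v ξ : ℝ)) - 1) * 𝓕 f ξ := by
  have h1 : 𝓕 (fun x => f (x + v)) ξ = Complex.exp (Complex.I * (2 * Real.pi * inner ℝ v ξ : ℝ)) *
      𝓕 f ξ := by
    have := congrFun (VectorFourier.fourierIntegral_comp_add_right Real.fourierChar
      (volume : Measure (Rn n)) (innerₗ (Rn n)) f v) ξ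
    refine this.trans ?_
    rw [Circle.smul_def, smul_eq_mul, Real.fourierChar_apply]
    congr 2
    simp only [innerₗ_apply_apply]
    push_cast
    ring
  have h2 : 𝓕 (diffOp v f) ξ = 𝓕 (fun x => f (x + v)) ξ - 𝓕 f ξ := by
    simp only [fourier_eq_expo, diffOp, sub_mul]
    have hb : ∀ {g : Rn n → ℂ}, Integrable g → Integrable (fun x => g x * expo ξ x) := fun hg =>
      hg.mul_bdd (c := 1) (contDiff_expo ξ).continuous.aestronglyMeasurable
        (Filter.Eventually.of_forall fun x => (norm_expo ξ x).le)
    exact integral_sub (hb (hf.comp_add_right v)) (hb hf)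
  rw [h2, h1]; ring

theorem integrable_iterate_diffOp (v : Rn n) {f : Rn n → ℂ} (hf : Integrable f) (M : ℕ) :
    Integrable ((diffOp v)^[M] f) := by
  induction M with
  | zero => exact hf
  | succ M ih => rw [Function.iterate_succ_apply']; exact integrable_diffOp v ih

theorem memLp_iterate_diffOp (v : Rn n) {f : Rn n → ℂ} (hf : MemLp f 2) (M : ℕ) :
    MemLp ((diffOp v)^[M] f) 2 := by
  induction M with
  | zero => exact hf
  | succ M ih => rw [Function.iterate_succ_apply']; exact memLp_diffOp v ih

theorem fourier_iterate_diffOp (v : Rn n) {f : Rn n → ℂ} (hf : Integrable f) (M : ℕ) (ξ : Rn n) :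
    𝓕 ((diffOp v)^[M] f) ξ =
      (Complex.exp (Complex.I * (2 * Real.pi * inner ℝ v ξ : ℝ)) - 1) ^ M * 𝓕 f ξ := by
  induction M with
  | zero => simp
  | succ M ih =>
    rw [Function.iterate_succ_apply', fourier_diffOp v (integrable_iterate_diffOp v hf M), ih]
    ring

theorem lintegral_fourier_sq {f : Rn n → ℂ} (hf : Integrable f) (hf2 : MemLp f 2) :
    ∫⁻ ξ, ENNReal.ofReal (‖𝓕 f ξ‖ ^ 2) = ENNReal.ofReal (∫ x, ‖f x‖ ^ 2) := by
  obtain ⟨h1, h2⟩ := fourier_memLp_two hf hf2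
  rw [← h2, ofReal_integral_eq_lintegral_ofReal
    ((memLp_two_iff_integrable_sq_norm h1.1).1 h1) (Filter.Eventually.of_forall fun _ => by positivity)]

/-- Translations along i₀ commute with the shear, which preserves measure, so iterated differences
before and after shearing have the same L² norm. Plancherel turns those norms into these
multipliers. -/
theorem lintegral_diff_fourier_shear {i₀ : Fin n} {h : Rn n → ℝ} (hh : IsShear i₀ h)
    {f : Rn n → ℂ} (hf : Integrable f) (hf2 : MemLp f 2) (M : ℕ) (t : ℝ) :
    ∫⁻ ξ : Rn n, ENNReal.ofReal
      (‖Complex.exp (Complex.I * (2 * Real.pi * (t * ξ i₀) : ℝ)) - 1‖ ^ (2 * M) *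
        ‖𝓕 (f ∘ shear i₀ h) ξ‖ ^ 2) =
    ∫⁻ ξ : Rn n, ENNReal.ofReal
      (‖Complex.exp (Complex.I * (2 * Real.pi * (t * ξ i₀) : ℝ)) - 1‖ ^ (2 * M) *
        ‖𝓕 f ξ‖ ^ 2) := by
  set v : Rn n := t • basisVec i₀ with hv
  have hin : ∀ ξ : Rn n, inner ℝ v ξ = t * ξ i₀ := fun ξ => by
    rw [hv, real_inner_smul_left, inner_basisVec_left]
  have hmp := hh.measurePreserving
  have hfs : Integrable (f ∘ shear i₀ h) := hmp.integrable_comp_of_integrable hf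
  have hfs2 : MemLp (f ∘ shear i₀ h) 2 := hf2.comp_measurePreserving hmp
  have key : ∀ {g : Rn n → ℂ}, Integrable g → MemLp g 2 →
      ∫⁻ ξ : Rn n, ENNReal.ofReal
        (‖Complex.exp (Complex.I * (2 * Real.pi * (t * ξ i₀) : ℝ)) - 1‖ ^ (2 * M) *
          ‖𝓕 g ξ‖ ^ 2) = ENNReal.ofReal (∫ x, ‖(diffOp v)^[M] g x‖ ^ 2) := by
    intro g hg hg2
    rw [← lintegral_fourier_sq (integrable_iterate_diffOp v hg M) (memLp_iterate_diffOp v hg2 M)]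
    refine lintegral_congr fun ξ => ?_
    rw [fourier_iterate_diffOp v hg, hin, norm_mul, norm_pow, mul_pow, ← pow_mul, mul_comm M 2]
  rw [key hf hf2, key hfs hfs2]
  congr 1
  have hcomm : ∀ M, (diffOp v)^[M] (f ∘ shear i₀ h) = ((diffOp v)^[M] f) ∘ shear i₀ h := by
    intro M
    induction M with
    | zero => rfl
    | succ M ih =>
      rw [Function.iterate_succ_apply', ih, Function.iterate_succ_apply']
      ext y
      simp only [diffOp, Function.comp, hv, hh.shear_add]
  rw [hcomm]
  exact hmp.integral_comp hh.measurableEmbedding (fun x => ‖(diffOp v)^[M] f x‖ ^ 2)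

/-- Interpolates between |e^{2πiα} - 1| ≤ 2π|α| for small α and the bound 2 ≤ 2π for large α. -/
theorem norm_exp_sub_one_pow_le {M : ℕ} {s : ℝ} (hs : 0 ≤ s) (hM : s ≤ M) (α : ℝ) :
    ‖Complex.exp (Complex.I * (2 * Real.pi * α : ℝ)) - 1‖ ^ (2 * M) ≤
      (2 * Real.pi) ^ (2 * M) * (α ^ 2) ^ s := by
  have h1 : ‖Complex.exp (Complex.I * (2 * Real.pi * α : ℝ)) - 1‖ ≤ 2 * Real.pi * |α| := by
    refine (Real.norm_exp_I_mul_ofReal_sub_one_le).trans_eq ?_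
    rw [Real.norm_eq_abs, abs_mul, abs_of_pos (by positivity)]
  have h2 : ‖Complex.exp (Complex.I * (2 * Real.pi * α : ℝ)) - 1‖ ≤ 2 * Real.pi := by
    refine (norm_sub_le _ _).trans ?_
    rw [mul_comm Complex.I, Complex.norm_exp_ofReal_mul_I, norm_one]
    linarith [Real.pi_gt_three]
  rcases le_total |α| 1 with h | h
  · have h3 : |α| ^ (2 * M) ≤ (α ^ 2) ^ s := by
      rw [← sq_abs, ← Real.rpow_natCast, ← Real.rpow_natCast, ← Real.rpow_mul (abs_nonneg _)]
      rcases (abs_nonneg α).eq_or_lt with h0 | h0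
      · rw [← h0]
        rcases hs.eq_or_lt with hs0 | hs0
        · rw [← hs0]
          simp only [mul_zero, Real.rpow_zero]
          exact Real.rpow_le_one le_rfl zero_le_one (by positivity)
        · have : 0 < (M : ℝ) := hs0.trans_le hM
          have hM0 : ((2 * M : ℕ) : ℝ) ≠ 0 := by push_cast; positivity
          have hs2 : ((2 : ℕ) : ℝ) * s ≠ 0 := by push_cast; positivity
          rw [Real.zero_rpow hM0, Real.zero_rpow hs2]
      · refine Real.rpow_le_rpow_of_exponent_ge h0 h ?_
        push_cast
        linarith
    calc _ ≤ (2 * Real.pi * |α|) ^ (2 * M) := by gcongr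
      _ = (2 * Real.pi) ^ (2 * M) * |α| ^ (2 * M) := mul_pow _ _ _
      _ ≤ _ := by gcongr
  · have h3 : 1 ≤ (α ^ 2) ^ s := by
      refine Real.one_le_rpow ?_ hs
      rw [← sq_abs]
      exact one_le_pow₀ h
    calc _ ≤ (2 * Real.pi) ^ (2 * M) := by gcongr
      _ ≤ _ := le_mul_of_one_le_right (by positivity) h3

/-- Some dyadic scale puts α = 2^(-j)θ in 1/4 ≤ |α| ≤ 1/2, where |e^{2πiα} - 1| = 2 sin(π|α|) ≥ 4|α|
≥ 1. -/
theorem exists_one_le_norm_exp_sub_one {θ : ℝ} (hθ : 1 / 2 ≤ |θ|) :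
    ∃ j : ℕ, |θ| ≤ 2 ^ j / 2 ∧
      1 ≤ ‖Complex.exp (Complex.I * (2 * Real.pi * ((2 ^ j)⁻¹ * θ) : ℝ)) - 1‖ := by
  obtain ⟨k, h1, h2⟩ := exists_nat_pow_near (show 1 ≤ 2 * |θ| by linarith) (one_lt_two)
  refine ⟨k + 1, by linarith, ?_⟩
  rw [Complex.norm_exp_I_mul_ofReal_sub_one]
  set α := ((2 : ℝ) ^ (k + 1))⁻¹ * θ with hα
  have hα' : |α| = ((2 : ℝ) ^ (k + 1))⁻¹ * |θ| := by rw [hα, abs_mul, abs_of_pos (by positivity)]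
  have h3 : 1 / 4 ≤ |α| := by
    rw [hα', pow_succ, ← div_eq_inv_mul, le_div_iff₀ (by positivity)]
    linarith
  have h4 : |α| ≤ 1 / 2 := by
    rw [hα', ← div_eq_inv_mul, div_le_iff₀ (by positivity)]
    linarith
  have h5 : |Real.sin (2 * Real.pi * α / 2)| = Real.sin (Real.pi * |α|) := by
    have h6 : |Real.pi * α| ≤ Real.pi := by
      rw [abs_mul, abs_of_pos Real.pi_pos]
      nlinarith [Real.pi_pos]
    rw [show 2 * Real.pi * α / 2 = Real.pi * α by ring, Real.abs_sin_eq_sin_abs_of_abs_le_pi h6,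
      abs_mul, abs_of_pos Real.pi_pos]
  have h6 : 2 / Real.pi * (Real.pi * |α|) ≤ Real.sin (Real.pi * |α|) :=
    Real.mul_le_sin (by positivity) (by nlinarith [Real.pi_pos])
  have h7 : 2 / Real.pi * (Real.pi * |α|) = 2 * |α| := by
    field_simp
  rw [norm_mul, Real.norm_eq_abs, Real.norm_eq_abs, h5, abs_two]
  linarith

/-- Fractional regularity in the direction i₀ survives the shear because it is measured by
differences in that direction. The weight is dominated by a sum over dyadic steps 2^(-j) of 4^(sj)
times the difference multipliers; each difference is O(4^(-s'j)), and s < s' makes the sum finite.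
Regularity in the other directions is recovered from vector fields instead. -/
theorem lintegral_shear_weight_lt_top {i₀ : Fin n} {h : Rn n → ℝ} (hh : IsShear i₀ h)
    {f : Rn n → ℂ} (hf : Integrable f) (hf2 : MemLp f 2) {s s' : ℝ} (hs : 0 ≤ s) (hss : s < s')
    (hS : Integrable (fun ξ => (1 + ‖ξ‖ ^ 2) ^ s' * ‖𝓕 f ξ‖ ^ 2)) :
    ∫⁻ η : Rn n, ENNReal.ofReal ((1 + (η i₀) ^ 2) ^ s * ‖𝓕 (f ∘ shear i₀ h) η‖ ^ 2) < ⊤ := by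
  obtain ⟨M, hM⟩ := exists_nat_ge s'
  have hmp := hh.measurePreserving
  have hfs : Integrable (f ∘ shear i₀ h) := hmp.integrable_comp_of_integrable hf
  have hfs2 : MemLp (f ∘ shear i₀ h) 2 := hf2.comp_measurePreserving hmp
  have hcont : ∀ {g : Rn n → ℂ}, Integrable g → Continuous (𝓕 g) := fun hg =>
    VectorFourier.fourierIntegral_continuous Real.continuous_fourierChar continuous_inner hg
  set m : ℕ → ℝ → ℝ := fun j θ =>
    ‖Complex.exp (Complex.I * (2 * Real.pi * ((2 ^ j)⁻¹ * θ) : ℝ)) - 1‖ ^ (2 * M) with hm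
  have hmc : ∀ j, Continuous (m j) := fun j => by
    simp only [hm]
    exact ((Complex.continuous_exp.comp (continuous_const.mul
      (Complex.continuous_ofReal.comp (by fun_prop)))).sub continuous_const).norm.pow _
  set G := 𝓕 (f ∘ shear i₀ h) with hG
  set c : ℝ := 4 ^ s with hc
  have hc0 : 0 < c := by positivity
  set I : ℝ := ∫ ξ, (1 + ‖ξ‖ ^ 2) ^ s' * ‖𝓕 f ξ‖ ^ 2 with hI
  -- Small |η_{i₀}| is absorbed by the first summand; otherwise the j found above has multiplier at
  -- least 1 while the weight is at most 2^s · 4^(sj).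
  have hpt : ∀ η : Rn n, ENNReal.ofReal ((1 + (η i₀) ^ 2) ^ s * ‖G η‖ ^ 2) ≤
      ENNReal.ofReal (2 ^ s) * (ENNReal.ofReal (‖G η‖ ^ 2) +
        ∑' j, ENNReal.ofReal (c ^ j) * ENNReal.ofReal (m j (η i₀) * ‖G η‖ ^ 2)) := by
    intro η
    rcases lt_or_ge |η i₀| (1 / 2) with h1 | h1
    · refine le_trans ?_ (mul_le_mul_right (le_self_add) _)
      rw [← ENNReal.ofReal_mul (by positivity)]
      refine ENNReal.ofReal_le_ofReal ?_
      gcongr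
      have : (η i₀) ^ 2 ≤ (1 / 2) ^ 2 := by rw [← sq_abs]; gcongr
      linarith
    · obtain ⟨j, h2, h3⟩ := exists_one_le_norm_exp_sub_one h1
      refine le_trans ?_ (mul_le_mul_right ((ENNReal.le_tsum j).trans le_add_self) _)
      rw [← ENNReal.ofReal_mul (by positivity), ← ENNReal.ofReal_mul (by positivity)]
      refine ENNReal.ofReal_le_ofReal ?_
      have h4 : 1 ≤ m j (η i₀) := one_le_pow₀ h3
      have h5 : (1 + (η i₀) ^ 2) ^ s ≤ 2 ^ s * c ^ j := by
        have h6 : c ^ j = ((2 ^ j) ^ 2 : ℝ) ^ s := by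
          rw [hc, ← Real.rpow_natCast, ← Real.rpow_mul (by norm_num), mul_comm, Real.rpow_mul
            (by norm_num), Real.rpow_natCast, ← pow_mul, mul_comm j 2, pow_mul]
          norm_num
        rw [h6, ← Real.mul_rpow (by norm_num) (by positivity)]
        gcongr
        have h7 : (η i₀) ^ 2 ≤ (2 ^ j / 2) ^ 2 := by rw [← sq_abs]; gcongr
        have h8 : (1 : ℝ) ≤ (2 ^ j) ^ 2 := one_le_pow₀ (one_le_pow₀ (by norm_num))
        nlinarith
      calc (1 + (η i₀) ^ 2) ^ s * ‖G η‖ ^ 2 ≤ 2 ^ s * c ^ j * ‖G η‖ ^ 2 := by gcongr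
        _ ≤ 2 ^ s * c ^ j * ‖G η‖ ^ 2 * m j (η i₀) := le_mul_of_one_le_right (by positivity) h4
        _ = _ := by ring
  have hterm : ∀ j, ∫⁻ η : Rn n, ENNReal.ofReal (c ^ j) * ENNReal.ofReal (m j (η i₀) * ‖G η‖ ^ 2) ≤
      ENNReal.ofReal ((2 * Real.pi) ^ (2 * M) * I * ((4 : ℝ) ^ (s - s')) ^ j) := by
    intro j
    rw [lintegral_const_mul' _ _ ENNReal.ofReal_ne_top, hG]
    simp only [hm]
    rw [lintegral_diff_fourier_shear hh hf hf2]
    -- After the shear has been removed, the multiplier bound with M ≥ s' extracts 4^(-s'j) and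
    -- leaves the Sobolev integral of f.
    have h1 : ∫⁻ ξ : Rn n, ENNReal.ofReal (m j (ξ i₀) * ‖𝓕 f ξ‖ ^ 2) ≤
        ENNReal.ofReal ((2 * Real.pi) ^ (2 * M) * ((4 : ℝ) ^ (-s')) ^ j * I) := by
      rw [hI, ← integral_const_mul, ofReal_integral_eq_lintegral_ofReal (hS.const_mul _)
        (Filter.Eventually.of_forall fun ξ => by positivity)]
      refine lintegral_mono fun ξ => ENNReal.ofReal_le_ofReal ?_
      rw [← mul_assoc]
      gcongr
      refine (norm_exp_sub_one_pow_le (hs.trans hss.le) hM _).trans ?_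
      rw [mul_assoc]
      refine mul_le_mul_of_nonneg_left ?_ (by positivity)
      rw [mul_pow, Real.mul_rpow (by positivity) (by positivity)]
      have h2 : ((((2 : ℝ) ^ j)⁻¹) ^ 2) ^ s' = ((4 : ℝ) ^ (-s')) ^ j := by
        rw [← Real.rpow_natCast (4 ^ (-s')), ← Real.rpow_mul (by norm_num), mul_comm (-s'),
          Real.rpow_mul (by norm_num), Real.rpow_natCast, Real.rpow_neg (by positivity),
          ← Real.inv_rpow (by positivity), inv_pow, ← pow_mul, mul_comm j 2, pow_mul]
        norm_num
      rw [h2]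
      refine mul_le_mul_of_nonneg_left (Real.rpow_le_rpow (by positivity) ?_ (hs.trans hss.le))
        (by positivity)
      have := PiLp.norm_apply_le ξ i₀
      rw [Real.norm_eq_abs] at this
      have h3 : (ξ i₀) ^ 2 ≤ ‖ξ‖ ^ 2 := by rw [← sq_abs]; gcongr
      linarith
    refine (mul_le_mul_right h1 _).trans (le_of_eq ?_)
    rw [← ENNReal.ofReal_mul (by positivity)]
    congr 1
    rw [sub_eq_add_neg, Real.rpow_add (by norm_num), mul_pow]
    ring
  have hr1 : (4 : ℝ) ^ (s - s') < 1 := Real.rpow_lt_one_of_one_lt_of_neg (by norm_num) (by linarith)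
  have hIG : ∫⁻ η, ENNReal.ofReal (‖G η‖ ^ 2) < ⊤ := by
    rw [hG, lintegral_fourier_sq hfs hfs2]
    exact ENNReal.ofReal_lt_top
  have hI0 : 0 ≤ I := integral_nonneg fun ξ => by positivity
  refine lt_of_le_of_lt (lintegral_mono hpt) ?_
  rw [lintegral_const_mul' _ _ ENNReal.ofReal_ne_top]
  refine ENNReal.mul_lt_top ENNReal.ofReal_lt_top ?_
  have hGm : Measurable fun η => ENNReal.ofReal (‖G η‖ ^ 2) :=
    ((hcont hfs).norm.pow 2).measurable.ennreal_ofReal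
  rw [lintegral_add_left hGm]
  refine ENNReal.add_lt_top.2 ⟨hIG, ?_⟩
  have hmG : ∀ j, AEMeasurable fun η : Rn n =>
      ENNReal.ofReal (c ^ j) * ENNReal.ofReal (m j (η i₀) * ‖G η‖ ^ 2) := fun j =>
    ((((hmc j).comp (contDiff_coord i₀).continuous).mul
      ((hcont hfs).norm.pow 2)).measurable.ennreal_ofReal.const_mul _).aemeasurable
  rw [lintegral_tsum hmG]
  refine lt_of_le_of_lt (ENNReal.tsum_le_tsum hterm) ?_
  rw [← ENNReal.ofReal_tsum_of_nonneg (fun j => by positivity)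
    ((summable_geometric_of_lt_one (by positivity) hr1).mul_left _)]
  exact ENNReal.ofReal_lt_top

theorem integrable_shear_weight {i₀ : Fin n} {h : Rn n → ℝ} (hh : IsShear i₀ h)
    {f : Rn n → ℂ} (hf : Integrable f) (hf2 : MemLp f 2) {s s' : ℝ} (hs : 0 ≤ s) (hss : s < s')
    (hS : Integrable (fun ξ => (1 + ‖ξ‖ ^ 2) ^ s' * ‖𝓕 f ξ‖ ^ 2)) :
    Integrable (fun η : Rn n => (1 + (η i₀) ^ 2) ^ s * ‖𝓕 (f ∘ shear i₀ h) η‖ ^ 2) := by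
  have hfs : Integrable (f ∘ shear i₀ h) := hh.measurePreserving.integrable_comp_of_integrable hf
  have hc : Continuous (𝓕 (f ∘ shear i₀ h)) :=
    VectorFourier.fourierIntegral_continuous Real.continuous_fourierChar continuous_inner hfs
  have hw : Continuous (fun η : Rn n => (1 + (η i₀) ^ 2) ^ s) :=
    (continuous_const.add ((contDiff_coord i₀).continuous.pow 2)).rpow_const fun _ => Or.inr hs
  refine ⟨(hw.mul (hc.norm.pow 2)).aestronglyMeasurable, ?_⟩
  rw [hasFiniteIntegral_iff_ofReal (Filter.Eventually.of_forall fun ξ => by positivity)]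
  exact lintegral_shear_weight_lt_top hh hf hf2 hs hss hS

end Difference

/-! ### Derivatives away from the hypersurface, and localization of test functions -/

section Local

theorem IsTest.mono {O : Opens (Rn n)} {φ : Rn n → ℂ} (h : IsTest O φ) (hO : O ≤ Ω) :
    IsTest Ω φ :=
  ⟨h.contDiff, h.hasCompactSupport, h.tsupport_subset.trans hO⟩

theorem IsTest.integrable {φ : Rn n → ℂ} (h : IsTest Ω φ) : Integrable φ :=
  h.contDiff.continuous.integrable_of_hasCompactSupport h.hasCompactSupport

/-- If `w` is given by a smooth function `F` on `O`, then `V w` is given by `V F` on `O`. -/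
theorem pair_act_of_smooth {O : Opens (Rn n)} (hO : O ≤ Ω) {w : 𝓓'(Ω, ℂ)} {F : Rn n → ℂ}
    (hF : ContDiffOn ℝ ∞ F O) (hrep : ∀ φ, IsTest O φ → pair w φ = ∫ x, φ x * F x)
    (V : SmoothVectorField Ω) {φ : Rn n → ℂ} (hφ : IsTest O φ) :
    pair (V.act w) φ = ∫ x, φ x * vact V F x := by
  have hV : ∀ i, IsTest O (fun x => φ x * V.toFun x i) := fun i =>
    hφ.mul_contDiffOn ((V.contDiffOn_coord_ofReal i).mono hO)
  have hFd : ∀ i, ContDiffOn ℝ ∞ (fun x => fderiv ℝ F x (basisVec i)) O := fun i =>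
    (hF.fderiv_of_isOpen O.isOpen (m := ∞) (by norm_cast)).clm_apply contDiffOn_const
  rw [pair_act V w (hφ.mono hO), ← Finset.sum_neg_distrib]
  simp only [vact_eq_sum, Finset.mul_sum, ← mul_assoc]
  rw [integral_finsetSum _ fun i _ => ((hV i).mul_contDiffOn (hFd i)).integrable]
  refine Finset.sum_congr rfl fun i _ => ?_
  rw [hrep _ ((hV i).fderiv _)]
  exact (integral_mul_fderiv_eq_neg_fderiv_mul_of_integrable
    (((hV i).fderiv _).mul_contDiffOn hF).integrable
    ((hV i).mul_contDiffOn (hFd i)).integrable ((hV i).mul_contDiffOn hF).integrable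
    (fun x _ => ((hV i).contDiff.differentiable (by simp)).differentiableAt)
    (fun x hx => (hF.contDiffAt (O.isOpen.mem_nhds ((hV i).tsupport_subset hx))).differentiableAt
      (by simp))).symm

theorem contDiffOn_foldr_vact {U : Set (Rn n)} (hU : IsOpen U) (hUΩ : U ⊆ Ω) {f : Rn n → ℂ}
    (hf : ContDiffOn ℝ ∞ f U) (L : List (SmoothVectorField Ω)) :
    ContDiffOn ℝ ∞ (L.foldr vact f) U := by
  induction L with
  | nil => exact hf
  | cons V L ih => exact contDiffOn_vact V hU hUΩ ih

theorem pair_foldr_act_of_smooth {O : Opens (Rn n)} (hO : O ≤ Ω) {w : 𝓓'(Ω, ℂ)} {F : Rn n → ℂ}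
    (hF : ContDiffOn ℝ ∞ F O) (hrep : ∀ φ, IsTest O φ → pair w φ = ∫ x, φ x * F x)
    (L : List (SmoothVectorField Ω)) : ∀ φ, IsTest O φ →
    pair (L.foldr SmoothVectorField.act w) φ = ∫ x, φ x * L.foldr vact F x := by
  induction L with
  | nil => exact hrep
  | cons V L ih =>
    exact fun φ hφ => pair_act_of_smooth hO (contDiffOn_foldr_vact O.isOpen hO hF L) ih V hφ

/-- A property of test functions that is additive and holds for all test functions with support
in small sets holds for all test functions. -/
theorem testFunction_induction {P : 𝓓(Ω, ℝ) → Prop} (zero : P 0)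
    (add : ∀ φ ψ, P φ → P ψ → P (φ + ψ))
    (loc : ∀ p ∈ Ω, ∃ U : Set (Rn n), IsOpen U ∧ p ∈ U ∧ ∀ φ : 𝓓(Ω, ℝ), tsupport φ ⊆ U → P φ)
    (φ : 𝓓(Ω, ℝ)) : P φ := by
  choose! U hUo hpU hU using loc
  obtain ⟨t, ht, hcov⟩ := φ.hasCompactSupport.isCompact.elim_nhds_subcover U
    (fun x hx => (hUo x (φ.tsupport_subset hx)).mem_nhds (hpU x (φ.tsupport_subset hx)))
  obtain ⟨ρ, hρ⟩ := SmoothPartitionOfUnity.exists_isSubordinate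
    (modelWithCornersSelf ℝ (Rn n)) (isClosed_tsupport φ) (fun i : t => U i)
    (fun i => hUo _ (φ.tsupport_subset (ht i i.2)))
    (fun x hx => by
      obtain ⟨i, hi, hxi⟩ := mem_iUnion₂.1 (hcov hx)
      exact mem_iUnion.2 ⟨⟨i, hi⟩, hxi⟩)
  have hsum : ∀ (s : Finset t) , P (∑ i ∈ s, mulTest (ρ i) (ρ i).contMDiff.contDiff.contDiffOn φ) := by
    intro s
    classical
    induction s using Finset.induction_on with
    | empty => simpa using zero
    | insert a s ha ih =>
      rw [Finset.sum_insert ha]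
      refine add _ _ (hU a (φ.tsupport_subset (ht a a.2)) _ ?_) ih
      exact (tsupport_mul_subset_right).trans (hρ a)
  convert! hsum Finset.univ
  ext x
  have hs : ∀ (s : Finset t) (g : t → 𝓓(Ω, ℝ)), (∑ i ∈ s, g i) x = ∑ i ∈ s, g i x := by
    intro s g
    classical
    induction s using Finset.induction_on with
    | empty => rfl
    | insert a s ha ih => rw [Finset.sum_insert ha, Finset.sum_insert ha, ← ih]; rfl
  rw [hs]
  simp only [mulTest_apply]
  rw [← Finset.mul_sum]
  by_cases hx : x ∈ tsupport φ
  · have := ρ.sum_eq_one hx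
    rw [finsum_eq_sum_of_fintype] at this
    rw [this, mul_one]
  · rw [image_eq_zero_of_notMem_tsupport hx, zero_mul]

end Local

/-! ### Continuous conormal functions in flat coordinates -/

/-- The distribution given by the continuous function `f` is conormal with respect to `S`. -/
structure IsConormalFun (Ω : Opens (Rn n)) (S : Set (Rn n)) (s : ℝ) (f : Rn n → ℂ) : Prop where
  hypersurface : IsHypersurface Ω S
  pos : 0 < s
  continuousOn : ContinuousOn f Ω
  memBesovLoc : ∀ L : List (SmoothVectorField Ω), (∀ V ∈ L, V.IsTangent S) →
      MemBesovLoc s (L.foldr SmoothVectorField.act (ofFunction Ω f))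

theorem IsHypersurface.diff_eq {S : Set (Rn n)} (hS : IsHypersurface Ω S) :
    (Ω : Set (Rn n)) \ S = (Ω : Set (Rn n)) ∩ (closure S)ᶜ :=
  Set.ext fun _ => ⟨fun hx => ⟨hx.1, fun h => hx.2 (hS.closed_in ⟨h, hx.1⟩)⟩,
    fun hx => ⟨hx.1, fun h => hx.2 (subset_closure h)⟩⟩

theorem IsHypersurface.isOpen_diff {S : Set (Rn n)} (hS : IsHypersurface Ω S) :
    IsOpen ((Ω : Set (Rn n)) \ S) := by
  rw [hS.diff_eq]
  exact Ω.isOpen.inter isClosed_closure.isOpen_compl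

/-- The complement of the hypersurface. -/
def IsHypersurface.compl {S : Set (Rn n)} (hS : IsHypersurface Ω S) : Opens (Rn n) :=
  ⟨(Ω : Set (Rn n)) \ S, hS.isOpen_diff⟩

theorem IsHypersurface.compl_le {S : Set (Rn n)} (hS : IsHypersurface Ω S) : hS.compl ≤ Ω :=
  fun _ hx => hx.1

theorem IsConormalFun.contDiffOn {S : Set (Rn n)} {s : ℝ} {f : Rn n → ℂ}
    (hf : IsConormalFun Ω S s f) : ContDiffOn ℝ ∞ f (Ω \ S) := fun x hx =>
  (contDiffAt_of_conormal hf.pos hf.continuousOn hf.memBesovLoc hx.1 (by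
    filter_upwards [hf.hypersurface.isOpen_diff.mem_nhds hx] with y hy using hy.2)).contDiffWithinAt

theorem IsConormalFun.locallyIntegrableOn {S : Set (Rn n)} {s : ℝ} {f : Rn n → ℂ}
    (hf : IsConormalFun Ω S s f) : LocallyIntegrableOn f Ω :=
  hf.continuousOn.locallyIntegrableOn Ω.isOpen.measurableSet

theorem IsGraphChart.volume_inter {S U : Set (Rn n)} {i₀ : Fin n} {h : Rn n → ℝ}
    (hc : IsGraphChart S U i₀ h) : volume (U ∩ S) = 0 :=
  measure_mono_null (fun x hx => (hc.mem_iff x hx.1).1 hx.2) hc.toIsShear.volume_graph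

/-! ### Tangential derivatives as L² functions and their Fourier transforms after flattening -/

section Rep

variable {S U : Set (Rn n)} {s : ℝ} {f : Rn n → ℂ} {i₀ : Fin n} {h : Rn n → ℝ}

theorem IsConormalFun.fourierRep (hf : IsConormalFun Ω S s f) (L : List (SmoothVectorField Ω)) :
    FourierRep (L.foldr SmoothVectorField.act (ofFunction Ω f)) :=
  (fourierRep_ofFunction hf.locallyIntegrableOn).foldr_act L

/-- A priori V_1⋯V_N f could carry a layer on S. Off S it is the classical derivative, S is null in
the chart, and positive Besov order gives a square integrable localization, so there is no layer. -/
theorem IsConormalFun.memLp_two (hf : IsConormalFun Ω S s f) (hc : IsGraphChart S U i₀ h)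
    {L : List (SmoothVectorField Ω)} (hL : ∀ V ∈ L, V.IsTangent S) {χ : 𝓓(Ω, ℝ)}
    (hχ : tsupport χ ⊆ U) :
    MemLp (fun x => χ x * L.foldr vact f x) 2 ∧ ∀ a : Rn n → ℂ, ContDiff ℝ ∞ a →
      pair (L.foldr SmoothVectorField.act (ofFunction Ω f)) (fun x => χ x * a x) =
        ∫ x, χ x * L.foldr vact f x * a x := by
  have hsm := contDiffOn_foldr_vact hf.hypersurface.isOpen_diff sdiff_subset hf.contDiffOn L
  refine (hf.fourierRep L).memLp_two χ ?_ hf.hypersurface.isOpen_diff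
    (hsm.continuousOn.locallyIntegrableOn hf.hypersurface.isOpen_diff.measurableSet)
    (fun φ hφ hφS => ?_) (measure_mono_null (fun x hx => ?_) hc.volume_inter)
  · rw [memLp_two_iff_integrable_sq_norm ((hf.fourierRep L).cont χ).aestronglyMeasurable]
    simpa using (hf.fourierRep L).integrable_sobolev le_rfl hf.pos (hf.memBesovLoc L hL) χ
  · exact pair_foldr_act_of_smooth hf.hypersurface.compl_le hf.contDiffOn (fun ψ hψ =>
      pair_ofFunction hf.locallyIntegrableOn (hψ.mono hf.hypersurface.compl_le)) L φ
      ⟨hφ.contDiff, hφ.hasCompactSupport, hφS⟩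
  · refine ⟨hχ hx.1, ?_⟩
    by_contra hxS
    exact hx.2 ⟨χ.tsupport_subset hx.1, hxS⟩

theorem IsConormalFun.integrable (hf : IsConormalFun Ω S s f) (hc : IsGraphChart S U i₀ h)
    {L : List (SmoothVectorField Ω)} (hL : ∀ V ∈ L, V.IsTangent S) {χ : 𝓓(Ω, ℝ)}
    (hχ : tsupport χ ⊆ U) : Integrable (fun x => χ x * L.foldr vact f x) := by
  have h1 := (MemLp.locallyIntegrable_two (hf.memLp_two hc hL hχ).1).integrableOn_isCompact
    χ.hasCompactSupport.isCompact
  refine (integrableOn_iff_integrable_of_support_subset fun x hx => ?_).1 h1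
  refine subset_tsupport _ fun h0 => hx ?_
  simp [h0]

open FourierTransform

/-- The Fourier transform, in flat coordinates, of a localized derivative of `f`. -/
def flatFt (f : Rn n → ℂ) (i₀ : Fin n) (h : Rn n → ℝ) (L : List (SmoothVectorField Ω))
    (χ : 𝓓(Ω, ℝ)) : Rn n → ℂ :=
  𝓕 ((fun x => χ x * L.foldr vact f x) ∘ shear i₀ h)

/-- The shear preserves measure, so the transform in flat coordinates is a pairing in the original
ones, with a sheared character as amplitude; vector fields can then be transposed onto it. -/
theorem IsConormalFun.flatFt_eq (hf : IsConormalFun Ω S s f) (hc : IsGraphChart S U i₀ h)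
    {L : List (SmoothVectorField Ω)} (hL : ∀ V ∈ L, V.IsTangent S) {χ : 𝓓(Ω, ℝ)}
    (hχ : tsupport χ ⊆ U) (η : Rn n) :
    flatFt f i₀ h L χ η = pair (L.foldr SmoothVectorField.act (ofFunction Ω f))
      (fun x => χ x * expo η (shear i₀ (fun x => -h x) x)) := by
  have ha : ContDiff ℝ ∞ fun x => expo η (shear i₀ (fun x => -h x) x) :=
    (contDiff_expo η).comp hc.neg.contDiff_shear
  rw [(hf.memLp_two hc hL hχ).2 _ ha, flatFt,
    fourier_eq_expo]
  refine Eq.trans ?_ (hc.measurePreserving.integral_comp hc.measurableEmbedding (fun x =>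
    χ x * L.foldr vact f x * expo η (shear i₀ (fun x => -h x) x)))
  simp [hc.shear_neg_shear]

theorem IsConormalFun.continuous_flatFt (hf : IsConormalFun Ω S s f) (hc : IsGraphChart S U i₀ h)
    {L : List (SmoothVectorField Ω)} (hL : ∀ V ∈ L, V.IsTangent S) {χ : 𝓓(Ω, ℝ)}
    (hχ : tsupport χ ⊆ U) : Continuous (flatFt f i₀ h L χ) :=
  VectorFourier.fourierIntegral_continuous Real.continuous_fourierChar continuous_inner
    (hc.measurePreserving.integrable_comp_of_integrable (hf.integrable hc hL hχ))

/-- On the support of χ the cut-off field is ∂_i in flat coordinates, so it acts on the sheared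
character as multiplication by -2πiη_i. -/
theorem IsConormalFun.flatFt_act (hf : IsConormalFun Ω S s f) (hc : IsGraphChart S U i₀ h)
    {κ : Rn n → ℝ} (hκ : ContDiff ℝ ∞ κ) (hκU : ∀ x, κ x ≠ 0 → x ∈ U)
    {L : List (SmoothVectorField Ω)} (hL : ∀ V ∈ L, V.IsTangent S) {χ : 𝓓(Ω, ℝ)}
    (hχ : ∀ x ∈ tsupport χ, κ x = 1) {i : Fin n} (hi : i ≠ i₀) (η : Rn n) :
    (2 * Real.pi * Complex.I : ℂ) * (η i : ℂ) * flatFt f i₀ h L χ η =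
      flatFt f i₀ h (cutoffField Ω κ hκ hc.toIsShear i :: L) χ η +
        flatFt f i₀ h L ((cutoffField Ω κ hκ hc.toIsShear i).divTest χ) η := by
  set V := cutoffField Ω κ hκ hc.toIsShear i with hV
  have hχU : tsupport χ ⊆ U := fun x hx => hκU x (by rw [hχ x hx]; norm_num)
  have ha : ContDiff ℝ ∞ fun x => expo η (shear i₀ (fun x => -h x) x) :=
    (contDiff_expo η).comp hc.neg.contDiff_shear
  rw [hf.flatFt_eq hc hL hχU, hf.flatFt_eq hc (L := V :: L) (List.forall_mem_cons.2
    ⟨hc.isTangent_cutoffField hκ hκU hi, hL⟩) hχU,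
    hf.flatFt_eq hc hL ((V.tsupport_divTest_subset χ).trans hχU), List.foldr_cons,
    pair_act_mul V _ χ ha, sub_add_cancel, ← pair_const_mul _ (isTest_coe_mul χ ha.contDiffOn),
    ← pair_neg _ (isTest_coe_mul χ (contDiffOn_vact V Ω.isOpen le_rfl ha.contDiffOn))]
  congr 1
  ext x
  by_cases hx : x ∈ tsupport χ
  · have h1 : vact V (fun x => expo η (shear i₀ (fun x => -h x) x)) x =
        -(2 * Real.pi * Complex.I * η i) * expo η (shear i₀ (fun x => -h x) x) := by
      have h2 := fderiv_comp x
        ((contDiff_expo η).differentiable (by simp) (shear i₀ (fun x => -h x) x))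
        (hc.neg.contDiff_shear.differentiable (by simp) x)
      rw [Function.comp_def] at h2
      rw [vact, h2, ContinuousLinearMap.comp_apply]
      have h3 : V.toFun x = graphField i₀ h i x := by
        rw [hV]; simp [cutoffField, hχ x hx]
      rw [h3, hc.fderiv_shear_neg_graphField, fderiv_expo, inner_basisVec_left]
    rw [h1]
    ring
  · simp [image_eq_zero_of_notMem_tsupport hx]

end Rep

/-! ### Weighted integrability of Fourier transforms in flat coordinates -/

section Weight

open FourierTransform

variable {S U : Set (Rn n)} {s : ℝ} {f : Rn n → ℂ} {i₀ : Fin n} {h : Rn n → ℝ}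

theorem continuous_weight (i : Fin n) (s : ℝ) :
    Continuous (fun η : Rn n => (1 + (η i) ^ 2) ^ s) :=
  (continuous_const.add ((contDiff_coord i).continuous.pow 2)).rpow_const fun η =>
    Or.inl (show 1 + (η i) ^ 2 ≠ 0 by positivity)

theorem continuous_prod_weight (A : Finset (Fin n)) :
    Continuous (fun η : Rn n => ∏ i ∈ A, (1 + (η i) ^ 2)) :=
  continuous_finsetProd _ fun i _ => continuous_const.add ((contDiff_coord i).continuous.pow 2)

/-- The weight in η_{i₀} comes from Besov regularity, and each factor 1 + η_i² is paid for by one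
more tangential field. As before, L and χ must vary in the induction. -/
theorem IsConormalFun.integrable_prod_weight (hf : IsConormalFun Ω S s f)
    (hc : IsGraphChart S U i₀ h) {κ : Rn n → ℝ} (hκ : ContDiff ℝ ∞ κ)
    (hκU : ∀ x, κ x ≠ 0 → x ∈ U) {s' : ℝ} (hs' : 0 ≤ s') (hs : s' < s) (A : Finset (Fin n))
    (hA : i₀ ∉ A) : ∀ L : List (SmoothVectorField Ω), (∀ V ∈ L, V.IsTangent S) →
      ∀ χ : 𝓓(Ω, ℝ), (∀ x ∈ tsupport χ, κ x = 1) →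
      Integrable (fun η => (1 + (η i₀) ^ 2) ^ s' * (∏ i ∈ A, (1 + (η i) ^ 2)) *
        ‖flatFt f i₀ h L χ η‖ ^ 2) := by
  have hsub : ∀ χ : 𝓓(Ω, ℝ), (∀ x ∈ tsupport χ, κ x = 1) → tsupport χ ⊆ U :=
    fun χ hχ x hx => hκU x (by rw [hχ x hx]; norm_num)
  induction A using Finset.induction_on with
  | empty =>
    intro L hL χ hχ
    -- Two losses of regularity: from s to s'' in passing from Besov to Sobolev, and from s'' to s'
    -- under the shear.
    obtain ⟨s'', h1, h2⟩ := exists_between hs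
    have h3 := (hf.fourierRep L).integrable_sobolev (hs'.trans h1.le) h2 (hf.memBesovLoc L hL) χ
    have h4 : ∀ ξ, ft (L.foldr SmoothVectorField.act (ofFunction Ω f)) χ ξ =
        𝓕 (fun x => χ x * L.foldr vact f x) ξ := fun ξ => by
      rw [ft, (hf.memLp_two hc hL (hsub χ hχ)).2 _ (contDiff_expo ξ), fourier_eq_expo]
    simp only [h4] at h3
    simpa [flatFt] using integrable_shear_weight hc.toIsShear (hf.integrable hc hL (hsub χ hχ))
      (hf.memLp_two hc hL (hsub χ hχ)).1 hs' h1 h3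
  | insert i A hi ih =>
    intro L hL χ hχ
    obtain ⟨hi₀, hA'⟩ : i ≠ i₀ ∧ i₀ ∉ A := by
      simp only [Finset.mem_insert, not_or] at hA
      exact ⟨fun h => hA.1 h.symm, hA.2⟩
    set V := cutoffField Ω κ hκ hc.toIsShear i with hV
    have hVL : ∀ W ∈ V :: L, W.IsTangent S :=
      List.forall_mem_cons.2 ⟨hc.isTangent_cutoffField hκ hκU hi₀, hL⟩
    have hdiv : ∀ x ∈ tsupport (V.divTest χ), κ x = 1 := fun x hx =>
      hχ x (V.tsupport_divTest_subset χ hx)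
    have I1 := ih hA' L hL χ hχ
    have I2 := ih hA' (V :: L) hVL χ hχ
    have I3 := ih hA' L hL _ hdiv
    refine (I1.add ((I2.add I3).const_mul 2)).mono'
      ((((continuous_weight i₀ s').mul (continuous_prod_weight _)).mul
        ((hf.continuous_flatFt hc hL (hsub χ hχ)).norm.pow 2)).aestronglyMeasurable)
      (Filter.Eventually.of_forall fun η => ?_)
    rw [Real.norm_of_nonneg (mul_nonneg (mul_nonneg (by positivity)
      (Finset.prod_nonneg fun i _ => by positivity)) (by positivity)), Finset.prod_insert hi]
    have h3 := hf.flatFt_act hc hκ hκU hL hχ hi₀ η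
    rw [← hV] at h3
    simp only [Pi.add_apply]
    set W := (1 + (η i₀) ^ 2) ^ s' * ∏ i ∈ A, (1 + (η i) ^ 2) with hW
    have hW0 : 0 ≤ W := mul_nonneg (by positivity) (Finset.prod_nonneg fun i _ => by positivity)
    have h4 := sq_norm_le_two_mul (flatFt f i₀ h (V :: L) χ η) (flatFt f i₀ h L (V.divTest χ) η)
    rw [← h3, norm_mul, norm_mul, mul_pow, mul_pow] at h4
    have h5 : ‖(2 * Real.pi * Complex.I : ℂ)‖ = 2 * Real.pi := by
      simp [abs_of_pos Real.pi_pos]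
    rw [h5, Complex.norm_real, Real.norm_eq_abs, sq_abs] at h4
    have h6 : 1 ≤ (2 * Real.pi) ^ 2 := by nlinarith [Real.pi_gt_three]
    have h7 : (η i) ^ 2 * ‖flatFt f i₀ h L χ η‖ ^ 2 ≤
        (2 * Real.pi) ^ 2 * (η i) ^ 2 * ‖flatFt f i₀ h L χ η‖ ^ 2 := by
      rw [mul_assoc]
      exact le_mul_of_one_le_left (by positivity) h6
    have h8 := mul_le_mul_of_nonneg_left (h7.trans h4) hW0
    calc (1 + (η i₀) ^ 2) ^ s' * ((1 + (η i) ^ 2) * ∏ i ∈ A, (1 + (η i) ^ 2)) *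
          ‖flatFt f i₀ h L χ η‖ ^ 2
        = W * ‖flatFt f i₀ h L χ η‖ ^ 2 + W * ((η i) ^ 2 * ‖flatFt f i₀ h L χ η‖ ^ 2) := by
          rw [hW]; ring
      _ ≤ _ := by linarith

theorem integrable_anisotropic (i₀ : Fin n) {r : ℝ} (hr : 1 / 2 < r) :
    Integrable (fun η : Rn n => (1 + (η i₀) ^ 2) ^ (-r) *
      (∏ i ∈ Finset.univ.erase i₀, (1 + (η i) ^ 2))⁻¹) := by
  have h1 : ∀ i : Fin n, Integrable (fun t : ℝ => (1 + t ^ 2) ^ (-(if i = i₀ then r else 1))) := by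
    intro i
    have := integrable_rpow_neg_one_add_norm_sq (E := ℝ) (μ := volume)
      (r := 2 * (if i = i₀ then r else 1)) (by
        rw [Module.finrank_self]; push_cast; split_ifs <;> linarith)
    refine this.congr (Filter.Eventually.of_forall fun t => ?_)
    simp only [Real.norm_eq_abs, sq_abs]
    congr 1
    ring
  have h2 := (PiLp.volume_preserving_ofLp (Fin n)).integrable_comp_of_integrable
    (Integrable.fintype_prod h1)
  refine h2.congr (Filter.Eventually.of_forall fun η => ?_)
  simp only [Function.comp]
  rw [← Finset.mul_prod_erase _ _ (Finset.mem_univ i₀), if_pos rfl, ← Finset.prod_inv_distrib]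
  congr 1
  refine Finset.prod_congr rfl fun i hi => ?_
  rw [if_neg (Finset.ne_of_mem_erase hi), Real.rpow_neg_one]

/-- Cauchy-Schwarz against the anisotropic weight: the tangential factors (1 + η_i²)⁻¹ are
integrable at no cost in s, and the normal factor needs only s' - τ > 1/2. -/
theorem IsConormalFun.integrable_flatFt (hf : IsConormalFun Ω S s f)
    (hc : IsGraphChart S U i₀ h) {κ : Rn n → ℝ} (hκ : ContDiff ℝ ∞ κ)
    (hκU : ∀ x, κ x ≠ 0 → x ∈ U) {τ : ℝ} (hτ : 0 ≤ τ) (hs : τ + 1 / 2 < s)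
    {L : List (SmoothVectorField Ω)} (hL : ∀ V ∈ L, V.IsTangent S)
    {χ : 𝓓(Ω, ℝ)} (hχ : ∀ x ∈ tsupport χ, κ x = 1) :
    Integrable (fun η => (1 + (η i₀) ^ 2) ^ (τ / 2) * ‖flatFt f i₀ h L χ η‖) := by
  obtain ⟨s', h1, h2⟩ := exists_between hs
  have I1 := hf.integrable_prod_weight hc hκ hκU (by linarith : 0 ≤ s') h2
    (Finset.univ.erase i₀) (by simp) L hL χ hχ
  have I2 := integrable_anisotropic i₀ (r := s' - τ) (by linarith)
  have hχU : tsupport χ ⊆ U := fun x hx => hκU x (by rw [hχ x hx]; norm_num)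
  refine (I1.add I2).mono' ((continuous_weight i₀ _).mul
    (hf.continuous_flatFt hc hL hχU).norm).aestronglyMeasurable
    (Filter.Eventually.of_forall fun η => ?_)
  rw [Real.norm_of_nonneg (by positivity), Pi.add_apply]
  set P := ∏ i ∈ Finset.univ.erase i₀, (1 + (η i) ^ 2) with hP
  have hP0 : 0 < P := Finset.prod_pos fun i _ => by positivity
  set w := 1 + (η i₀) ^ 2 with hw
  have hw0 : 0 < w := by positivity
  set g := ‖flatFt f i₀ h L χ η‖
  have e1 : (w ^ (τ / 2) * g) ^ 2 = (w ^ s' * P * g ^ 2) * (w ^ (-(s' - τ)) * P⁻¹) := by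
    have e2 : (w ^ (τ / 2)) ^ 2 = w ^ s' * w ^ (-(s' - τ)) := by
      rw [← Real.rpow_natCast, ← Real.rpow_mul hw0.le, ← Real.rpow_add hw0]
      congr 1; push_cast; ring
    rw [mul_pow, e2]
    field_simp
  have h3 : 0 ≤ w ^ s' * P * g ^ 2 := by positivity
  have h4 : 0 ≤ w ^ (-(s' - τ)) * P⁻¹ := by positivity
  -- The square of the left side is the product of the two integrable functions, so the left side is
  -- at most their sum.
  nlinarith [sq_nonneg (w ^ s' * P * g ^ 2 - w ^ (-(s' - τ)) * P⁻¹),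
    (by positivity : 0 ≤ w ^ (τ / 2) * g)]

end Weight

/-! ### Taylor expansion of inverse Fourier transforms in one direction -/

section Taylor

open FourierTransform

/-- For |θ| ≤ 1 the Taylor remainder is O(|θ|^(k+1)), which τ ≤ k + 1 allows; for |θ| ≥ 1 each of
the k + 2 terms is at most |θ|^τ because k ≤ τ. -/
theorem norm_exp_sub_sum_le {k : ℕ} {τ : ℝ} (h1 : (k : ℝ) ≤ τ) (h2 : τ ≤ k + 1) (θ : ℝ) :
    ‖Complex.exp (θ * Complex.I) - ∑ b ∈ Finset.range (k + 1), (θ * Complex.I) ^ b / b.factorial‖ ≤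
      (k + 2) * |θ| ^ τ := by
  have hn : ‖(θ * Complex.I : ℂ)‖ = |θ| := by simp
  rcases le_total |θ| 1 with h | h
  · have h3 := Complex.exp_bound (x := θ * Complex.I) (hn.trans_le h) (n := k + 1) (by omega)
    rw [hn] at h3
    have h4 : |θ| ^ (k + 1) ≤ |θ| ^ τ := by
      rcases (abs_nonneg θ).eq_or_lt with h0 | h0
      · rw [← h0, zero_pow (by omega)]; positivity
      · rw [← Real.rpow_natCast]
        exact Real.rpow_le_rpow_of_exponent_ge h0 h (by push_cast; linarith)
    have h5 : ((k + 1).succ : ℝ) * (((k + 1).factorial : ℝ) * ((k + 1 : ℕ) : ℝ))⁻¹ ≤ k + 2 := by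
      have h6 : (1 : ℝ) ≤ ((k + 1).factorial : ℝ) * ((k + 1 : ℕ) : ℝ) := by
        exact_mod_cast Nat.succ_le_of_lt (Nat.mul_pos (Nat.factorial_pos _) (Nat.succ_pos k))
      have h7 := inv_le_one_of_one_le₀ h6
      calc ((k + 1).succ : ℝ) * (((k + 1).factorial : ℝ) * ((k + 1 : ℕ) : ℝ))⁻¹
          ≤ ((k + 1).succ : ℝ) * 1 := by gcongr
        _ = k + 2 := by push_cast; ring
    refine h3.trans ?_
    rw [mul_comm]
    gcongr
  · have h3 : ∀ b ∈ Finset.range (k + 1), ‖(θ * Complex.I : ℂ) ^ b / b.factorial‖ ≤ |θ| ^ τ := by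
      intro b hb
      rw [norm_div, norm_pow, hn, Complex.norm_natCast]
      have hb' : (b : ℝ) ≤ k := by exact_mod_cast Nat.lt_succ_iff.1 (Finset.mem_range.1 hb)
      calc |θ| ^ b / (b.factorial : ℝ) ≤ |θ| ^ b :=
            div_le_self (by positivity) (by exact_mod_cast Nat.factorial_pos b)
        _ ≤ |θ| ^ τ := by
          rw [← Real.rpow_natCast]
          exact Real.rpow_le_rpow_of_exponent_le h (hb'.trans h1)
    have h4 : (1 : ℝ) ≤ |θ| ^ τ := Real.one_le_rpow h ((Nat.cast_nonneg k).trans h1)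
    calc _ ≤ 1 + ∑ b ∈ Finset.range (k + 1), |θ| ^ τ := by
          refine (norm_sub_le _ _).trans (add_le_add ?_ (norm_sum_le_of_le _ h3))
          rw [Complex.norm_exp_ofReal_mul_I]
      _ ≤ _ := by
          rw [Finset.sum_const, Finset.card_range, nsmul_eq_mul]
          push_cast
          linarith

/-- Expand the character in t under the integral sign. The coefficients depend on the base point y,
but the remainder sees only the weighted L¹ norm of g, so C is uniform in y; this uniformity is
needed when y runs along S. -/
theorem exists_fourierInv_taylor (i₀ : Fin n) {k : ℕ} {τ : ℝ} (h1 : (k : ℝ) ≤ τ)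
    (h2 : τ ≤ k + 1) {g : Rn n → ℂ} (hgc : Continuous g)
    (hg : Integrable (fun η : Rn n => (1 + (η i₀) ^ 2) ^ (τ / 2) * ‖g η‖)) :
    ∃ C : ℝ, ∀ y : Rn n, ∃ c : ℕ → ℂ, ∀ t : ℝ,
      ‖𝓕⁻ g (y + t • basisVec i₀) - ∑ b ∈ Finset.range (k + 1), c b * (t : ℂ) ^ b‖ ≤ C * |t| ^ τ := by
  have hτ : 0 ≤ τ := (Nat.cast_nonneg k).trans h1
  have hw : ∀ (η : Rn n) (r : ℝ), 0 ≤ r → r ≤ τ → |η i₀| ^ r ≤ (1 + (η i₀) ^ 2) ^ (τ / 2) := by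
    intro η r hr hrτ
    calc |η i₀| ^ r = ((η i₀) ^ 2) ^ (r / 2) := by
          rw [← sq_abs, ← Real.rpow_natCast, ← Real.rpow_mul (abs_nonneg _)]
          congr 1; push_cast; ring
      _ ≤ (1 + (η i₀) ^ 2) ^ (r / 2) := by gcongr; linarith
      _ ≤ _ := Real.rpow_le_rpow_of_exponent_le (by nlinarith [sq_nonneg (η i₀)]) (by linarith)
  have hpow : ∀ b : ℕ, b ≤ k → Integrable (fun η : Rn n => |η i₀| ^ b * ‖g η‖) := fun b hb => by
    refine hg.mono' (((contDiff_coord i₀).continuous.abs.pow b).mul hgc.norm).aestronglyMeasurable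
      (Filter.Eventually.of_forall fun η => ?_)
    rw [Real.norm_of_nonneg (by positivity)]
    gcongr
    rw [← Real.rpow_natCast]
    exact hw η b (Nat.cast_nonneg b) (le_trans (by exact_mod_cast hb) h1)
  have he : ∀ y : Rn n, Continuous fun v : Rn n =>
      Complex.exp (((2 * Real.pi * inner ℝ v y : ℝ) : ℂ) * Complex.I) := fun y => by fun_prop
  have hne : ∀ y v : Rn n,
      ‖Complex.exp (((2 * Real.pi * inner ℝ v y : ℝ) : ℂ) * Complex.I)‖ = 1 := fun y v =>
    Complex.norm_exp_ofReal_mul_I _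
  have hci : Continuous fun v : Rn n => (v i₀ : ℂ) :=
    Complex.continuous_ofReal.comp (contDiff_coord i₀).continuous
  -- The integrand of the b-th Taylor coefficient at y.
  set A := fun (y : Rn n) (b : ℕ) (v : Rn n) =>
    Complex.exp (((2 * Real.pi * inner ℝ v y : ℝ) : ℂ) * Complex.I) *
      ((2 * Real.pi * v i₀ * Complex.I) ^ b / b.factorial) * g v with hA
  have hAi : ∀ y b, b ≤ k → Integrable (A y b) := fun y b hb => by
    refine ((hpow b hb).const_mul ((2 * Real.pi) ^ b / b.factorial)).mono'
      ((((he y).mul ((((continuous_const.mul hci).mul continuous_const).pow b).div_const _)).mul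
        hgc).aestronglyMeasurable) (Filter.Eventually.of_forall fun v => le_of_eq ?_)
    simp only [hA, norm_mul, norm_div, norm_pow, hne, Complex.norm_natCast, Complex.norm_I,
      Complex.norm_real, Real.norm_eq_abs, abs_of_pos Real.pi_pos, Complex.norm_ofNat]
    ring
  have hE : ∀ y, Integrable (fun v => Complex.exp (((2 * Real.pi * inner ℝ v y : ℝ) : ℂ) *
      Complex.I) • g v) := fun y => by
    refine (hpow 0 (Nat.zero_le k)).mono' ((he y).smul hgc).aestronglyMeasurable
      (Filter.Eventually.of_forall fun v => ?_)
    rw [norm_smul, hne]; simp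
  refine ⟨(k + 2) * (2 * Real.pi) ^ τ * ∫ η, (1 + (η i₀) ^ 2) ^ (τ / 2) * ‖g η‖, fun y =>
    ⟨fun b => ∫ v, A y b v, fun t => ?_⟩⟩
  have hsum : ∑ b ∈ Finset.range (k + 1), (∫ v, A y b v) * (t : ℂ) ^ b =
      ∫ v, ∑ b ∈ Finset.range (k + 1), A y b v * (t : ℂ) ^ b := by
    rw [integral_finsetSum _ fun b hb =>
      (hAi y b (Nat.lt_succ_iff.1 (Finset.mem_range.1 hb))).mul_const _]
    exact Finset.sum_congr rfl fun b _ => (integral_mul_const _ _).symm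
  have hR : (k + 2) * (2 * Real.pi) ^ τ * (∫ η : Rn n, (1 + (η i₀) ^ 2) ^ (τ / 2) * ‖g η‖) *
      |t| ^ τ = ∫ η : Rn n, (|t| ^ τ * (((k : ℝ) + 2) * (2 * Real.pi) ^ τ)) *
        ((1 + (η i₀) ^ 2) ^ (τ / 2) * ‖g η‖) := by
    rw [integral_const_mul]; ring
  rw [Real.fourierInv_eq', hsum, ← integral_sub (hE _) (integrable_finsetSum _ fun b hb =>
    (hAi y b (Nat.lt_succ_iff.1 (Finset.mem_range.1 hb))).mul_const _), hR]
  refine norm_integral_le_of_norm_le (hg.const_mul _) (Filter.Eventually.of_forall fun v => ?_)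
  set θ : ℝ := 2 * Real.pi * v i₀ * t with hθ
  have e1 : Complex.exp (((2 * Real.pi * inner ℝ v (y + t • basisVec i₀) : ℝ) : ℂ) * Complex.I) =
      Complex.exp (((2 * Real.pi * inner ℝ v y : ℝ) : ℂ) * Complex.I) *
        Complex.exp (θ * Complex.I) := by
    have e0 : inner ℝ v (y + t • basisVec i₀) = inner ℝ v y + t * v i₀ := by
      rw [inner_add_right, inner_smul_right, real_inner_comm (basisVec i₀) v, inner_basisVec_left]
    rw [← Complex.exp_add, e0, hθ]
    congr 1
    push_cast
    ring
  have e2 : Complex.exp (((2 * Real.pi * inner ℝ v (y + t • basisVec i₀) : ℝ) : ℂ) * Complex.I) •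
      g v - ∑ b ∈ Finset.range (k + 1), A y b v * (t : ℂ) ^ b =
      Complex.exp (((2 * Real.pi * inner ℝ v y : ℝ) : ℂ) * Complex.I) *
        (Complex.exp (θ * Complex.I) -
          ∑ b ∈ Finset.range (k + 1), (θ * Complex.I) ^ b / b.factorial) * g v := by
    rw [e1, smul_eq_mul, mul_sub, sub_mul, Finset.mul_sum, Finset.sum_mul]
    congr 1
    refine Finset.sum_congr rfl fun b _ => ?_
    simp only [hA, hθ]
    push_cast
    rw [mul_right_comm _ (t : ℂ), mul_pow _ (t : ℂ)]
    ring
  rw [e2, norm_mul, norm_mul, hne y v, one_mul]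
  have h3 := norm_exp_sub_sum_le h1 h2 θ
  have h4 : |θ| ^ τ = (2 * Real.pi) ^ τ * |v i₀| ^ τ * |t| ^ τ := by
    rw [hθ, abs_mul, abs_mul, Real.mul_rpow (by positivity) (by positivity),
      Real.mul_rpow (by positivity) (by positivity), abs_of_pos (a := 2 * Real.pi) (by positivity)]
  have h5 := hw v τ hτ le_rfl
  calc _ ≤ (k + 2) * |θ| ^ τ * ‖g v‖ := by gcongr
    _ = (|t| ^ τ * (((k : ℝ) + 2) * (2 * Real.pi) ^ τ)) * (|v i₀| ^ τ * ‖g v‖) := by rw [h4]; ring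
    _ ≤ (|t| ^ τ * (((k : ℝ) + 2) * (2 * Real.pi) ^ τ)) *
        ((1 + (v i₀) ^ 2) ^ (τ / 2) * ‖g v‖) := by gcongr
    _ = _ := by ring

-- Letting t tend to 0 kills the constant coefficient; dividing by t lowers the degree.
open Asymptotics Topology in
theorem eq_zero_of_polynomial_isLittleO (k : ℕ) : ∀ c : ℕ → ℂ,
    (fun t : ℝ => ∑ b ∈ Finset.range (k + 1), c b * (t : ℂ) ^ b) =o[𝓝[≠] 0]
      (fun t : ℝ => t ^ k) → ∀ b ≤ k, c b = 0 := by
  have h0 : ∀ (k : ℕ) (c : ℕ → ℂ),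
      (fun t : ℝ => ∑ b ∈ Finset.range (k + 1), c b * (t : ℂ) ^ b) =o[𝓝[≠] 0]
      (fun t : ℝ => t ^ k) → c 0 = 0 := by
    intro k c hc
    have h1 : Filter.Tendsto (fun t : ℝ => ∑ b ∈ Finset.range (k + 1), c b * (t : ℂ) ^ b)
        (𝓝[≠] 0) (𝓝 (c 0)) := by
      have h2 : Continuous (fun t : ℝ => ∑ b ∈ Finset.range (k + 1), c b * (t : ℂ) ^ b) := by
        fun_prop
      have h3 := h2.tendsto 0
      simp only [Finset.sum_range_succ', Complex.ofReal_zero, ne_eq, Nat.add_eq_zero_iff,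
        one_ne_zero, and_false, not_false_eq_true, zero_pow, mul_zero, Finset.sum_const_zero,
        pow_zero, mul_one, zero_add] at h3
      refine (h3.mono_left nhdsWithin_le_nhds).congr fun t => ?_
      rw [Finset.sum_range_succ' (n := k)]
      simp
    have h4 : (fun t : ℝ => t ^ k) =O[𝓝[≠] 0] (fun _ => (1 : ℝ)) :=
      (((continuous_pow k).tendsto (0 : ℝ)).mono_left nhdsWithin_le_nhds).isBigO_one ℝ
    exact tendsto_nhds_unique h1 ((isLittleO_one_iff ℝ).1 (hc.trans_isBigO h4))
  induction k with
  | zero =>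
    intro c hc b hb
    rw [Nat.le_zero.1 hb]
    exact h0 0 c hc
  | succ k ih =>
    intro c hc b hb
    have hc0 := h0 _ c hc
    cases b with
    | zero => exact hc0
    | succ b =>
      refine ih (fun b => c (b + 1)) ?_ b (by omega)
      have h1 : (fun t : ℝ => (t : ℂ)⁻¹ * ∑ b ∈ Finset.range (k + 1 + 1), c b * (t : ℂ) ^ b)
          =o[𝓝[≠] 0] (fun t : ℝ => t⁻¹ * t ^ (k + 1)) :=
        IsBigO.mul_isLittleO (IsBigO.of_bound 1 (Filter.Eventually.of_forall fun t => by simp)) hc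
      refine (h1.congr' ?_ ?_)
      · filter_upwards [self_mem_nhdsWithin] with t ht
        have : (t : ℂ) ≠ 0 := by exact_mod_cast ht
        rw [Finset.sum_range_succ', hc0, zero_mul, add_zero, Finset.mul_sum]
        refine Finset.sum_congr rfl fun b _ => ?_
        field_simp
        ring
      · filter_upwards [self_mem_nhdsWithin] with t ht
        have : t ≠ 0 := ht
        field_simp
        ring

open Asymptotics Topology in
/-- A `C^k` function with vanishing derivatives of order at most `k` at `p` is `o(|x - p|^k)`. -/
theorem isLittleO_of_iteratedFDeriv_eq_zero {p : Rn n} (k : ℕ) :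
    ∀ {F : Type} [NormedAddCommGroup F] [NormedSpace ℝ F] {f : Rn n → F}, ContDiffAt ℝ k f p →
      (∀ i ≤ k, iteratedFDeriv ℝ i f p = 0) → f =o[𝓝 p] (fun x => ‖x - p‖ ^ k) := by
  induction k with
  | zero =>
    intro F _ _ f hf h0
    have h1 : f p = 0 := by
      rw [← norm_eq_zero, ← norm_iteratedFDeriv_zero (𝕜 := ℝ), h0 0 le_rfl, norm_zero]
    have h2 := hf.continuousAt.tendsto
    rw [h1] at h2
    simpa using (isLittleO_one_iff ℝ).2 h2
  | succ k ih =>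
    intro F _ _ f hf h0
    have h1 : f p = 0 := by
      rw [← norm_eq_zero, ← norm_iteratedFDeriv_zero (𝕜 := ℝ), h0 0 (by omega), norm_zero]
    -- The induction hypothesis is used for the derivative, which is why the codomain is quantified
    -- inside the induction.
    have h2 := ih (hf.fderiv_right (m := k) (by norm_cast)) (fun i hi => by
      rw [← norm_eq_zero, norm_iteratedFDeriv_fderiv, h0 (i + 1) (by omega), norm_zero])
    have hd : ∀ᶠ x in 𝓝 p, DifferentiableAt ℝ f x := by
      have h3 : ContDiffAt ℝ 1 f p := hf.of_le (by exact_mod_cast Nat.le_add_left 1 k)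
      filter_upwards [h3.eventually (by simp)] with x hx using hx.differentiableAt (by simp)
    rw [isLittleO_iff] at h2 ⊢
    intro c hc
    obtain ⟨r, hr, hball⟩ := Metric.eventually_nhds_iff_ball.1 ((h2 hc).and hd)
    filter_upwards [Metric.ball_mem_nhds p hr] with x hx
    have hxr : ‖x - p‖ < r := by rwa [← dist_eq_norm]
    have hsub : Metric.closedBall p ‖x - p‖ ⊆ Metric.ball p r :=
      Metric.closedBall_subset_ball hxr
    have h3 := Convex.norm_image_sub_le_of_norm_fderiv_le (f := f) (𝕜 := ℝ)
      (C := c * ‖x - p‖ ^ k) (s := Metric.closedBall p ‖x - p‖) (x := p) (y := x)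
      (fun y hy => (hball y (hsub hy)).2) (fun y hy => by
        refine (hball y (hsub hy)).1.trans ?_
        rw [Real.norm_of_nonneg (by positivity)]
        have : ‖y - p‖ ≤ ‖x - p‖ := by rw [← dist_eq_norm]; exact hy
        gcongr)
      (convex_closedBall _ _) (by simp) (by simp [dist_eq_norm])
    rw [h1, sub_zero] at h3
    refine h3.trans_eq ?_
    rw [Real.norm_of_nonneg (by positivity), pow_succ]
    ring

end Taylor

/-! ### Pointwise bounds for derivatives of conormal functions near the hypersurface -/

section Pointwise

open FourierTransform Asymptotics Topology

variable {S U : Set (Rn n)} {s : ℝ} {f : Rn n → ℂ} {i₀ : Fin n} {h : Rn n → ℝ}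

/-- χ localizes functions and κ localizes vector fields; since κ = 1 on the support of χ, the
truncation of the fields is invisible there. -/
theorem exists_cutoffs {p : Rn n} (hU : IsOpen U) (hpU : p ∈ U) (hpΩ : p ∈ Ω) :
    ∃ (κ : Rn n → ℝ) (χ : 𝓓(Ω, ℝ)), ContDiff ℝ ∞ κ ∧ (∀ x, κ x ≠ 0 → x ∈ U) ∧
      (∀ x ∈ tsupport χ, κ x = 1) ∧ (∀ᶠ x in 𝓝 p, χ x = 1) ∧ ∀ x, |χ x| ≤ 1 := by
  obtain ⟨r, hr, hball⟩ := Metric.eventually_nhds_iff_ball.1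
    ((Ω.isOpen.eventually_mem hpΩ).and (hU.eventually_mem hpU))
  let κ : ContDiffBump p := ⟨r / 3, r / 2, by positivity, by linarith⟩
  let b : ContDiffBump p := ⟨r / 4, r / 3, by positivity, by linarith⟩
  have hbΩ : Metric.closedBall p b.rOut ⊆ Ω := fun x hx =>
    (hball x (Metric.closedBall_subset_ball (show r / 3 < r by linarith) hx)).1
  have hχ : tsupport (bumpTest b hbΩ) ⊆ Metric.closedBall p (r / 3) := b.tsupport_eq.subset
  refine ⟨κ, bumpTest b hbΩ, κ.contDiff, fun x hx => ?_, fun x hx =>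
    κ.one_of_mem_closedBall (hχ hx), b.eventuallyEq_one, fun x => ?_⟩
  · by_contra hxU
    refine hx (κ.zero_of_le_dist ?_)
    by_contra hlt
    exact hxU (hball x (Metric.mem_ball.2 ((not_le.1 hlt).trans
      (show r / 2 < r by linarith)))).2
  · exact abs_le.2 ⟨by linarith [b.nonneg' x, show bumpTest b hbΩ x = b x from rfl],
      b.le_one⟩

theorem IsConormalFun.fourierInv_flatFt (hf : IsConormalFun Ω S s f)
    (hc : IsGraphChart S U i₀ h) {L : List (SmoothVectorField Ω)} (hL : ∀ V ∈ L, V.IsTangent S)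
    {χ : 𝓓(Ω, ℝ)} (hχ : tsupport χ ⊆ U) (hi : Integrable (flatFt f i₀ h L χ)) {x : Rn n}
    (hx : ContinuousAt (fun x => χ x * L.foldr vact f x) x) :
    𝓕⁻ (flatFt f i₀ h L χ) (shear i₀ (fun x => -h x) x) = χ x * L.foldr vact f x := by
  have h1 := Integrable.fourierInv_fourier_eq
    (hc.measurePreserving.integrable_comp_of_integrable (hf.integrable hc hL hχ)) hi
    (v := shear i₀ (fun x => -h x) x) (by
      refine ContinuousAt.comp ?_ hc.contDiff_shear.continuous.continuousAt
      rwa [hc.shear_shear_neg])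
  rw [flatFt, h1]
  simp [hc.shear_shear_neg]

/-- An integrable Fourier transform bounds the function by its L¹ norm. Inversion is applied only
off S, where the derivatives are known to be continuous. -/
theorem IsConormalFun.isBigO_one (hf : IsConormalFun Ω S s f) (hs : 1 / 2 < s) {p : Rn n}
    (hp : p ∈ S) {L : List (SmoothVectorField Ω)} (hL : ∀ V ∈ L, V.IsTangent S) :
    L.foldr vact f =O[𝓝[Sᶜ] p] (fun _ => (1 : ℝ)) := by
  obtain ⟨U', g, hpU', hg⟩ := hf.hypersurface.exists_defining p hp
  obtain ⟨i₀, h, U, hpU, -, hc⟩ := exists_graphChart hg hpU' hp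
  have hpΩ := hf.hypersurface.subset hp
  obtain ⟨κ, χ, hκ, hκU, hχκ, hχ1, -⟩ := exists_cutoffs hc.isOpen hpU hpΩ
  have hχU : tsupport χ ⊆ U := fun x hx => hκU x (by rw [hχκ x hx]; norm_num)
  have hi : Integrable (flatFt f i₀ h L χ) := by
    rw [← integrable_norm_iff (hf.continuous_flatFt hc hL hχU).aestronglyMeasurable]
    simpa using hf.integrable_flatFt hc hκ hκU le_rfl (by linarith) hL hχκ
  refine IsBigO.of_bound (∫ η, ‖flatFt f i₀ h L χ η‖) ?_
  filter_upwards [mem_nhdsWithin_of_mem_nhds hχ1,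
    mem_nhdsWithin_of_mem_nhds (Ω.isOpen.mem_nhds hpΩ), self_mem_nhdsWithin] with x h1 h2 h3
  have hx : x ∈ (Ω : Set (Rn n)) \ S := ⟨h2, h3⟩
  have h4 := hf.fourierInv_flatFt hc hL hχU hi (x := x)
    ((Complex.continuous_ofReal.comp χ.continuous).continuousAt.mul
      ((contDiffOn_foldr_vact hf.hypersurface.isOpen_diff sdiff_subset hf.contDiffOn
        L).continuousOn.continuousAt (hf.hypersurface.isOpen_diff.mem_nhds hx)))
  rw [show χ x = 1 from h1, Complex.ofReal_one, one_mul] at h4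
  rw [norm_one, mul_one, ← h4, Real.fourierInv_eq']
  refine (norm_integral_le_integral_norm _).trans_eq (integral_congr_ae
    (Filter.Eventually.of_forall fun v => ?_))
  simp only [norm_smul, Complex.norm_exp_ofReal_mul_I, one_mul]

/-- A continuous conormal function whose derivatives of order at most `k` vanish on `S` is
`O(|g|^τ)`. -/
theorem IsConormalFun.isBigO_graphFun (hf : IsConormalFun Ω S s f) {k : ℕ} {τ : ℝ}
    (hkτ : (k : ℝ) < τ) (hτk : τ ≤ k + 1) (hτs : τ + 1 / 2 < s) (hfk : ContDiffOn ℝ k f Ω)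
    (hjet : ∀ p ∈ S, ∀ i ≤ k, iteratedFDeriv ℝ i f p = 0) {p : Rn n}
    (hp : p ∈ S) (hpU : p ∈ U) (hc : IsGraphChart S U i₀ h) :
    f =O[𝓝 p] (fun x => |graphFun i₀ h x| ^ τ) := by
  have hpΩ := hf.hypersurface.subset hp
  have hτ0 : 0 ≤ τ := (Nat.cast_nonneg k).trans hkτ.le
  obtain ⟨κ, χ, hκ, hκU, hχκ, hχ1, hχb⟩ := exists_cutoffs hc.isOpen hpU hpΩ
  have hχU : tsupport χ ⊆ U := fun x hx => hκU x (by rw [hχκ x hx]; norm_num)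
  have hL : ∀ V ∈ ([] : List (SmoothVectorField Ω)), V.IsTangent S := by simp
  have hiw := hf.integrable_flatFt hc hκ hκU hτ0 hτs hL hχκ
  have hi : Integrable (flatFt f i₀ h [] χ) := by
    rw [← integrable_norm_iff (hf.continuous_flatFt hc hL hχU).aestronglyMeasurable]
    simpa using hf.integrable_flatFt hc hκ hκU le_rfl (by linarith) hL hχκ
  have hcont : ∀ x, ContinuousAt (fun x => (χ x : ℂ) * f x) x := by
    intro x
    by_cases hx : x ∈ tsupport χ
    · exact (Complex.continuous_ofReal.comp χ.continuous).continuousAt.mul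
        (hf.continuousOn.continuousAt (Ω.isOpen.mem_nhds (χ.tsupport_subset hx)))
    · have h0 : (fun x => (χ x : ℂ) * f x) =ᶠ[nhds x] fun _ => (0 : ℂ) := by
        filter_upwards [(isClosed_tsupport χ).isOpen_compl.mem_nhds hx] with y hy
        rw [image_eq_zero_of_notMem_tsupport hy]; simp
      exact continuousAt_const.congr h0.symm
  obtain ⟨C, hC⟩ := exists_fourierInv_taylor i₀ hkτ.le hτk
    (hf.continuous_flatFt hc hL hχU) hiw
  have hgp : graphFun i₀ h p = 0 := (hc.mem_iff p hpU).1 hp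
  have hlim : Filter.Tendsto (fun x => x - graphFun i₀ h x • basisVec i₀) (𝓝 p) (𝓝 p) := by
    have hcn : Continuous (fun x => x - graphFun i₀ h x • basisVec i₀) :=
      continuous_id.sub (hc.contDiff_graphFun.continuous.smul continuous_const)
    simpa [hgp] using hcn.tendsto p
  refine IsBigO.of_bound C ?_
  filter_upwards [hχ1, hlim.eventually (hc.isOpen.eventually_mem hpU)] with x h1 h2
  set x' := x - graphFun i₀ h x • basisVec i₀ with hx'
  have hx'g : graphFun i₀ h x' = 0 := by
    have := hc.graphFun_add x (-graphFun i₀ h x)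
    rw [neg_smul, ← sub_eq_add_neg] at this
    rw [hx', this]; ring
  have hx'S : x' ∈ S := (hc.mem_iff x' h2).2 hx'g
  -- Expand along the normal line through x' ∈ S; the point x lies on it at parameter t = g(x).
  obtain ⟨c, hc'⟩ := hC (shear i₀ (fun x => -h x) x')
  have hval : ∀ t : ℝ, 𝓕⁻ (flatFt f i₀ h [] χ) (shear i₀ (fun x => -h x) x' + t • basisVec i₀) =
      χ (x' + t • basisVec i₀) * f (x' + t • basisVec i₀) := fun t => by
    rw [← hc.toIsShear.neg.shear_add]
    exact hf.fourierInv_flatFt hc hL hχU hi (hcont _)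
  have hline : Filter.Tendsto (fun t : ℝ => x' + t • basisVec i₀) (𝓝[≠] 0) (𝓝 x') := by
    have hcn : Continuous (fun t : ℝ => x' + t • basisVec i₀) := by fun_prop
    have := hcn.tendsto 0
    rw [zero_smul, add_zero] at this
    exact this.mono_left nhdsWithin_le_nhds
  have hsmall : (fun t : ℝ => χ (x' + t • basisVec i₀) * f (x' + t • basisVec i₀)) =o[𝓝[≠] 0]
      (fun t : ℝ => t ^ k) := by
    have h3 := (isLittleO_of_iteratedFDeriv_eq_zero k (hfk.contDiffAt
      (Ω.isOpen.mem_nhds (hf.hypersurface.subset hx'S))) (hjet x' hx'S)).comp_tendsto hline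
    have h4 : (fun t : ℝ => (χ (x' + t • basisVec i₀) : ℂ)) =O[𝓝[≠] 0] (fun _ => (1 : ℝ)) :=
      IsBigO.of_bound 1 (Filter.Eventually.of_forall fun t => by simpa using hχb _)
    have h5 := h4.mul_isLittleO h3
    refine h5.trans_isBigO (IsBigO.of_bound 1 (Filter.Eventually.of_forall fun t => ?_))
    simp [Function.comp, norm_smul, basisVec]
  -- Because τ > k, the Taylor remainder is o(t^k). So is χ f on the line, by the vanishing
  -- derivatives at x'; hence the Taylor polynomial is o(t^k) and must be zero.
  have hrem : (fun t : ℝ => |t| ^ τ) =o[𝓝[≠] 0] (fun t : ℝ => t ^ k) := by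
    have h3 : Filter.Tendsto (fun t : ℝ => |t| ^ (τ - k)) (𝓝[≠] 0) (𝓝 0) := by
      have hcn : Continuous (fun t : ℝ => |t| ^ (τ - k)) :=
        continuous_abs.rpow_const fun _ => Or.inr (by linarith)
      have := hcn.tendsto 0
      rw [abs_zero, Real.zero_rpow (by linarith)] at this
      exact this.mono_left nhdsWithin_le_nhds
    have h4 := ((isLittleO_one_iff ℝ).2 h3).mul_isBigO
      (isBigO_refl (fun t : ℝ => |t| ^ k) (𝓝[≠] 0))
    refine (h4.congr' ?_ ?_).trans_isBigO (IsBigO.of_bound 1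
      (Filter.Eventually.of_forall fun t => ?_) : (fun t : ℝ => |t| ^ k) =O[𝓝[≠] 0] _)
    · filter_upwards [self_mem_nhdsWithin] with t ht
      have : 0 < |t| := abs_pos.2 ht
      rw [← Real.rpow_natCast, ← Real.rpow_add this]
      congr 1; ring
    · exact Filter.Eventually.of_forall fun t => one_mul _
    · simp
  have hzero := eq_zero_of_polynomial_isLittleO k c (by
    have h3 : (fun t : ℝ => χ (x' + t • basisVec i₀) * f (x' + t • basisVec i₀) -
        ∑ b ∈ Finset.range (k + 1), c b * (t : ℂ) ^ b) =O[𝓝[≠] 0] (fun t : ℝ => |t| ^ τ) :=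
      IsBigO.of_bound C (Filter.Eventually.of_forall fun t => by
        rw [← hval, Real.norm_of_nonneg (by positivity)]
        exact hc' t)
    simpa using hsmall.sub (h3.trans_isLittleO hrem))
  have h6 := hc' (graphFun i₀ h x)
  rw [hval, Finset.sum_eq_zero fun b hb => by
    rw [hzero b (Nat.lt_succ_iff.1 (Finset.mem_range.1 hb)), zero_mul], sub_zero,
    hx', sub_add_cancel, h1, Complex.ofReal_one, one_mul] at h6
  rwa [Real.norm_of_nonneg (by positivity)]

end Pointwise

/-! ### Interpolation of bounds along tangent vector fields -/

section Interpolation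

open Asymptotics Topology

/-- Landau-Kolmogorov inequality on an interval: φ' varies by at most Bδ, while δ φ'(0) differs from
φ(δ) - φ(0) by at most Bδ². -/
theorem norm_deriv_zero_le {φ φ' φ'' : ℝ → ℂ} {δ A B : ℝ} (hδ : 0 < δ)
    (h1 : ∀ s ∈ Icc 0 δ, HasDerivAt φ (φ' s) s) (h2 : ∀ s ∈ Icc 0 δ, HasDerivAt φ' (φ'' s) s)
    (hA : ∀ s ∈ Icc 0 δ, ‖φ s‖ ≤ A) (hB : ∀ s ∈ Icc 0 δ, ‖φ'' s‖ ≤ B) :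
    ‖φ' 0‖ ≤ 2 * A / δ + B * δ := by
  have h0 : (0 : ℝ) ∈ Icc 0 δ := ⟨le_rfl, hδ.le⟩
  have hδm : δ ∈ Icc 0 δ := ⟨hδ.le, le_rfl⟩
  have hB0 : 0 ≤ B := (norm_nonneg _).trans (hB 0 h0)
  have h3 : ∀ s ∈ Icc 0 δ, ‖φ' s - φ' 0‖ ≤ B * δ := fun s hs =>
    (norm_image_sub_le_of_norm_deriv_le_segment' (fun x hx => (h2 x hx).hasDerivWithinAt)
      (fun x hx => hB x (Ico_subset_Icc_self hx)) s hs).trans (by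
        rw [sub_zero]; exact mul_le_mul_of_nonneg_left hs.2 hB0)
  have h4 : ∀ s ∈ Icc 0 δ, HasDerivAt (fun s => φ s - s • φ' 0) (φ' s - (1 : ℝ) • φ' 0) s :=
    fun s hs => (h1 s hs).sub ((hasDerivAt_id s).smul_const (φ' 0))
  have h5 := norm_image_sub_le_of_norm_deriv_le_segment' (C := B * δ)
    (fun x hx => (h4 x hx).hasDerivWithinAt) (fun x hx => by
      rw [one_smul]; exact h3 x (Ico_subset_Icc_self hx)) δ hδm
  have h6 : ‖δ • φ' 0‖ ≤ 2 * A + B * δ * δ := by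
    have e : δ • φ' 0 = φ δ - φ 0 - ((φ δ - δ • φ' 0) - (φ 0 - (0 : ℝ) • φ' 0)) := by
      rw [zero_smul]; abel
    rw [e]
    refine (norm_sub_le _ _).trans ?_
    rw [sub_zero] at h5
    have := norm_sub_le (φ δ) (φ 0)
    linarith [hA 0 h0, hA δ hδm]
  rw [norm_smul, Real.norm_of_nonneg hδ.le] at h6
  rw [← mul_le_mul_iff_right₀ hδ]
  refine h6.trans_eq ?_
  field_simp

/-- `γ` is a local flow of `V` near `p`, off `S`, along which `|g|` is at most doubled. -/
structure IsLocalFlow (V : SmoothVectorField Ω) (S : Set (Rn n)) (p : Rn n) (g : Rn n → ℝ)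
    (γ : Rn n → ℝ → Rn n) : Prop where
  zero : ∀ x, γ x 0 = x
  continuousAt : ContinuousAt (fun q : Rn n × ℝ => γ q.1 q.2) (p, 0)
  eventually : ∃ ε > 0, ∀ᶠ x in 𝓝[Sᶜ] p, ∀ s ∈ Icc 0 ε,
    γ x s ∉ S ∧ |g (γ x s)| ≤ 2 * |g x| ∧ HasDerivAt (γ x) (V.toFun (γ x s)) s

theorem exists_forall_mem_of_continuousAt {γ : Rn n → ℝ → Rn n} {p : Rn n}
    (hγ : ContinuousAt (fun q : Rn n × ℝ => γ q.1 q.2) (p, 0)) (h0 : γ p 0 = p)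
    {P : Rn n → Prop} (hP : ∀ᶠ x in 𝓝 p, P x) :
    ∃ ε > 0, ∀ᶠ x in 𝓝 p, ∀ s ∈ Icc (0 : ℝ) ε, P (γ x s) := by
  have h1 : ∀ᶠ q : Rn n × ℝ in 𝓝 p ×ˢ 𝓝 0, P (γ q.1 q.2) := by
    rw [← nhds_prod_eq]
    refine hγ.eventually ?_
    simpa [h0] using hP
  obtain ⟨pa, ha, pb, hb, hab⟩ := Filter.eventually_prod_iff.1 h1
  obtain ⟨ε, hε, hball⟩ := Metric.eventually_nhds_iff_ball.1 hb
  refine ⟨ε / 2, by positivity, ha.mono fun x hx s hs => hab hx (hball s ?_)⟩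
  rw [Metric.mem_ball, Real.dist_eq, sub_zero, abs_of_nonneg hs.1]
  linarith [hs.2]

variable {S U : Set (Rn n)} {i₀ : Fin n} {h : Rn n → ℝ}

theorem IsGraphChart.eventually_ne_zero (hc : IsGraphChart S U i₀ h) {p : Rn n} (hpU : p ∈ U)
    (hp : p ∈ S) : ∀ᶠ x in 𝓝[Sᶜ] p, 0 < |graphFun i₀ h x| ∧ |graphFun i₀ h x| ≤ 1 := by
  have h1 : ∀ᶠ x in 𝓝 p, |graphFun i₀ h x| < 1 := by
    refine (hc.contDiff_graphFun.continuous.abs.tendsto p).eventually (gt_mem_nhds ?_)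
    rw [(hc.mem_iff p hpU).1 hp]; simp
  filter_upwards [mem_nhdsWithin_of_mem_nhds (hc.isOpen.mem_nhds hpU), self_mem_nhdsWithin,
    mem_nhdsWithin_of_mem_nhds h1] with x hx hxS hx1
  exact ⟨abs_pos.2 fun h0 => hxS ((hc.mem_iff x hx).2 h0), le_of_lt hx1⟩

theorem IsGraphChart.rpow_isBigO (hc : IsGraphChart S U i₀ h) {p : Rn n} (hpU : p ∈ U)
    (hp : p ∈ S) {a b : ℝ} (hab : a ≤ b) :
    (fun x => |graphFun i₀ h x| ^ b) =O[𝓝[Sᶜ] p] (fun x => |graphFun i₀ h x| ^ a) := by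
  refine IsBigO.of_bound 1 ?_
  filter_upwards [hc.eventually_ne_zero hpU hp] with x hx
  rw [Real.norm_of_nonneg (by positivity), Real.norm_of_nonneg (by positivity), one_mul]
  exact Real.rpow_le_rpow_of_exponent_ge hx.1 hx.2 hab

/-- Apply the preceding inequality to F along the flow line from x. Since |g| at most doubles on it,
F is O(r^a) and V²F is O(r^b) all along, where r = |g(x)|. -/
theorem IsLocalFlow.interpolate {V : SmoothVectorField Ω} {p : Rn n}
    (hS : IsOpen ((Ω : Set (Rn n)) \ S)) (hc : IsGraphChart S U i₀ h) (hpU : p ∈ U) (hp : p ∈ S)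
    (hpΩ : p ∈ Ω)
    {γ : Rn n → ℝ → Rn n} (hγ : IsLocalFlow V S p (graphFun i₀ h) γ) {F : Rn n → ℂ}
    (hF : ContDiffOn ℝ ∞ F (Ω \ S)) {a b : ℝ} (hb : 0 ≤ b) (hab : b ≤ a)
    (h1 : F =O[𝓝[Sᶜ] p] (fun x => |graphFun i₀ h x| ^ a))
    (h2 : vact V (vact V F) =O[𝓝[Sᶜ] p] (fun x => |graphFun i₀ h x| ^ b)) :
    vact V F =O[𝓝[Sᶜ] p] (fun x => |graphFun i₀ h x| ^ ((a + b) / 2)) := by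
  obtain ⟨A, hA, hA1⟩ := h1.exists_pos
  obtain ⟨B, hB, hB1⟩ := h2.exists_pos
  have hgood := ((eventually_nhdsWithin_iff.1 hA1.bound).and
    (eventually_nhdsWithin_iff.1 hB1.bound)).and (Ω.isOpen.eventually_mem hpΩ)
  obtain ⟨ε, hε, hstay⟩ := exists_forall_mem_of_continuousAt hγ.continuousAt (hγ.zero p) hgood
  obtain ⟨ε', hε', hflow⟩ := hγ.eventually
  set δ := min ε ε' with hδdef
  have hδ : 0 < δ := lt_min hε hε'
  refine IsBigO.of_bound (2 * (A * 2 ^ a) / δ + B * 2 ^ b * δ) ?_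
  filter_upwards [mem_nhdsWithin_of_mem_nhds hstay, hflow, hc.eventually_ne_zero hpU hp]
    with x hx1 hx2 hx3
  set r := |graphFun i₀ h x| with hr
  have hr0 : 0 < r := hx3.1
  -- The flow time that balances r^a / η against r^b η.
  set η := δ * r ^ ((a - b) / 2) with hη
  have hη0 : 0 < η := by positivity
  have hηδ : η ≤ δ := mul_le_of_le_one_right hδ.le
    (Real.rpow_le_one hr0.le hx3.2 (by linarith))
  have hin : ∀ s ∈ Icc 0 η, s ∈ Icc 0 ε ∧ s ∈ Icc 0 ε' := fun s hs =>
    ⟨⟨hs.1, hs.2.trans (hηδ.trans (min_le_left _ _))⟩,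
      ⟨hs.1, hs.2.trans (hηδ.trans (min_le_right _ _))⟩⟩
  have hmem : ∀ s ∈ Icc 0 η, γ x s ∈ (Ω : Set (Rn n)) \ S := fun s hs =>
    ⟨(hx1 s (hin s hs).1).2, (hx2 s (hin s hs).2).1⟩
  have hder : ∀ G : Rn n → ℂ, ContDiffOn ℝ ∞ G (Ω \ S) → ∀ s ∈ Icc 0 η,
      HasDerivAt (fun s => G (γ x s)) (vact V G (γ x s)) s := fun G hG s hs =>
    (((hG.contDiffAt (hS.mem_nhds (hmem s hs))).differentiableAt
      (by simp)).hasFDerivAt).comp_hasDerivAt s (hx2 s (hin s hs).2).2.2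
  have hpow : ∀ {c : ℝ}, 0 ≤ c → ∀ s ∈ Icc 0 η, |graphFun i₀ h (γ x s)| ^ c ≤ 2 ^ c * r ^ c :=
    fun hc0 s hs => by
      rw [← Real.mul_rpow (by norm_num) hr0.le]
      exact Real.rpow_le_rpow (abs_nonneg _) (hx2 s (hin s hs).2).2.1 hc0
  have key := norm_deriv_zero_le (φ := fun s => F (γ x s)) (φ' := fun s => vact V F (γ x s))
    (φ'' := fun s => vact V (vact V F) (γ x s)) (A := A * (2 ^ a * r ^ a))
    (B := B * (2 ^ b * r ^ b)) hη0 (hder F hF)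
    (hder _ (contDiffOn_vact V hS sdiff_subset hF))
    (fun s hs => by
      have := (hx1 s (hin s hs).1).1.1 (hmem s hs).2
      rw [Real.norm_of_nonneg (by positivity)] at this
      exact this.trans (mul_le_mul_of_nonneg_left (hpow (hb.trans hab) s hs) hA.le))
    (fun s hs => by
      have := (hx1 s (hin s hs).1).1.2 (hmem s hs).2
      rw [Real.norm_of_nonneg (by positivity)] at this
      exact this.trans (mul_le_mul_of_nonneg_left (hpow hb s hs) hB.le))
  simp only [hγ.zero] at key
  rw [Real.norm_of_nonneg (by positivity)]
  refine key.trans_eq ?_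
  have e1 : r ^ a = r ^ ((a + b) / 2) * r ^ ((a - b) / 2) := by
    rw [← Real.rpow_add hr0]; congr 1; ring
  have e2 : r ^ b * r ^ ((a - b) / 2) = r ^ ((a + b) / 2) := by
    rw [← Real.rpow_add hr0]; congr 1; ring
  have e3 : 0 < r ^ ((a - b) / 2) := by positivity
  rw [e1, hη, ← e2]
  field_simp

/-- The curve moves in direction i and corrects along i₀ so that g stays constant; it therefore
never reaches S. -/
theorem isLocalFlow_cutoffField (hc : IsGraphChart S U i₀ h) {κ : Rn n → ℝ}
    (hκ : ContDiff ℝ ∞ κ) {p : Rn n} (hpU : p ∈ U) (hκ1 : ∀ᶠ x in 𝓝 p, κ x = 1) {i : Fin n}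
    (hi : i ≠ i₀) :
    IsLocalFlow (cutoffField Ω κ hκ hc.toIsShear i) S p (graphFun i₀ h)
      (fun x s => x + s • basisVec i + (h (x + s • basisVec i) - h x) • basisVec i₀) := by
  have hei : basisVec i i₀ = 0 := by simp [basisVec, hi.symm]
  have hz : ∀ x : Rn n, x + (0 : ℝ) • basisVec i +
      (h (x + (0 : ℝ) • basisVec i) - h x) • basisVec i₀ = x := fun x => by simp
  have hcn : ContinuousAt (fun q : Rn n × ℝ => q.1 + q.2 • basisVec i +
      (h (q.1 + q.2 • basisVec i) - h q.1) • basisVec i₀) (p, 0) := by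
    have := hc.contDiff.continuous
    fun_prop
  have hg : ∀ (x : Rn n) (s : ℝ), graphFun i₀ h (x + s • basisVec i +
      (h (x + s • basisVec i) - h x) • basisVec i₀) = graphFun i₀ h x := fun x s => by
    rw [hc.graphFun_add]
    simp only [graphFun, PiLp.add_apply, PiLp.smul_apply, hei, smul_zero, add_zero]
    ring
  refine ⟨hz, hcn, ?_⟩
  obtain ⟨ε, hε, hstay⟩ := exists_forall_mem_of_continuousAt
    (γ := fun x s => x + s • basisVec i + (h (x + s • basisVec i) - h x) • basisVec i₀)
    hcn (hz p) ((hc.isOpen.eventually_mem hpU).and hκ1)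
  refine ⟨ε, hε, ?_⟩
  filter_upwards [mem_nhdsWithin_of_mem_nhds hstay, self_mem_nhdsWithin,
    mem_nhdsWithin_of_mem_nhds (hc.isOpen.mem_nhds hpU)] with x hx hxS hxU s hs
  obtain ⟨hU, hκx⟩ := hx s hs
  refine ⟨fun hS => hxS ?_, ?_, ?_⟩
  · rw [hc.mem_iff x hxU, ← hg x s]
    exact (hc.mem_iff _ hU).1 hS
  · rw [hg]
    linarith [abs_nonneg (graphFun i₀ h x)]
  · have h1 : HasDerivAt (fun s : ℝ => x + s • basisVec i) (basisVec i) s := by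
      simpa using ((hasDerivAt_id s).smul_const (basisVec i)).const_add x
    have h2 : HasDerivAt (fun s : ℝ => h (x + s • basisVec i))
        (fderiv ℝ h (x + s • basisVec i) (basisVec i)) s :=
      ((hc.contDiff.differentiable (by simp)).differentiableAt.hasFDerivAt).comp_hasDerivAt s h1
    have h3 := h1.add ((h2.sub_const (h x)).smul_const (basisVec i₀))
    have h4 : ∀ (z : Rn n) (t : ℝ), fderiv ℝ h (z + t • basisVec i₀) = fderiv ℝ h z := fun z t => by
      rw [← fderiv_comp_add_right]
      simp only [hc.invariant]
    simp only [cutoffField, graphField]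
    rw [hκx, one_smul, h4]
    exact h3

/-- Along the field g ∂_{i₀} the function g is multiplied by e^s, so its sign is kept and S is never
reached. -/
theorem isLocalFlow_smulField (hc : IsGraphChart S U i₀ h) {κ : Rn n → ℝ}
    (hκ : ContDiff ℝ ∞ κ) {p : Rn n} (hpU : p ∈ U) (hp : p ∈ S) (hκ1 : ∀ᶠ x in 𝓝 p, κ x = 1) :
    IsLocalFlow (smulField Ω (fun x => κ x * graphFun i₀ h x) (hκ.mul hc.contDiff_graphFun)
      (basisVec i₀)) S p (graphFun i₀ h)
      (fun x s => x + (graphFun i₀ h x * (Real.exp s - 1)) • basisVec i₀) := by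
  have hz : ∀ x : Rn n, x + (graphFun i₀ h x * (Real.exp 0 - 1)) • basisVec i₀ = x :=
    fun x => by simp
  have hcn : ContinuousAt (fun q : Rn n × ℝ =>
      q.1 + (graphFun i₀ h q.1 * (Real.exp q.2 - 1)) • basisVec i₀) (p, 0) := by
    have := hc.contDiff_graphFun.continuous
    fun_prop
  have hg : ∀ (x : Rn n) (s : ℝ), graphFun i₀ h
      (x + (graphFun i₀ h x * (Real.exp s - 1)) • basisVec i₀) = graphFun i₀ h x * Real.exp s :=
    fun x s => by rw [hc.graphFun_add]; ring
  refine ⟨hz, hcn, ?_⟩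
  obtain ⟨ε, hε, hstay⟩ := exists_forall_mem_of_continuousAt
    (γ := fun x s => x + (graphFun i₀ h x * (Real.exp s - 1)) • basisVec i₀)
    hcn (hz p) ((hc.isOpen.eventually_mem hpU).and hκ1)
  -- Times up to log 2 at most double |g|.
  refine ⟨min ε (Real.log 2), lt_min hε (Real.log_pos one_lt_two), ?_⟩
  filter_upwards [mem_nhdsWithin_of_mem_nhds hstay, hc.eventually_ne_zero hpU hp] with x hx hx0 s hs
  obtain ⟨hU, hκx⟩ := hx s ⟨hs.1, hs.2.trans (min_le_left _ _)⟩
  refine ⟨fun hS => ?_, ?_, ?_⟩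
  · have h1 := (hc.mem_iff _ hU).1 hS
    rw [hg] at h1
    exact (mul_ne_zero (abs_pos.1 hx0.1) (Real.exp_pos s).ne') h1
  · rw [hg, abs_mul, abs_of_pos (Real.exp_pos s), mul_comm]
    gcongr
    calc Real.exp s ≤ Real.exp (Real.log 2) := Real.exp_le_exp.2 (hs.2.trans (min_le_right _ _))
      _ = 2 := Real.exp_log two_pos
  · have h1 : HasDerivAt (fun s : ℝ => x + (graphFun i₀ h x * (Real.exp s - 1)) • basisVec i₀)
        ((graphFun i₀ h x * Real.exp s) • basisVec i₀) s :=
      ((((Real.hasDerivAt_exp s).sub_const 1).const_mul _).smul_const _).const_add x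
    simp only [smulField]
    rw [hκx, one_mul, hg]
    exact h1

/-- Bootstrap. If first derivatives keep a fraction θ of the exponent, second derivatives keep θ²,
and interpolation improves θ to (1 + θ²)/2. Mere boundedness starts it at θ = 0, and the N-th
iterate is at least 1 - 2/(N + 2), which tends to 1. -/
theorem IsLocalFlow.isBigO_of_bounded {V : SmoothVectorField Ω} {p : Rn n}
    (hS : IsOpen ((Ω : Set (Rn n)) \ S)) (hc : IsGraphChart S U i₀ h) (hpU : p ∈ U) (hp : p ∈ S)
    (hpΩ : p ∈ Ω) {γ : Rn n → ℝ → Rn n} (hγ : IsLocalFlow V S p (graphFun i₀ h) γ)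
    {T : Set (Rn n → ℂ)} (hT : ∀ F ∈ T, ContDiffOn ℝ ∞ F (Ω \ S)) (hTV : ∀ F ∈ T, vact V F ∈ T)
    (hTb : ∀ F ∈ T, F =O[𝓝[Sᶜ] p] (fun _ => (1 : ℝ))) (N : ℕ) :
    ∀ F ∈ T, ∀ a : ℝ, 0 ≤ a → F =O[𝓝[Sᶜ] p] (fun x => |graphFun i₀ h x| ^ a) →
      vact V F =O[𝓝[Sᶜ] p] (fun x => |graphFun i₀ h x| ^ ((1 - 2 / ((N : ℝ) + 2)) * a)) := by
  induction N with
  | zero =>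
    intro F hF a _ _
    have := hTb _ (hTV F hF)
    simpa using this
  | succ N ih =>
    intro F hF a ha hFa
    set θ : ℝ := 1 - 2 / ((N : ℝ) + 2) with hθ
    have hN : (0 : ℝ) < (N : ℝ) + 2 := by positivity
    have hθ0 : 0 ≤ θ := by
      rw [hθ, sub_nonneg, div_le_one hN]; linarith [(Nat.cast_nonneg N : (0 : ℝ) ≤ N)]
    have hθ1 : θ ≤ 1 := by rw [hθ]; linarith [(by positivity : (0 : ℝ) ≤ 2 / ((N : ℝ) + 2))]
    have h1 := ih F hF a ha hFa
    have h2 := ih _ (hTV F hF) (θ * a) (by positivity) h1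
    have h3 := hγ.interpolate hS hc hpU hp hpΩ (hT F hF) (b := θ * (θ * a)) (by positivity)
      (by nlinarith [mul_nonneg hθ0 ha]) hFa h2
    refine h3.trans (hc.rpow_isBigO hpU hp ?_)
    -- The two sides differ by 2 / ((N + 2)² (N + 3)).
    have h4 : 1 - 2 / (((N + 1 : ℕ) : ℝ) + 2) ≤ (1 + θ ^ 2) / 2 := by
      rw [hθ]
      push_cast
      rw [show (N : ℝ) + 1 + 2 = N + 3 by ring]
      have e : (1 + (1 - 2 / ((N : ℝ) + 2)) ^ 2) / 2 - (1 - 2 / ((N : ℝ) + 3)) =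
          2 / (((N : ℝ) + 2) ^ 2 * (N + 3)) := by
        field_simp
        ring
      have : (0 : ℝ) ≤ 2 / (((N : ℝ) + 2) ^ 2 * (N + 3)) := by positivity
      linarith
    calc (1 - 2 / (((N + 1 : ℕ) : ℝ) + 2)) * a ≤ (1 + θ ^ 2) / 2 * a := by gcongr
      _ = (a + θ * (θ * a)) / 2 := by ring

theorem IsLocalFlow.isBigO_of_lt {V : SmoothVectorField Ω} {p : Rn n}
    (hS : IsOpen ((Ω : Set (Rn n)) \ S)) (hc : IsGraphChart S U i₀ h) (hpU : p ∈ U) (hp : p ∈ S)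
    (hpΩ : p ∈ Ω) {γ : Rn n → ℝ → Rn n} (hγ : IsLocalFlow V S p (graphFun i₀ h) γ)
    {T : Set (Rn n → ℂ)} (hT : ∀ F ∈ T, ContDiffOn ℝ ∞ F (Ω \ S)) (hTV : ∀ F ∈ T, vact V F ∈ T)
    (hTb : ∀ F ∈ T, F =O[𝓝[Sᶜ] p] (fun _ => (1 : ℝ))) {F : Rn n → ℂ} (hF : F ∈ T) {a b : ℝ}
    (hb : 0 ≤ b) (hab : b < a) (hFa : F =O[𝓝[Sᶜ] p] (fun x => |graphFun i₀ h x| ^ a)) :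
    vact V F =O[𝓝[Sᶜ] p] (fun x => |graphFun i₀ h x| ^ b) := by
  obtain ⟨N, hN⟩ := exists_nat_gt (2 * a / (a - b))
  refine (hγ.isBigO_of_bounded hS hc hpU hp hpΩ hT hTV hTb N F hF a (hb.trans hab.le) hFa).trans
    (hc.rpow_isBigO hpU hp ?_)
  have h1 : 0 < a - b := by linarith
  rw [div_lt_iff₀ h1] at hN
  rw [sub_mul, one_mul, le_sub_comm, div_mul_eq_mul_div, div_le_iff₀ (by positivity)]
  nlinarith

/-- Near p and off S, V = Σ_{i ≠ i₀} V_i W_i + q · (g ∂_{i₀}), with W_i the graph fields and q = V g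
/ g. Tangency makes q bounded, so only these model fields, whose flows are explicit, have to be
estimated. -/
theorem IsGraphChart.vact_isBigO (hc : IsGraphChart S U i₀ h) {p : Rn n} (hpU : p ∈ U)
    (hp : p ∈ S) (hpΩ : p ∈ Ω) {κ : Rn n → ℝ} (hκ : ContDiff ℝ ∞ κ)
    (hκ1 : ∀ᶠ x in 𝓝 p, κ x = 1) {V : SmoothVectorField Ω} (hV : V.IsTangent S) {F : Rn n → ℂ}
    {b : ℝ} (h1 : ∀ i, i ≠ i₀ → vact (cutoffField Ω κ hκ hc.toIsShear i) F
      =O[𝓝[Sᶜ] p] (fun x => |graphFun i₀ h x| ^ b))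
    (h2 : vact (smulField Ω (fun x => κ x * graphFun i₀ h x) (hκ.mul hc.contDiff_graphFun)
      (basisVec i₀)) F =O[𝓝[Sᶜ] p] (fun x => |graphFun i₀ h x| ^ b)) :
    vact V F =O[𝓝[Sᶜ] p] (fun x => |graphFun i₀ h x| ^ b) := by
  set q : Rn n → ℝ := fun x => fderiv ℝ (graphFun i₀ h) x (V.toFun x) / graphFun i₀ h x with hq
  obtain ⟨C, hC⟩ := hc.fderiv_graphFun_isBigO hV hp hpU hpΩ
  have hqO : (fun x => (q x : ℂ)) =O[𝓝[Sᶜ] p] (fun _ => (1 : ℝ)) := by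
    refine IsBigO.of_bound C ?_
    filter_upwards [mem_nhdsWithin_of_mem_nhds hC, hc.eventually_ne_zero hpU hp] with x hx hx0
    rw [Complex.norm_real, Real.norm_eq_abs, hq, abs_div, norm_one, mul_one, div_le_iff₀ hx0.1]
    exact hx
  have hVO : ∀ i, (fun x => (V.toFun x i : ℂ)) =O[𝓝[Sᶜ] p] (fun _ => (1 : ℝ)) := fun i =>
    (((V.contDiffOn_coord_ofReal i).continuousOn.continuousAt
      (Ω.isOpen.mem_nhds hpΩ)).tendsto.mono_left nhdsWithin_le_nhds).isBigO_one ℝ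
  have hsum : (fun x => (∑ i ∈ Finset.univ.erase i₀, (V.toFun x i : ℂ) *
      vact (cutoffField Ω κ hκ hc.toIsShear i) F x) + q x *
      vact (smulField Ω (fun x => κ x * graphFun i₀ h x) (hκ.mul hc.contDiff_graphFun)
        (basisVec i₀)) F x) =O[𝓝[Sᶜ] p] (fun x => |graphFun i₀ h x| ^ b) := by
    refine IsBigO.add (IsBigO.fun_sum fun i hi => ?_) ?_
    · simpa using (hVO i).mul (h1 i (Finset.ne_of_mem_erase hi))
    · simpa using hqO.mul h2
  refine hsum.congr' ?_ Filter.EventuallyEq.rfl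
  filter_upwards [mem_nhdsWithin_of_mem_nhds hκ1, hc.eventually_ne_zero hpU hp] with x hx hx0
  have hx1 : κ x = 1 := hx
  have hg0 : (graphFun i₀ h x : ℂ) ≠ 0 := by exact_mod_cast abs_pos.1 hx0.1
  have e1 : fderiv ℝ (graphFun i₀ h) x (V.toFun x) =
      V.toFun x i₀ - ∑ i ∈ Finset.univ.erase i₀, V.toFun x i * fderiv ℝ h x (basisVec i) := by
    rw [hc.fderiv_graphFun]
    congr 1
    conv_lhs => rw [euclidean_eq_sum (V.toFun x)]
    rw [map_sum, ← Finset.add_sum_erase _ _ (Finset.mem_univ i₀)]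
    simp [hc.fderiv_basisVec]
  have e2 : vact V F x = (V.toFun x i₀ : ℂ) * fderiv ℝ F x (basisVec i₀) +
      ∑ i ∈ Finset.univ.erase i₀, (V.toFun x i : ℂ) * fderiv ℝ F x (basisVec i) := by
    rw [vact_eq_sum, ← Finset.add_sum_erase _ _ (Finset.mem_univ i₀)]
  rw [e2]
  simp only [vact, cutoffField, smulField, hx1, one_smul, one_mul, graphField, map_add, map_smul,
    Complex.real_smul, hq]
  push_cast
  rw [div_mul_eq_mul_div, mul_left_comm, mul_div_cancel_left₀ _ hg0, e1]
  push_cast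
  rw [sub_mul, Finset.sum_mul, add_sub_left_comm, ← Finset.sum_sub_distrib]
  congr 1
  refine Finset.sum_congr rfl fun i _ => ?_
  ring

/-- Interpolation: iterated tangential derivatives of a function that is `O(|g|^a)`, and has
bounded tangential derivatives, are `O(|g|^b)` for `b < a`. -/
theorem isBigO_foldr_vact {p : Rn n} (hS : IsOpen ((Ω : Set (Rn n)) \ S))
    (hc : IsGraphChart S U i₀ h) (hpU : p ∈ U) (hp : p ∈ S) (hpΩ : p ∈ Ω) {f : Rn n → ℂ}
    (hf : ContDiffOn ℝ ∞ f (Ω \ S))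
    (hfb : ∀ L : List (SmoothVectorField Ω), (∀ V ∈ L, V.IsTangent S) →
      L.foldr vact f =O[𝓝[Sᶜ] p] (fun _ => (1 : ℝ))) {a : ℝ}
    (hfa : f =O[𝓝[Sᶜ] p] (fun x => |graphFun i₀ h x| ^ a)) (L : List (SmoothVectorField Ω))
    (hL : ∀ V ∈ L, V.IsTangent S) : ∀ b : ℝ, 0 ≤ b → b < a →
    L.foldr vact f =O[𝓝[Sᶜ] p] (fun x => |graphFun i₀ h x| ^ b) := by
  obtain ⟨κ, χ, hκ, hκU, hχκ, hχ1, -⟩ := exists_cutoffs hc.isOpen hpU hpΩ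
  have hκ1 : ∀ᶠ x in 𝓝 p, κ x = 1 := by
    filter_upwards [hχ1] with x hx
    exact hχκ x (subset_tsupport _ (by rw [Function.mem_support, hx]; exact one_ne_zero))
  -- The bootstrap needs a class closed under the model fields, with uniform membership in O(1): all
  -- iterated tangential derivatives of f.
  set T : Set (Rn n → ℂ) := {F | ∃ L : List (SmoothVectorField Ω), (∀ V ∈ L, V.IsTangent S) ∧
    F = L.foldr vact f} with hT
  have hTs : ∀ F ∈ T, ContDiffOn ℝ ∞ F (Ω \ S) := by
    rintro F ⟨L, -, rfl⟩
    exact contDiffOn_foldr_vact hS sdiff_subset hf L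
  have hTV : ∀ V : SmoothVectorField Ω, V.IsTangent S → ∀ F ∈ T, vact V F ∈ T := by
    rintro V hV F ⟨L, hL, rfl⟩
    exact ⟨V :: L, List.forall_mem_cons.2 ⟨hV, hL⟩, rfl⟩
  have hTb : ∀ F ∈ T, F =O[𝓝[Sᶜ] p] (fun _ => (1 : ℝ)) := by
    rintro F ⟨L, hL, rfl⟩
    exact hfb L hL
  induction L with
  | nil => exact fun b _ hb => hfa.trans (hc.rpow_isBigO hpU hp hb.le)
  | cons V L ih =>
    intro b hb hba
    obtain ⟨hV, hL'⟩ := List.forall_mem_cons.1 hL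
    -- Each further field costs an arbitrarily small part of the exponent.
    obtain ⟨c, hbc, hca⟩ := exists_between hba
    have hF : L.foldr vact f ∈ T := ⟨L, hL', rfl⟩
    have hFc := ih hL' c (hb.trans hbc.le) hca
    exact hc.vact_isBigO hpU hp hpΩ hκ hκ1 hV
      (fun i hi => (isLocalFlow_cutoffField hc hκ hpU hκ1 hi).isBigO_of_lt hS hc hpU hp hpΩ hTs
        (hTV _ (hc.isTangent_cutoffField hκ hκU hi)) hTb hF hb hbc hFc)
      ((isLocalFlow_smulField hc hκ hpU hp hκ1).isBigO_of_lt hS hc hpU hp hpΩ hTs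
        (hTV _ (hc.isTangent_smulField hκ hκU _)) hTb hF hb hbc hFc)

end Interpolation

/-! ### Functions vanishing to a given order at the hypersurface -/

section Flat

open Asymptotics Topology

variable {S U : Set (Rn n)} {i₀ : Fin n} {h : Rn n → ℝ}

/-- `F` is smooth off `S` and `O(dist(·, S)^τ)`. -/
structure IsFlatZero (Ω : Opens (Rn n)) (S : Set (Rn n)) (τ : ℝ) (F : Rn n → ℂ) : Prop where
  contDiffOn : ContDiffOn ℝ ∞ F (Ω \ S)
  isBigO : ∀ p ∈ S, F =O[𝓝[Sᶜ] p] (fun x => Metric.infDist x S ^ τ)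

/-- The derivatives of `F` along at most `N` tangent vector fields are `O(dist(·, S)^τ)`. -/
def IsFlatOrder (Ω : Opens (Rn n)) (S : Set (Rn n)) (τ : ℝ) : ℕ → (Rn n → ℂ) → Prop
  | 0, F => IsFlatZero Ω S τ F
  | N + 1, F => IsFlatZero Ω S τ F ∧
      ∀ V : SmoothVectorField Ω, V.IsTangent S → IsFlatOrder Ω S τ N (vact V F)

theorem isFlatOrder_succ {τ : ℝ} {N : ℕ} {F : Rn n → ℂ} : IsFlatOrder Ω S τ (N + 1) F ↔
    IsFlatZero Ω S τ F ∧
      ∀ V : SmoothVectorField Ω, V.IsTangent S → IsFlatOrder Ω S τ N (vact V F) := Iff.rfl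

/-- All derivatives of `F` along tangent vector fields are `O(dist(·, S)^τ)`. -/
def IsFlat (Ω : Opens (Rn n)) (S : Set (Rn n)) (τ : ℝ) (F : Rn n → ℂ) : Prop :=
  ∀ N, IsFlatOrder Ω S τ N F

theorem IsFlatOrder.isFlatZero {τ : ℝ} {N : ℕ} {F : Rn n → ℂ} (hF : IsFlatOrder Ω S τ N F) :
    IsFlatZero Ω S τ F := by
  cases N with
  | zero => exact hF
  | succ N => exact (isFlatOrder_succ.1 hF).1

theorem IsFlatOrder.of_succ {τ : ℝ} {N : ℕ} : ∀ {F : Rn n → ℂ},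
    IsFlatOrder Ω S τ (N + 1) F → IsFlatOrder Ω S τ N F := by
  induction N with
  | zero => exact fun hF => hF.isFlatZero
  | succ N ih => exact fun hF => isFlatOrder_succ.2 ⟨hF.isFlatZero, fun V hV =>
      ih ((isFlatOrder_succ.1 hF).2 V hV)⟩

theorem IsHypersurface.diff_mem_nhdsWithin (hS : IsHypersurface Ω S) {p : Rn n} (hp : p ∈ S) :
    (Ω : Set (Rn n)) \ S ∈ 𝓝[Sᶜ] p :=
  Filter.inter_mem (mem_nhdsWithin_of_mem_nhds (Ω.isOpen.mem_nhds (hS.subset hp)))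
    self_mem_nhdsWithin

theorem vact_congr (hS : IsHypersurface Ω S) (V : SmoothVectorField Ω) {F G : Rn n → ℂ}
    (h : EqOn F G (Ω \ S)) : EqOn (vact V F) (vact V G) (Ω \ S) := fun x hx => by
  rw [vact, vact, (Filter.eventuallyEq_of_mem (hS.isOpen_diff.mem_nhds hx) h).fderiv_eq]

theorem IsFlatOrder.congr (hS : IsHypersurface Ω S) {τ : ℝ} {N : ℕ} : ∀ {F G : Rn n → ℂ},
    IsFlatOrder Ω S τ N F → EqOn F G (Ω \ S) → IsFlatOrder Ω S τ N G := by
  have h0 : ∀ {F G : Rn n → ℂ}, IsFlatZero Ω S τ F → EqOn F G (Ω \ S) →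
      IsFlatZero Ω S τ G := fun hF h =>
    ⟨hF.1.congr fun x hx => (h hx).symm, fun p hp => (hF.2 p hp).congr'
      (Filter.eventuallyEq_of_mem (hS.diff_mem_nhdsWithin hp) h) Filter.EventuallyEq.rfl⟩
  induction N with
  | zero => exact h0
  | succ N ih =>
    exact fun hF h => isFlatOrder_succ.2 ⟨h0 hF.isFlatZero h, fun V hV =>
      ih ((isFlatOrder_succ.1 hF).2 V hV) (vact_congr hS V h)⟩

theorem differentiableAt_of_mem (hS : IsHypersurface Ω S) {F : Rn n → ℂ}
    (hF : ContDiffOn ℝ ∞ F (Ω \ S)) {x : Rn n} (hx : x ∈ (Ω : Set (Rn n)) \ S) :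
    DifferentiableAt ℝ F x :=
  (hF.contDiffAt (hS.isOpen_diff.mem_nhds hx)).differentiableAt (by simp)

theorem IsFlatOrder.add (hS : IsHypersurface Ω S) {τ : ℝ} {N : ℕ} : ∀ {F G : Rn n → ℂ},
    IsFlatOrder Ω S τ N F → IsFlatOrder Ω S τ N G →
      IsFlatOrder Ω S τ N (fun x => F x + G x) := by
  have h0 : ∀ {F G : Rn n → ℂ}, IsFlatZero Ω S τ F → IsFlatZero Ω S τ G →
      IsFlatZero Ω S τ (fun x => F x + G x) := fun hF hG =>
    ⟨hF.1.add hG.1, fun p hp => (hF.2 p hp).add (hG.2 p hp)⟩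
  induction N with
  | zero => exact h0
  | succ N ih =>
    refine fun {F G} hF hG => isFlatOrder_succ.2 ⟨h0 hF.isFlatZero hG.isFlatZero,
      fun V hV => (ih ((isFlatOrder_succ.1 hF).2 V hV)
        ((isFlatOrder_succ.1 hG).2 V hV)).congr hS fun x hx => ?_⟩
    simp only [vact]
    rw [fderiv_fun_add (differentiableAt_of_mem hS hF.isFlatZero.1 hx)
      (differentiableAt_of_mem hS hG.isFlatZero.1 hx)]
    rfl

theorem IsHypersurface.infDist_pos (hS : IsHypersurface Ω S) {p x : Rn n} (hp : p ∈ S)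
    (hx : x ∈ (Ω : Set (Rn n)) \ S) : 0 < Metric.infDist x S := by
  rw [hS.diff_eq] at hx
  exact (Metric.infDist_pos_iff_notMem_closure ⟨p, hp⟩).1 hx.2

/-- Leibniz rule; exponents add because dist(·, S) > 0 off S. Bounding the number of fields by N is
what makes the induction possible. -/
theorem IsFlatOrder.mul (hS : IsHypersurface Ω S) {σ τ : ℝ} {N : ℕ} : ∀ {F G : Rn n → ℂ},
    IsFlatOrder Ω S σ N F → IsFlatOrder Ω S τ N G →
      IsFlatOrder Ω S (σ + τ) N (fun x => F x * G x) := by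
  have h0 : ∀ {F G : Rn n → ℂ}, IsFlatZero Ω S σ F → IsFlatZero Ω S τ G →
      IsFlatZero Ω S (σ + τ) (fun x => F x * G x) := fun hF hG =>
    ⟨hF.1.mul hG.1, fun p hp => ((hF.2 p hp).mul (hG.2 p hp)).congr' Filter.EventuallyEq.rfl (by
      filter_upwards [hS.diff_mem_nhdsWithin hp] with x hx
      rw [Real.rpow_add (hS.infDist_pos hp hx)])⟩
  induction N with
  | zero => exact h0
  | succ N ih =>
    refine fun {F G} hF hG => isFlatOrder_succ.2 ⟨h0 hF.isFlatZero hG.isFlatZero, fun V hV =>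
      ((ih ((isFlatOrder_succ.1 hF).2 V hV) hG.of_succ).add hS
        (ih hF.of_succ ((isFlatOrder_succ.1 hG).2 V hV))).congr hS fun x hx => ?_⟩
    simp only [vact]
    rw [fderiv_fun_mul (differentiableAt_of_mem hS hF.isFlatZero.1 hx)
      (differentiableAt_of_mem hS hG.isFlatZero.1 hx)]
    simp
    ring

theorem isFlatOrder_of_contDiffOn (hS : IsHypersurface Ω S) {N : ℕ} : ∀ {F : Rn n → ℂ},
    ContDiffOn ℝ ∞ F Ω → IsFlatOrder Ω S 0 N F := by
  have h0 : ∀ {F : Rn n → ℂ}, ContDiffOn ℝ ∞ F Ω → IsFlatZero Ω S 0 F := fun hF =>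
    ⟨hF.mono sdiff_subset, fun p hp => by
      simpa using ((hF.continuousOn.continuousAt
        (Ω.isOpen.mem_nhds (hS.subset hp))).tendsto.mono_left nhdsWithin_le_nhds).isBigO_one ℝ⟩
  induction N with
  | zero => exact h0
  | succ N ih =>
    exact fun hF => isFlatOrder_succ.2 ⟨h0 hF, fun V _ => ih (contDiffOn_vact V Ω.isOpen le_rfl hF)⟩

theorem IsFlat.contDiffOn {τ : ℝ} {F : Rn n → ℂ} (hF : IsFlat Ω S τ F) :
    ContDiffOn ℝ ∞ F (Ω \ S) := (hF 0).isFlatZero.1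

theorem IsFlat.isBigO {τ : ℝ} {F : Rn n → ℂ} (hF : IsFlat Ω S τ F) {p : Rn n} (hp : p ∈ S) :
    F =O[𝓝[Sᶜ] p] (fun x => Metric.infDist x S ^ τ) := (hF 0).isFlatZero.2 p hp

theorem IsFlat.vact {τ : ℝ} {F : Rn n → ℂ} (hF : IsFlat Ω S τ F) {V : SmoothVectorField Ω}
    (hV : V.IsTangent S) : IsFlat Ω S τ (vact V F) := fun N =>
  (isFlatOrder_succ.1 (hF (N + 1))).2 V hV

theorem IsFlat.foldr_vact {τ : ℝ} {F : Rn n → ℂ} (hF : IsFlat Ω S τ F)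
    (L : List (SmoothVectorField Ω)) (hL : ∀ V ∈ L, V.IsTangent S) :
    IsFlat Ω S τ (L.foldr Conormal.vact F) := by
  induction L with
  | nil => exact hF
  | cons V L ih =>
    obtain ⟨hV, hL'⟩ := List.forall_mem_cons.1 hL
    exact (ih hL').vact hV

theorem IsFlat.mul (hS : IsHypersurface Ω S) {σ τ : ℝ} {F G : Rn n → ℂ} (hF : IsFlat Ω S σ F)
    (hG : IsFlat Ω S τ G) : IsFlat Ω S (σ + τ) (fun x => F x * G x) := fun N =>
  (hF N).mul hS (hG N)

theorem IsFlat.mul_contDiffOn (hS : IsHypersurface Ω S) {τ : ℝ} {F a : Rn n → ℂ}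
    (hF : IsFlat Ω S τ F) (ha : ContDiffOn ℝ ∞ a Ω) : IsFlat Ω S τ (fun x => F x * a x) :=
  fun N => by simpa using (hF N).mul hS (isFlatOrder_of_contDiffOn hS ha)

theorem IsFlat.add (hS : IsHypersurface Ω S) {τ : ℝ} {F G : Rn n → ℂ} (hF : IsFlat Ω S τ F)
    (hG : IsFlat Ω S τ G) : IsFlat Ω S τ (fun x => F x + G x) := fun N => (hF N).add hS (hG N)

theorem IsFlat.congr (hS : IsHypersurface Ω S) {τ : ℝ} {F G : Rn n → ℂ} (hF : IsFlat Ω S τ F)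
    (h : EqOn F G (Ω \ S)) : IsFlat Ω S τ G := fun N => (hF N).congr hS h

theorem IsFlat.pow (hS : IsHypersurface Ω S) {τ : ℝ} {F : Rn n → ℂ} (hF : IsFlat Ω S τ F)
    (j : ℕ) : IsFlat Ω S (j * τ) (fun x => F x ^ j) := by
  induction j with
  | zero => exact fun N => by simpa using isFlatOrder_of_contDiffOn hS contDiffOn_const
  | succ j ih =>
    have := ih.mul hS hF
    simp only [← pow_succ] at this
    rwa [show ((j + 1 : ℕ) : ℝ) * τ = j * τ + τ by push_cast; ring]

theorem isFlat_of_foldr {τ : ℝ} {F : Rn n → ℂ} (hF : ContDiffOn ℝ ∞ F (Ω \ S))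
    (hS : IsHypersurface Ω S)
    (h : ∀ L : List (SmoothVectorField Ω), (∀ V ∈ L, V.IsTangent S) → ∀ p ∈ S,
      L.foldr Conormal.vact F =O[𝓝[Sᶜ] p] (fun x => Metric.infDist x S ^ τ)) :
    IsFlat Ω S τ F := by
  have h1 : ∀ N, ∀ L : List (SmoothVectorField Ω), (∀ V ∈ L, V.IsTangent S) →
      IsFlatOrder Ω S τ N (L.foldr Conormal.vact F) := by
    intro N
    induction N with
    | zero => exact fun L hL => IsFlatZero.mk (contDiffOn_foldr_vact hS.isOpen_diff sdiff_subset hF L) (h L hL)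
    | succ N ih =>
      exact fun L hL => isFlatOrder_succ.2 ⟨⟨contDiffOn_foldr_vact hS.isOpen_diff sdiff_subset hF L,
        h L hL⟩,
        fun V hV => ih (V :: L) (List.forall_mem_cons.2 ⟨hV, hL⟩)⟩
  exact fun N => h1 N [] (by simp)

/-! ### Distance to the hypersurface compared with a defining function -/

theorem IsGraphChart.infDist_le (hc : IsGraphChart S U i₀ h) {p : Rn n} (hpU : p ∈ U)
    (hp : p ∈ S) : ∀ᶠ x in 𝓝 p, Metric.infDist x S ≤ |graphFun i₀ h x| := by
  have hgp : graphFun i₀ h p = 0 := (hc.mem_iff p hpU).1 hp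
  have hlim : Filter.Tendsto (fun x => x - graphFun i₀ h x • basisVec i₀) (𝓝 p) (𝓝 p) := by
    have hcn : Continuous (fun x => x - graphFun i₀ h x • basisVec i₀) :=
      continuous_id.sub (hc.contDiff_graphFun.continuous.smul continuous_const)
    simpa [hgp] using hcn.tendsto p
  filter_upwards [hlim.eventually (hc.isOpen.eventually_mem hpU)] with x h2
  set x' := x - graphFun i₀ h x • basisVec i₀ with hx'
  have hx'S : x' ∈ S := by
    have := hc.graphFun_add x (-graphFun i₀ h x)
    rw [neg_smul, ← sub_eq_add_neg, add_neg_cancel] at this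
    exact (hc.mem_iff x' h2).2 this
  refine (Metric.infDist_le_dist_of_mem hx'S).trans_eq ?_
  rw [dist_eq_norm, hx', sub_sub_cancel, norm_smul, Real.norm_eq_abs]
  simp [basisVec]

/-- g is Lipschitz near p and vanishes on S, so it suffices to compare x with almost nearest points
of S, which stay in the chart when x is close to p. -/
theorem IsGraphChart.le_infDist (hc : IsGraphChart S U i₀ h) {p : Rn n} (hpU : p ∈ U)
    (hp : p ∈ S) : ∃ C : ℝ, 0 ≤ C ∧ ∀ᶠ x in 𝓝 p, |graphFun i₀ h x| ≤ C * Metric.infDist x S := by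
  have hac : ContDiffAt ℝ 1 (graphFun i₀ h) p :=
    (hc.contDiff_graphFun.of_le (by norm_cast)).contDiffAt
  obtain ⟨K, t, ht, hK⟩ := hac.exists_lipschitzOnWith
  obtain ⟨r, hr, hball⟩ := Metric.mem_nhds_iff.1 (Filter.inter_mem ht (hc.isOpen.mem_nhds hpU))
  refine ⟨K, K.2, ?_⟩
  filter_upwards [Metric.ball_mem_nhds p (show 0 < r / 4 by positivity)] with x hx
  rw [Metric.mem_ball] at hx
  have hd : Metric.infDist x S ≤ dist x p := Metric.infDist_le_dist_of_mem hp
  refine le_of_forall_pos_le_add fun ε hε => ?_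
  have hK0 : (0 : ℝ) < K + 1 := by positivity
  obtain ⟨y, hy, hxy⟩ := (Metric.infDist_lt_iff ⟨p, hp⟩).1
    (show Metric.infDist x S < Metric.infDist x S + min (r / 4) (ε / (K + 1)) by
      linarith [lt_min (show 0 < r / 4 by positivity) (show 0 < ε / ((K : ℝ) + 1) by positivity)])
  have hy1 : dist x y < r / 2 := by linarith [min_le_left (r / 4) (ε / ((K : ℝ) + 1))]
  have hyb : y ∈ Metric.ball p r := by
    rw [Metric.mem_ball]
    linarith [dist_triangle_left y p x]
  have hxb : x ∈ Metric.ball p r := Metric.mem_ball.2 (by linarith)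
  have h1 := hK.dist_le_mul x (hball hxb).1 y (hball hyb).1
  rw [(hc.mem_iff y (hball hyb).2).1 hy, Real.dist_eq, sub_zero] at h1
  have h2 : (K : ℝ) * (ε / (K + 1)) ≤ ε := by
    rw [mul_div_assoc', div_le_iff₀ hK0]; nlinarith
  calc |graphFun i₀ h x| ≤ K * dist x y := h1
    _ ≤ K * (Metric.infDist x S + ε / (K + 1)) := by
      gcongr; exact hxy.le.trans (by gcongr; exact min_le_right _ _)
    _ ≤ _ := by rw [mul_add]; linarith

theorem IsGraphChart.isBigO_infDist_rpow (hc : IsGraphChart S U i₀ h) {p : Rn n} (hpU : p ∈ U)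
    (hp : p ∈ S) {τ : ℝ} (hτ : 0 ≤ τ) :
    (fun x => |graphFun i₀ h x| ^ τ) =O[𝓝[Sᶜ] p] (fun x => Metric.infDist x S ^ τ) := by
  obtain ⟨C, hC0, hC⟩ := hc.le_infDist hpU hp
  refine IsBigO.of_bound (C ^ τ) ?_
  filter_upwards [mem_nhdsWithin_of_mem_nhds hC] with x hx
  have hd : 0 ≤ Metric.infDist x S := Metric.infDist_nonneg
  rw [Real.norm_of_nonneg (by positivity), Real.norm_of_nonneg (by positivity),
    ← Real.mul_rpow hC0 hd]
  exact Real.rpow_le_rpow (abs_nonneg _) hx hτ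

theorem IsGraphChart.infDist_rpow_isBigO (hc : IsGraphChart S U i₀ h) {p : Rn n} (hpU : p ∈ U)
    (hp : p ∈ S) {τ : ℝ} (hτ : 0 ≤ τ) :
    (fun x => Metric.infDist x S ^ τ) =O[𝓝[Sᶜ] p] (fun x => |graphFun i₀ h x| ^ τ) := by
  refine IsBigO.of_bound 1 ?_
  filter_upwards [mem_nhdsWithin_of_mem_nhds (hc.infDist_le hpU hp)] with x hx
  have hd : 0 ≤ Metric.infDist x S := Metric.infDist_nonneg
  rw [Real.norm_of_nonneg (by positivity), Real.norm_of_nonneg (by positivity), one_mul]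
  exact Real.rpow_le_rpow hd hx hτ

theorem IsHypersurface.exists_chart (hS : IsHypersurface Ω S) {p : Rn n} (hp : p ∈ S) :
    ∃ (i₀ : Fin n) (h : Rn n → ℝ) (U : Set (Rn n)), p ∈ U ∧ IsGraphChart S U i₀ h := by
  obtain ⟨U', g, hpU', hg⟩ := hS.exists_defining p hp
  obtain ⟨i₀, h, U, hpU, -, hc⟩ := exists_graphChart hg hpU' hp
  exact ⟨i₀, h, U, hpU, hc⟩

/-- A continuous conormal function whose derivatives of order at most `k` vanish on `S` vanishes
there, with all its tangential derivatives, to any order between `k` and that of its Besov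
regularity. -/
theorem IsConormalFun.isFlat {s : ℝ} {f : Rn n → ℂ} (hf : IsConormalFun Ω S s f) {k : ℕ}
    {τ τ' : ℝ} (hkτ : (k : ℝ) < τ) (hττ : τ < τ') (hτk : τ' ≤ k + 1) (hτs : τ' + 1 / 2 < s)
    (hfk : ContDiffOn ℝ k f Ω) (hjet : ∀ p ∈ S, ∀ i ≤ k, iteratedFDeriv ℝ i f p = 0) :
    IsFlat Ω S τ f := by
  have hk : (0 : ℝ) ≤ k := Nat.cast_nonneg k
  refine isFlat_of_foldr hf.contDiffOn hf.hypersurface fun L hL p hp => ?_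
  obtain ⟨i₀, h, U, hpU, hc⟩ := hf.hypersurface.exists_chart hp
  have hpΩ := hf.hypersurface.subset hp
  have h1 := hf.isBigO_graphFun (hkτ.trans hττ) hτk hτs hfk hjet hp hpU hc
  exact (isBigO_foldr_vact hf.hypersurface.isOpen_diff hc hpU hp hpΩ hf.contDiffOn
    (fun L hL => hf.isBigO_one (by linarith) hp hL) (h1.mono nhdsWithin_le_nhds) L hL τ
    (by linarith) hττ).trans (hc.isBigO_infDist_rpow hpU hp (by linarith))

end Flat

/-! ### Classical and distributional derivatives along tangent vector fields agree -/

section Act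

open Asymptotics Topology

variable {S : Set (Rn n)}

theorem IsFlat.eventually_norm_le {τ : ℝ} (hτ : 0 ≤ τ) {F : Rn n → ℂ} (hF : IsFlat Ω S τ F)
    {p : Rn n} (hp : p ∈ S) : ∃ M : ℝ, ∀ᶠ x in 𝓝[Sᶜ] p, ‖F x‖ ≤ M := by
  obtain ⟨C, hC, h1⟩ := (hF.isBigO hp).exists_pos
  refine ⟨C, ?_⟩
  have h2 : ∀ᶠ x in 𝓝[Sᶜ] p, Metric.infDist x S ≤ 1 := by
    filter_upwards [mem_nhdsWithin_of_mem_nhds (Metric.ball_mem_nhds p one_pos)] with x hx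
    exact (Metric.infDist_le_dist_of_mem hp).trans (Metric.mem_ball.1 hx).le
  filter_upwards [h1.bound, h2] with x hx hx2
  have hd : 0 ≤ Metric.infDist x S := Metric.infDist_nonneg
  rw [Real.norm_of_nonneg (by positivity)] at hx
  exact hx.trans (mul_le_of_le_one_right hC.le (Real.rpow_le_one hd hx2 hτ))

/-- A nonnegative exponent bounds F near S, off S; the values of F on S are arbitrary, but S is
locally null. -/
theorem IsFlat.locallyIntegrableOn (hS : IsHypersurface Ω S) {τ : ℝ} (hτ : 0 ≤ τ) {F : Rn n → ℂ}
    (hF : IsFlat Ω S τ F) : LocallyIntegrableOn F Ω := by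
  intro x hx
  by_cases hxS : x ∈ S
  · obtain ⟨M, hM⟩ := hF.eventually_norm_le hτ hxS
    obtain ⟨i₀, h, U, hpU, hc⟩ := hS.exists_chart hxS
    obtain ⟨r, hr, hball⟩ := Metric.eventually_nhds_iff_ball.1
      (((eventually_nhdsWithin_iff.1 hM).and (Ω.isOpen.eventually_mem hx)).and
        (hc.isOpen.eventually_mem hpU))
    refine ⟨Metric.ball x r, mem_nhdsWithin_of_mem_nhds (Metric.ball_mem_nhds x hr), ?_⟩
    have hsub : Metric.ball x r \ S ⊆ (Ω : Set (Rn n)) \ S := fun y hy =>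
      ⟨(hball y hy.1).1.2, hy.2⟩
    have hopen : IsOpen (Metric.ball x r \ S) := by
      have : Metric.ball x r \ S = Metric.ball x r ∩ ((Ω : Set (Rn n)) \ S) :=
        Set.ext fun y => ⟨fun hy => ⟨hy.1, hsub hy⟩, fun hy => ⟨hy.1, hy.2.2⟩⟩
      rw [this]
      exact Metric.isOpen_ball.inter hS.isOpen_diff
    have h1 : IntegrableOn F (Metric.ball x r \ S) := by
      refine IntegrableOn.of_bound
        ((measure_mono sdiff_subset).trans_lt measure_ball_lt_top)
        ((hF.contDiffOn.continuousOn.mono hsub).aestronglyMeasurable hopen.measurableSet) M ?_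
      filter_upwards [ae_restrict_mem hopen.measurableSet] with y hy
      exact (hball y hy.1).1.1 hy.2
    have e : Metric.ball x r \ S = Metric.ball x r \ (U ∩ S) :=
      Set.ext fun y => ⟨fun hy => ⟨hy.1, fun h => hy.2 h.2⟩, fun hy => ⟨hy.1, fun hyS =>
        hy.2 ⟨(hball y hy.1).2, hyS⟩⟩⟩
    rw [e] at h1
    exact h1.congr_set_ae (sdiff_null_ae_eq_self hc.volume_inter).symm
  · have h1 := hF.contDiffOn.continuousOn.locallyIntegrableOn (μ := volume)
      hS.isOpen_diff.measurableSet x ⟨hx, hxS⟩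
    rw [hS.isOpen_diff.nhdsWithin_eq ⟨hx, hxS⟩] at h1
    rwa [Ω.isOpen.nhdsWithin_eq hx]

/-- The bound on tθ'(t) is what keeps the V-derivatives of θ(jg) bounded uniformly in j. -/
theorem exists_smooth_cutoff : ∃ θ : ℝ → ℝ, ContDiff ℝ ∞ θ ∧ (∀ t, |θ t| ≤ 1) ∧
    (∀ t, |t| ≤ 1 → θ t = 0) ∧ (∀ t, 2 ≤ |t| → θ t = 1) ∧ (∀ t, 2 < |t| → deriv θ t = 0) ∧
    ∃ C, ∀ t, |deriv θ t * t| ≤ C := by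
  have hs : ContDiff ℝ ∞ (fun t : ℝ => Real.smoothTransition (t ^ 2 - 1)) :=
    Real.smoothTransition.contDiff.comp ((contDiff_id.pow 2).sub contDiff_const)
  have h1 : ∀ t : ℝ, 2 ≤ |t| → Real.smoothTransition (t ^ 2 - 1) = 1 := fun t ht =>
    Real.smoothTransition.one_of_one_le (by rw [← sq_abs]; nlinarith)
  have h2 : ∀ t : ℝ, 2 < |t| → deriv (fun t : ℝ => Real.smoothTransition (t ^ 2 - 1)) t = 0 := by
    intro t ht
    have h3 : (fun t : ℝ => Real.smoothTransition (t ^ 2 - 1)) =ᶠ[𝓝 t] fun _ => 1 := by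
      filter_upwards [continuous_abs.continuousAt.eventually (lt_mem_nhds ht)] with y hy
      exact h1 y hy.le
    rw [h3.deriv_eq, deriv_const]
  refine ⟨_, hs, fun t => ?_, fun t ht => ?_, h1, h2, ?_⟩
  · exact abs_le.2 ⟨by linarith [Real.smoothTransition.nonneg (t ^ 2 - 1)],
      Real.smoothTransition.le_one _⟩
  · exact Real.smoothTransition.zero_of_nonpos (by rw [← sq_abs]; nlinarith [abs_nonneg t])
  · have hc : Continuous (fun t => deriv (fun t : ℝ => Real.smoothTransition (t ^ 2 - 1)) t * t) :=
      (hs.continuous_deriv (by simp)).mul continuous_id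
    obtain ⟨C, hC⟩ := (isCompact_Icc (a := (-2 : ℝ)) (b := 2)).exists_bound_of_continuousOn
      hc.continuousOn
    refine ⟨max C 0, fun t => ?_⟩
    by_cases ht : 2 < |t|
    · rw [h2 t ht]; simp
    · exact (hC t (abs_le.1 (not_lt.1 ht))).trans (le_max_left _ _)

theorem pair_coe (u : 𝓓'(Ω, ℂ)) (φ : 𝓓(Ω, ℝ)) : pair u (fun x => (φ x : ℂ)) = u φ := by
  rw [pair_eq u (isTest_coe φ)]
  have h1 : (isTest_coe φ).re = φ := by ext x; simp
  have h2 : (isTest_coe φ).im = 0 := by ext x; simp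
  rw [h1, h2]
  simp

/-- Near S, integrate by parts against φ θ(jg), which is supported off S, and let j → ∞. The
boundary term contains V(θ(jg)) = θ'(jg) j V g. Since |V g| ≤ C |g| by tangency, it is bounded
uniformly in j, and it tends to 0 off the null set g = 0. No layer on S survives. -/
theorem IsFlat.pair_act (hS : IsHypersurface Ω S) {τ : ℝ} (hτ : 0 ≤ τ) {F : Rn n → ℂ}
    (hF : IsFlat Ω S τ F) {V : SmoothVectorField Ω} (hV : V.IsTangent S) (φ : 𝓓(Ω, ℝ)) :
    pair (V.act (ofFunction Ω F)) (fun x => (φ x : ℂ)) = ∫ x, φ x * Conormal.vact V F x := by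
  have hFi := hF.locallyIntegrableOn hS hτ
  have hVi := (hF.vact hV).locallyIntegrableOn hS hτ
  have hO : ∀ ψ, IsTest hS.compl ψ → pair (V.act (ofFunction Ω F)) ψ =
      ∫ x, ψ x * Conormal.vact V F x := fun ψ hψ =>
    pair_act_of_smooth hS.compl_le hF.contDiffOn
      (fun ψ hψ => pair_ofFunction hFi (hψ.mono hS.compl_le)) V hψ
  refine testFunction_induction (P := fun φ => pair (V.act (ofFunction Ω F))
    (fun x => (φ x : ℂ)) = ∫ x, φ x * Conormal.vact V F x) ?_ ?_ ?_ φ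
  · simp [pair_zero]
  · intro φ ψ h1 h2
    have e : (fun x => ((φ + ψ) x : ℂ)) = fun x => (φ x : ℂ) + ψ x := by
      ext x; push_cast [show (φ + ψ) x = φ x + ψ x from rfl]; rfl
    rw [e, pair_add _ (isTest_coe φ) (isTest_coe ψ), h1, h2,
      ← integral_add ((isTest_coe φ).integrable_mul hVi) ((isTest_coe ψ).integrable_mul hVi)]
    refine integral_congr_ae (Filter.Eventually.of_forall fun x => ?_)
    simp only [show (φ + ψ) x = φ x + ψ x from rfl]
    push_cast
    ring
  intro p hp
  by_cases hpS : p ∉ S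
  · exact ⟨(Ω : Set (Rn n)) \ S, hS.isOpen_diff, ⟨hp, hpS⟩, fun φ hφ => hO _
      ⟨(isTest_coe φ).contDiff, (isTest_coe φ).hasCompactSupport,
        (closure_mono fun x hx => by
          simp only [Function.mem_support] at hx ⊢; contrapose! hx; simp [hx]).trans hφ⟩⟩
  rw [not_not] at hpS
  obtain ⟨i₀, h, U, hpU, hc⟩ := hS.exists_chart hpS
  obtain ⟨C, hC⟩ := hc.fderiv_graphFun_isBigO hV hpS hpU hp
  obtain ⟨W, hW, hWo, hpW⟩ := eventually_nhds_iff.1 (hC.and (hc.isOpen.eventually_mem hpU))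
  refine ⟨W, hWo, hpW, fun φ hφ => ?_⟩
  obtain ⟨θ, hθ, hθb, hθ0, hθ1, hθd, B, hB⟩ := exists_smooth_cutoff
  set g := graphFun i₀ h with hg
  set ψ : ℕ → Rn n → ℂ := fun j x => (θ (j * g x) : ℂ) with hψdef
  have hψr : ∀ j : ℕ, ContDiff ℝ ∞ (fun x => θ (j * g x)) := fun j =>
    hθ.comp (contDiff_const.mul hc.contDiff_graphFun)
  have hψ : ∀ j, ContDiff ℝ ∞ (ψ j) := fun j => Complex.ofRealCLM.contDiff.comp (hψr j)
  have hVψ : ∀ j x, Conormal.vact V (ψ j) x =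
      ((deriv θ (j * g x) * (j * fderiv ℝ g x (V.toFun x)) : ℝ) : ℂ) := by
    intro j x
    have h1 : HasFDerivAt g (fderiv ℝ g x) x :=
      ((hc.contDiff_graphFun.differentiable (by simp)) x).hasFDerivAt
    have h2 := ((hθ.differentiable (by simp)) (j * g x)).hasDerivAt.comp_hasFDerivAt x
      (h1.const_mul (j : ℝ))
    have h3 := Complex.ofRealCLM.hasFDerivAt.comp x h2
    refine (DFunLike.congr_fun h3.fderiv (V.toFun x)).trans ?_
    simp
  have hae : ∀ᵐ x : Rn n, g x ≠ 0 := by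
    rw [ae_iff]; simpa using hc.volume_graph
  have hlarge : ∀ x, g x ≠ 0 → ∀ᶠ j : ℕ in Filter.atTop, 2 < |(j : ℝ) * g x| := by
    intro x hx
    have h1 : Filter.Tendsto (fun j : ℕ => (j : ℝ) * |g x|) Filter.atTop Filter.atTop :=
      tendsto_natCast_atTop_atTop.atTop_mul_const (abs_pos.2 hx)
    filter_upwards [h1.eventually_gt_atTop 2] with j hj
    rwa [abs_mul, Nat.abs_cast]
  have hψ1 : ∀ x, g x ≠ 0 → ∀ᶠ j in Filter.atTop, ψ j x = 1 := fun x hx =>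
    (hlarge x hx).mono fun j hj => by simp [hψdef, hθ1 _ hj.le]
  have hψb : ∀ j x, ‖ψ j x‖ ≤ 1 := fun j x => by
    simpa [hψdef] using hθb _
  have hφψ : ∀ j, IsTest hS.compl (fun x => (φ x : ℂ) * ψ j x) := fun j => by
    refine ⟨(isTest_coe φ).contDiff.mul (hψ j),
      (isTest_coe φ).hasCompactSupport.mul_right, ?_⟩
    have h1 : tsupport (fun x => (φ x : ℂ) * ψ j x) ⊆
        tsupport φ ∩ {x | 1 ≤ |(j : ℝ) * g x|} := by
      refine closure_minimal (fun x hx => ?_) ((isClosed_tsupport φ).inter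
        (isClosed_le continuous_const
          (continuous_const.mul hc.contDiff_graphFun.continuous).abs))
      rw [Function.mem_support] at hx
      refine ⟨subset_tsupport _ fun h0 => hx (by simp [h0]), ?_⟩
      by_contra hlt
      exact hx (by simp [hψdef, hθ0 _ (not_le.1 hlt).le])
    refine h1.trans fun x hx => ⟨φ.tsupport_subset hx.1, fun hxS => ?_⟩
    have h2 : 1 ≤ |(j : ℝ) * g x| := hx.2
    rw [hg, (hc.mem_iff x (hW x (hφ hx.1)).2).1 hxS] at h2
    norm_num at h2
  have hid : ∀ j, ∫ x, φ x * ψ j x * Conormal.vact V F x =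
      -(∫ x, φ x * Conormal.vact V (ψ j) x * F x) - ∫ x, V.divTest φ x * ψ j x * F x := by
    intro j
    rw [← hO _ (hφψ j), pair_act_mul V _ φ (hψ j),
      pair_ofFunction hFi (isTest_coe_mul φ (contDiffOn_vact V Ω.isOpen le_rfl (hψ j).contDiffOn)),
      pair_ofFunction hFi (isTest_coe_mul _ (hψ j).contDiffOn)]
  have hlim1 : Filter.Tendsto (fun j => ∫ x, φ x * ψ j x * Conormal.vact V F x) Filter.atTop
      (𝓝 (∫ x, φ x * Conormal.vact V F x)) := by
    refine tendsto_integral_of_dominated_convergence (fun x => ‖φ x * Conormal.vact V F x‖)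
      (fun j => ((isTest_coe_mul φ (hψ j).contDiffOn).integrable_mul hVi).aestronglyMeasurable)
      ((isTest_coe φ).integrable_mul hVi).norm (fun j => Filter.Eventually.of_forall fun x => ?_) ?_
    · rw [norm_mul, norm_mul, norm_mul]
      exact mul_le_mul_of_nonneg_right (mul_le_of_le_one_right (norm_nonneg _) (hψb j x))
        (norm_nonneg _)
    · filter_upwards [hae] with x hx
      refine tendsto_const_nhds.congr' ?_
      filter_upwards [hψ1 x hx] with j hj
      rw [hj, mul_one]
  have hlim3 : Filter.Tendsto (fun j => ∫ x, V.divTest φ x * ψ j x * F x) Filter.atTop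
      (𝓝 (∫ x, V.divTest φ x * F x)) := by
    refine tendsto_integral_of_dominated_convergence (fun x => ‖V.divTest φ x * F x‖)
      (fun j => ((isTest_coe_mul _ (hψ j).contDiffOn).integrable_mul hFi).aestronglyMeasurable)
      ((isTest_coe _).integrable_mul hFi).norm (fun j => Filter.Eventually.of_forall fun x => ?_) ?_
    · rw [norm_mul, norm_mul, norm_mul]
      exact mul_le_mul_of_nonneg_right (mul_le_of_le_one_right (norm_nonneg _) (hψb j x))
        (norm_nonneg _)
    · filter_upwards [hae] with x hx
      refine tendsto_const_nhds.congr' ?_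
      filter_upwards [hψ1 x hx] with j hj
      rw [hj, mul_one]
  -- The commutator term: dominated by |B||C| times |φ F|, and eventually zero wherever g ≠ 0.
  have hlim2 : Filter.Tendsto (fun j => ∫ x, φ x * Conormal.vact V (ψ j) x * F x) Filter.atTop
      (𝓝 (∫ _ : Rn n, (0 : ℂ))) := by
    refine tendsto_integral_of_dominated_convergence (fun x => |B| * |C| * ‖φ x * F x‖)
      (fun j => ((isTest_coe_mul φ (contDiffOn_vact V Ω.isOpen le_rfl
        (hψ j).contDiffOn)).integrable_mul hFi).aestronglyMeasurable)
      (((isTest_coe φ).integrable_mul hFi).norm.const_mul _)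
      (fun j => Filter.Eventually.of_forall fun x => ?_) ?_
    · by_cases hx : x ∈ tsupport φ
      · have h1 : ‖Conormal.vact V (ψ j) x‖ ≤ |B| * |C| := by
          rw [hVψ, Complex.norm_real, Real.norm_eq_abs]
          have h2 := (hW x (hφ hx)).1
          calc |deriv θ (j * g x) * (j * fderiv ℝ g x (V.toFun x))|
              = |deriv θ (j * g x)| * j * |fderiv ℝ g x (V.toFun x)| := by
                rw [abs_mul, abs_mul, Nat.abs_cast, mul_assoc]
            _ ≤ |deriv θ (j * g x)| * j * (C * |g x|) := by gcongr
            _ = |deriv θ (j * g x) * (j * g x)| * C := by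
                rw [abs_mul, abs_mul, Nat.abs_cast]; ring
            _ ≤ |deriv θ (j * g x) * (j * g x)| * |C| := by gcongr; exact le_abs_self C
            _ ≤ |B| * |C| := mul_le_mul_of_nonneg_right ((hB _).trans (le_abs_self B)) (abs_nonneg C)
        rw [norm_mul, norm_mul, norm_mul]
        calc ‖(φ x : ℂ)‖ * ‖Conormal.vact V (ψ j) x‖ * ‖F x‖
            ≤ ‖(φ x : ℂ)‖ * (|B| * |C|) * ‖F x‖ := by gcongr
          _ = _ := by ring
      · simp [image_eq_zero_of_notMem_tsupport hx]
    · filter_upwards [hae] with x hx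
      refine tendsto_const_nhds.congr' ?_
      filter_upwards [hlarge x hx] with j hj
      rw [hVψ, hθd _ hj]
      simp
  have hfin := tendsto_nhds_unique hlim1 (by
    simp only [hid]
    exact hlim2.neg.sub hlim3)
  rw [hfin]
  have h1 := pair_act_mul V (ofFunction Ω F) φ (a := fun _ => 1) contDiff_const
  have h2 : Conormal.vact V (fun _ => (1 : ℂ)) = fun _ => 0 := by
    ext x; simp [Conormal.vact]
  simp only [h2, mul_one, mul_zero, pair_zero, neg_zero, zero_sub] at h1
  rw [h1, pair_ofFunction hFi (isTest_coe _)]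
  simp

theorem IsFlat.act_ofFunction (hS : IsHypersurface Ω S) {τ : ℝ} (hτ : 0 ≤ τ) {F : Rn n → ℂ}
    (hF : IsFlat Ω S τ F) {V : SmoothVectorField Ω} (hV : V.IsTangent S) :
    V.act (ofFunction Ω F) = ofFunction Ω (Conormal.vact V F) := by
  ext φ
  rw [← pair_coe, ← pair_coe, hF.pair_act hS hτ hV,
    pair_ofFunction ((hF.vact hV).locallyIntegrableOn hS hτ) (isTest_coe φ)]

theorem IsFlat.foldr_act_ofFunction (hS : IsHypersurface Ω S) {τ : ℝ} (hτ : 0 ≤ τ)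
    {F : Rn n → ℂ} (hF : IsFlat Ω S τ F) (L : List (SmoothVectorField Ω))
    (hL : ∀ V ∈ L, V.IsTangent S) :
    L.foldr SmoothVectorField.act (ofFunction Ω F) = ofFunction Ω (L.foldr Conormal.vact F) := by
  induction L with
  | nil => rfl
  | cons V L ih =>
    obtain ⟨hV, hL'⟩ := List.forall_mem_cons.1 hL
    rw [List.foldr_cons, ih hL', (hF.foldr_vact L hL').act_ofFunction hS hτ hV, List.foldr_cons]

end Act

/-! ### Estimates for iterated differences -/

section Differences

open FourierTransform

theorem norm_iterate_diffOp_le_of_bound (v : Rn n) (M : ℕ) : ∀ {f : Rn n → ℂ} {x : Rn n} {B : ℝ},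
    (∀ k : ℕ, k ≤ M → ‖f (x + (k : ℝ) • v)‖ ≤ B) → ‖(diffOp v)^[M] f x‖ ≤ 2 ^ M * B := by
  induction M with
  | zero => intro f x B h; simpa using h 0 le_rfl
  | succ M ih =>
    intro f x B h
    rw [Function.iterate_succ_apply]
    refine (ih (B := 2 * B) fun k hk => ?_).trans_eq (by ring)
    have h1 := h (k + 1) (by omega)
    have h2 := h k (by omega)
    rw [show x + ((k + 1 : ℕ) : ℝ) • v = x + (k : ℝ) • v + v by push_cast; module] at h1
    exact (norm_sub_le _ _).trans (by linarith)

/-- Mean value inequality, one difference at a time. D is a chain of successive derivatives,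
required only on the segment from x of length Mr, which can therefore avoid S. -/
theorem norm_iterate_diffOp_le_of_hasDerivAt (e : Rn n) {r : ℝ} (hr : 0 ≤ r) (M : ℕ) :
    ∀ (D : ℕ → Rn n → ℂ) (x : Rn n) (B : ℝ),
      (∀ b < M, ∀ s ∈ Icc 0 (M * r), HasDerivAt (fun s : ℝ => D b (x + s • e))
        (D (b + 1) (x + s • e)) s) → (∀ s ∈ Icc 0 (M * r), ‖D M (x + s • e)‖ ≤ B) →
      ‖(diffOp (r • e))^[M] (D 0) x‖ ≤ r ^ M * B := by
  induction M with
  | zero => intro D x B _ h; simpa using h 0 (by simp)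
  | succ M ih =>
    intro D x B h1 h2
    rw [Function.iterate_succ_apply]
    have hsub : ∀ s ∈ Icc 0 ((M : ℝ) * r), s ∈ Icc 0 (((M + 1 : ℕ) : ℝ) * r) ∧
        s + r ∈ Icc 0 (((M + 1 : ℕ) : ℝ) * r) := fun s hs => by
      push_cast
      exact ⟨⟨hs.1, by linarith [hs.2]⟩, ⟨by linarith [hs.1], by linarith [hs.2]⟩⟩
    have hshift : ∀ (b : ℕ) (s : ℝ), D b (x + s • e + r • e) = D b (x + (s + r) • e) :=
      fun b s => by rw [add_smul, add_assoc]
    refine (ih (fun b => diffOp (r • e) (D b)) x (r * B) (fun b hb s hs => ?_)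
      fun s hs => ?_).trans_eq (by ring)
    · simp only [diffOp, hshift]
      exact ((h1 b (by omega) (s + r) (hsub s hs).2).comp_add_const s r).sub
        (h1 b (by omega) s (hsub s hs).1)
    · simp only [diffOp, hshift]
      have hin : ∀ t ∈ Icc s (s + r), t ∈ Icc 0 (((M + 1 : ℕ) : ℝ) * r) := fun t ht =>
        ⟨hs.1.trans ht.1, ht.2.trans (hsub s hs).2.2⟩
      have := norm_image_sub_le_of_norm_deriv_le_segment'
        (f := fun s : ℝ => D M (x + s • e)) (C := B)
        (fun t ht => (h1 M (by omega) t (hin t ht)).hasDerivWithinAt)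
        (fun t ht => h2 t (hin t (Ico_subset_Icc_self ht))) (s + r) ⟨by linarith, le_rfl⟩
      rw [add_sub_cancel_left, mul_comm] at this
      exact this

theorem le_norm_exp_sub_one {α : ℝ} (hα : |α| ≤ 1) :
    2 / Real.pi * |α| ≤ ‖Complex.exp (Complex.I * (α : ℝ)) - 1‖ := by
  rw [Complex.norm_exp_I_mul_ofReal_sub_one, norm_mul, Real.norm_eq_abs, Real.norm_eq_abs, abs_two,
    Real.abs_sin_eq_sin_abs_of_abs_le_pi (by
      rw [abs_div, abs_two]; linarith [Real.pi_gt_three]), abs_div, abs_two]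
  have := Real.mul_le_sin (x := |α| / 2) (by positivity) (by linarith [Real.pi_gt_three])
  linarith

theorem exists_norm_le_mul_coord {ξ : Rn n} (hξ : ξ ≠ 0) :
    ∃ i, ‖ξ‖ ≤ (n + 1) * |ξ i| := by
  by_contra! hcon
  have h0 : 0 < ‖ξ‖ := norm_pos_iff.2 hξ
  have h1 : ‖ξ‖ ≤ ∑ i, |ξ i| := by
    conv_lhs => rw [euclidean_eq_sum ξ]
    refine (norm_sum_le _ _).trans (Finset.sum_le_sum fun i _ => ?_)
    rw [norm_smul]
    simp [basisVec]
  have h2 : (n + 1) * ∑ i, |ξ i| ≤ n * ‖ξ‖ := by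
    rw [Finset.mul_sum]
    refine (Finset.sum_le_sum fun i _ => (hcon i).le).trans_eq ?_
    simp
  nlinarith [Nat.cast_nonneg (α := ℝ) n]

theorem lintegral_comp_smul_fourier_sq {f : Rn n → ℂ} (hf : Integrable f) (hf2 : MemLp f 2) :
    ∫⁻ ξ : Rn n, ENNReal.ofReal (‖𝓕 f ((2 * Real.pi)⁻¹ • ξ)‖ ^ 2) =
      ENNReal.ofReal ((2 * Real.pi) ^ n * ∫ x, ‖f x‖ ^ 2) := by
  obtain ⟨h1, h2⟩ := fourier_memLp_two hf hf2
  have h3 := (memLp_two_iff_integrable_sq_norm h1.1).1 h1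
  have h4 : Integrable (fun ξ : Rn n => ‖𝓕 f ((2 * Real.pi)⁻¹ • ξ)‖ ^ 2) :=
    h3.comp_smul (R := (2 * Real.pi)⁻¹) (by positivity)
  rw [← h2, ← ofReal_integral_eq_lintegral_ofReal h4
    (Filter.Eventually.of_forall fun _ => by positivity)]
  congr 1
  rw [Measure.integral_comp_inv_smul_of_nonneg volume (fun ξ => ‖𝓕 f ξ‖ ^ 2)
    (by positivity : 0 ≤ 2 * Real.pi)]
  simp

/-- Bounds for iterated differences in the coordinate directions imply Besov regularity. -/
theorem exists_shell_bound_of_diffOp {D : Rn n → ℂ} (hD : Integrable D) (hD2 : MemLp D 2) {e : ℝ}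
    (he : 0 ≤ e) (M : ℕ) {C : ℝ} (hC : ∀ i, ∀ r : ℝ, 0 < r → r ≤ 1 →
      ∫ x, ‖(diffOp (r • basisVec i))^[M] D x‖ ^ 2 ≤ C * r ^ (2 * e)) :
    ∃ B : ℝ, ∀ j, ∫⁻ ξ in dyadicShell n j,
      ENNReal.ofReal ((1 + ‖ξ‖ ^ 2) ^ e * ‖𝓕 D ((2 * Real.pi)⁻¹ • ξ)‖ ^ 2) ≤ ENNReal.ofReal B := by
  set c : ℝ := (Real.pi * (n + 1))⁻¹ with hc
  have hc0 : 0 < c := by have := Real.pi_pos; positivity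
  set B₀ : ℝ := 2 ^ e * ((2 * Real.pi) ^ n * ∫ x, ‖D x‖ ^ 2) with hB₀
  set B₁ : ℝ := n * (32 ^ e * (c⁻¹) ^ (2 * M) * ((2 * Real.pi) ^ n * C)) with hB₁
  refine ⟨max B₀ B₁, fun j => ?_⟩
  cases j with
  | zero =>
    refine le_trans ?_ (ENNReal.ofReal_le_ofReal (le_max_left B₀ B₁))
    rw [hB₀, ENNReal.ofReal_mul (by positivity), ← lintegral_comp_smul_fourier_sq hD hD2,
      ← lintegral_const_mul' _ _ ENNReal.ofReal_ne_top]
    refine (setLIntegral_mono' (measurableSet_dyadicShell 0) fun ξ hξ => ?_).trans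
      (setLIntegral_le_lintegral _ _)
    rw [← ENNReal.ofReal_mul (by positivity)]
    refine ENNReal.ofReal_le_ofReal ?_
    have h1 : ‖ξ‖ < 1 := hξ
    gcongr
    nlinarith [norm_nonneg ξ]
  | succ j =>
    refine le_trans ?_ (ENNReal.ofReal_le_ofReal (le_max_right B₀ B₁))
    -- The difference step is the inverse of the outer radius, so |r ξ_i| ≤ 1 on the shell.
    set r : ℝ := ((2 : ℝ) ^ (j + 1))⁻¹ with hr
    have hr0 : 0 < r := by positivity
    have hr1 : r ≤ 1 := inv_le_one_of_one_le₀ (one_le_pow₀ one_le_two)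
    set K : ℝ := 32 ^ e * (c⁻¹) ^ (2 * M) * r⁻¹ ^ (2 * e) / 4 ^ e with hK
    set G : Fin n → Rn n → ℂ := fun i => 𝓕 ((diffOp (r • basisVec i))^[M] D) with hG
    have hpt : ∀ ξ ∈ dyadicShell n (j + 1),
        ENNReal.ofReal ((1 + ‖ξ‖ ^ 2) ^ e * ‖𝓕 D ((2 * Real.pi)⁻¹ • ξ)‖ ^ 2) ≤
        ∑ i, ENNReal.ofReal K * ENNReal.ofReal (‖G i ((2 * Real.pi)⁻¹ • ξ)‖ ^ 2) := by
      rintro ξ ⟨h1, h2⟩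
      have hξ0 : ξ ≠ 0 := norm_pos_iff.1 (lt_of_lt_of_le (by positivity) h1)
      obtain ⟨i, hi⟩ := exists_norm_le_mul_coord hξ0
      refine le_trans ?_ (Finset.single_le_sum (f := fun i => ENNReal.ofReal K *
        ENNReal.ofReal (‖G i ((2 * Real.pi)⁻¹ • ξ)‖ ^ 2)) (fun _ _ => zero_le) (Finset.mem_univ i))
      rw [← ENNReal.ofReal_mul (by positivity)]
      refine ENNReal.ofReal_le_ofReal ?_
      have h3 : |ξ i| ≤ ‖ξ‖ := by simpa using PiLp.norm_apply_le ξ i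
      have h4 : |r * ξ i| ≤ 1 := by
        rw [abs_mul, abs_of_pos hr0, hr, inv_mul_le_iff₀ (by positivity)]
        linarith
      have h5 : c ≤ ‖Complex.exp (Complex.I * ((r * ξ i : ℝ) : ℂ)) - 1‖ := by
        refine le_trans ?_ (le_norm_exp_sub_one h4)
        have h6 : (2 * (n + 1) : ℝ)⁻¹ ≤ |r * ξ i| := by
          rw [abs_mul, abs_of_pos hr0, hr, inv_mul_eq_div, le_div_iff₀ (by positivity),
            inv_mul_le_iff₀ (by positivity), pow_succ]
          linarith
        calc c = 2 / Real.pi * (2 * (n + 1) : ℝ)⁻¹ := by rw [hc]; field_simp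
          _ ≤ _ := by have := Real.pi_pos; gcongr
      have h7 : G i ((2 * Real.pi)⁻¹ • ξ) =
          (Complex.exp (Complex.I * ((r * ξ i : ℝ) : ℂ)) - 1) ^ M * 𝓕 D ((2 * Real.pi)⁻¹ • ξ) := by
        rw [hG]
        simp only
        rw [fourier_iterate_diffOp _ hD, real_inner_smul_left, inner_basisVec_left]
        congr 5
        simp only [PiLp.smul_apply, smul_eq_mul]
        have := Real.pi_pos
        field_simp
      rw [h7, norm_mul, norm_pow, mul_pow, ← pow_mul, mul_comm M 2]
      -- Here 1 + |ξ|² ≤ 2r⁻² ≤ (32/4) r⁻²; the constant has slack, and 4^e is dropped at the end.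
      have h8 : (1 + ‖ξ‖ ^ 2) ^ e ≤ 32 ^ e * r⁻¹ ^ (2 * e) / 4 ^ e := by
        have h9 : r⁻¹ ^ (2 * e) = (r⁻¹ ^ 2) ^ e := by
          rw [← Real.rpow_natCast, ← Real.rpow_mul (by positivity)]; norm_num
        rw [h9, ← Real.mul_rpow (by norm_num) (by positivity),
          ← Real.div_rpow (by positivity) (by norm_num)]
        refine Real.rpow_le_rpow (by positivity) ?_ he
        rw [hr, inv_inv]
        have : (1 : ℝ) ≤ 2 ^ (j + 1) := one_le_pow₀ one_le_two
        nlinarith [norm_nonneg ξ]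
      have h10 : 1 ≤ (c⁻¹) ^ (2 * M) *
          ‖Complex.exp (Complex.I * ((r * ξ i : ℝ) : ℂ)) - 1‖ ^ (2 * M) := by
        rw [← mul_pow]
        refine one_le_pow₀ ?_
        rw [inv_mul_eq_div, le_div_iff₀ hc0, one_mul]
        exact h5
      calc (1 + ‖ξ‖ ^ 2) ^ e * ‖𝓕 D ((2 * Real.pi)⁻¹ • ξ)‖ ^ 2
          ≤ 32 ^ e * r⁻¹ ^ (2 * e) / 4 ^ e * ‖𝓕 D ((2 * Real.pi)⁻¹ • ξ)‖ ^ 2 * 1 := by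
            rw [mul_one]; gcongr
        _ ≤ 32 ^ e * r⁻¹ ^ (2 * e) / 4 ^ e * ‖𝓕 D ((2 * Real.pi)⁻¹ • ξ)‖ ^ 2 *
            ((c⁻¹) ^ (2 * M) *
              ‖Complex.exp (Complex.I * ((r * ξ i : ℝ) : ℂ)) - 1‖ ^ (2 * M)) := by gcongr
        _ = _ := by rw [hK]; ring
    have hGi : ∀ i, ∫⁻ ξ : Rn n, ENNReal.ofReal (‖G i ((2 * Real.pi)⁻¹ • ξ)‖ ^ 2) ≤
        ENNReal.ofReal ((2 * Real.pi) ^ n * (C * r ^ (2 * e))) := fun i => by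
      rw [hG, lintegral_comp_smul_fourier_sq (integrable_iterate_diffOp _ hD M)
        (memLp_iterate_diffOp _ hD2 M)]
      refine ENNReal.ofReal_le_ofReal ?_
      gcongr
      exact hC i r hr0 hr1
    have hGm : ∀ i, Measurable fun ξ : Rn n =>
        ENNReal.ofReal K * ENNReal.ofReal (‖G i ((2 * Real.pi)⁻¹ • ξ)‖ ^ 2) := fun i => by
      have h1 : Continuous (G i) := VectorFourier.fourierIntegral_continuous
        Real.continuous_fourierChar continuous_inner (integrable_iterate_diffOp _ hD M)
      exact (((h1.comp (continuous_const_smul _)).norm.pow 2).measurable.ennreal_ofReal).const_mul _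
    calc _ ≤ ∫⁻ ξ in dyadicShell n (j + 1), ∑ i, ENNReal.ofReal K *
          ENNReal.ofReal (‖G i ((2 * Real.pi)⁻¹ • ξ)‖ ^ 2) :=
          setLIntegral_mono' (measurableSet_dyadicShell _) hpt
      _ ≤ ∫⁻ ξ : Rn n, ∑ i, ENNReal.ofReal K *
          ENNReal.ofReal (‖G i ((2 * Real.pi)⁻¹ • ξ)‖ ^ 2) := setLIntegral_le_lintegral _ _
      _ = ∑ i, ENNReal.ofReal K *
          ∫⁻ ξ : Rn n, ENNReal.ofReal (‖G i ((2 * Real.pi)⁻¹ • ξ)‖ ^ 2) := by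
        rw [lintegral_finsetSum _ fun i _ => hGm i]
        exact Finset.sum_congr rfl fun i _ => lintegral_const_mul' _ _ ENNReal.ofReal_ne_top
      _ ≤ ∑ i : Fin n, ENNReal.ofReal K *
          ENNReal.ofReal ((2 * Real.pi) ^ n * (C * r ^ (2 * e))) := by
        gcongr with i
        exact hGi i
      _ ≤ ENNReal.ofReal B₁ := by
        rw [Finset.sum_const, Finset.card_univ, Fintype.card_fin, nsmul_eq_mul,
          ← ENNReal.ofReal_mul (by positivity), ← ENNReal.ofReal_natCast,
          ← ENNReal.ofReal_mul (Nat.cast_nonneg n)]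
        -- C ≥ 0 is read off from the hypothesis in one coordinate direction, so n = 0 is separate.
        rcases n.eq_zero_or_pos with h0 | h0
        · subst h0
          simp
        refine ENNReal.ofReal_le_ofReal (mul_le_mul_of_nonneg_left ?_ (Nat.cast_nonneg n))
        have hC0 : 0 ≤ C := by
          have := hC ⟨0, h0⟩ 1 one_pos le_rfl
          rw [Real.one_rpow, mul_one] at this
          exact (integral_nonneg fun x => by positivity).trans this
        have e1 : r⁻¹ ^ (2 * e) * r ^ (2 * e) = 1 := by
          rw [← Real.mul_rpow (by positivity) hr0.le, inv_mul_cancel₀ hr0.ne', Real.one_rpow]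
        have e2 : (1 : ℝ) ≤ 4 ^ e := Real.one_le_rpow (by norm_num) he
        calc K * ((2 * Real.pi) ^ n * (C * r ^ (2 * e)))
            = 32 ^ e * (c⁻¹) ^ (2 * M) * ((2 * Real.pi) ^ n * C) *
              (r⁻¹ ^ (2 * e) * r ^ (2 * e)) / 4 ^ e := by rw [hK]; ring
          _ ≤ _ := by
            rw [e1, mul_one]
            exact div_le_self (by positivity) e2

end Differences

/-! ### Differences of functions vanishing to a given order at the hypersurface -/

section ShearVolume

variable {i₀ : Fin n} {h : Rn n → ℝ}

/-- The layer of width r around the graph has volume O(r), stated for a weight with tails. After the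
shear the integrand is dominated by a product whose normal factor integrates to πr. This power of r
is the gain of 1/2 in Besov order. -/
theorem IsShear.exists_integral_le (hh : IsShear i₀ h) (R : ℝ) :
    ∃ V : ℝ, 0 ≤ V ∧ ∀ r : ℝ, 0 < r →
      ∫ x in Metric.closedBall (0 : Rn n) R, (1 + (graphFun i₀ h x / r) ^ 2)⁻¹ ≤ V * r := by
  obtain ⟨R', hR'⟩ := (((isCompact_closedBall (0 : Rn n) R).image
    hh.neg.contDiff_shear.continuous).isBounded).exists_norm_le
  set I : Set ℝ := Icc (-R') R' with hI
  refine ⟨Real.pi * ∏ i ∈ Finset.univ.erase i₀, ∫ t : ℝ, I.indicator 1 t, ?_, fun r hr => ?_⟩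
  · exact mul_nonneg Real.pi_pos.le (Finset.prod_nonneg fun i _ =>
      integral_nonneg fun t => indicator_nonneg (fun _ _ => zero_le_one) t)
  set f : Fin n → ℝ → ℝ := fun i =>
    if i = i₀ then fun t => (1 + (t / r) ^ 2)⁻¹ else I.indicator 1 with hf
  have hf0 : ∀ i t, 0 ≤ f i t := fun i t => by
    simp only [hf]
    split_ifs
    · positivity
    · exact indicator_nonneg (fun _ _ => zero_le_one) t
  have hfi : ∀ i, Integrable (f i) := fun i => by
    simp only [hf]
    split_ifs
    · exact integrable_inv_one_add_sq.comp_div hr.ne'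
    · exact (integrable_indicator_iff measurableSet_Icc).2
        (integrableOn_const (by simp))
  have hprod : Integrable (fun y : Rn n => ∏ i, f i (y i)) :=
    (PiLp.volume_preserving_ofLp (Fin n)).integrable_comp_of_integrable
      (Integrable.fintype_prod hfi)
  have hval : ∫ y : Rn n, ∏ i, f i (y i) =
      Real.pi * (∏ i ∈ Finset.univ.erase i₀, ∫ t : ℝ, I.indicator 1 t) * r := by
    rw [(PiLp.volume_preserving_ofLp (Fin n)).integral_comp
      (MeasurableEquiv.toLp 2 (Fin n → ℝ)).symm.measurableEmbedding
      (fun y : Fin n → ℝ => ∏ i, f i (y i)), integral_fintype_prod_volume_eq_prod,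
      ← Finset.mul_prod_erase _ _ (Finset.mem_univ i₀)]
    have e1 : ∫ t, f i₀ t = r * Real.pi := by
      simp only [hf, if_true]
      rw [Measure.integral_comp_div (fun t : ℝ => (1 + t ^ 2)⁻¹) r,
        integral_univ_inv_one_add_sq, abs_of_pos hr, smul_eq_mul]
    have e2 : ∏ i ∈ Finset.univ.erase i₀, ∫ t, f i t =
        ∏ i ∈ Finset.univ.erase i₀, ∫ t : ℝ, I.indicator 1 t :=
      Finset.prod_congr rfl fun i hi => by
        simp only [hf, if_neg (Finset.ne_of_mem_erase hi)]
    rw [e1, e2]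
    ring
  rw [← hval, ← integral_indicator Metric.isClosed_closedBall.measurableSet,
    ← hh.measurePreserving.integral_comp hh.measurableEmbedding]
  refine integral_mono_of_nonneg (Filter.Eventually.of_forall fun y =>
    indicator_nonneg (fun x _ => by positivity) _) hprod (Filter.Eventually.of_forall fun y => ?_)
  by_cases hy : shear i₀ h y ∈ Metric.closedBall (0 : Rn n) R
  · have hy' : ‖y‖ ≤ R' := by
      have := hR' _ (mem_image_of_mem _ hy)
      rwa [hh.shear_neg_shear] at this
    simp only [indicator_of_mem hy, hh.graphFun_shear]
    rw [← Finset.mul_prod_erase _ _ (Finset.mem_univ i₀), Finset.prod_eq_one, mul_one]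
    · simp [hf]
    · intro i hi
      have h1 : |y i| ≤ R' := by
        have := PiLp.norm_apply_le y i
        rw [Real.norm_eq_abs] at this
        exact this.trans hy'
      simp only [hf, if_neg (Finset.ne_of_mem_erase hi)]
      rw [indicator_of_mem (show y i ∈ I from abs_le.1 h1), Pi.one_apply]
  · simp only [indicator_of_notMem hy]
    exact Finset.prod_nonneg fun i _ => hf0 i _

theorem exists_abs_sub_le_of_contDiff {g : Rn n → ℝ} (hg : ContDiff ℝ ∞ g) (R : ℝ) :
    ∃ Λ : ℝ, 1 ≤ Λ ∧ ∀ x ∈ Metric.closedBall (0 : Rn n) R, ∀ y ∈ Metric.closedBall (0 : Rn n) R,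
      |g y - g x| ≤ Λ * ‖y - x‖ := by
  obtain ⟨Λ, hΛ⟩ := (isCompact_closedBall (0 : Rn n) R).exists_bound_of_continuousOn
    (hg.continuous_fderiv (by simp)).continuousOn
  refine ⟨max Λ 1, le_max_right _ _, fun x hx y hy => ?_⟩
  exact (convex_closedBall (0 : Rn n) R).norm_image_sub_le_of_norm_fderiv_le
    (fun z _ => (hg.differentiable (by simp)).differentiableAt)
    (fun z hz => (hΛ z hz).trans (le_max_left _ _)) hx hy

/-- Near the graph, where |g(x)| < ar, all points of the difference have |g| ≤ 2ar, and the bound on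
D 0 gives O(r^τ). Farther away the segment stays at |g| ≥ |g(x)|/2, and the M-th derivative gives
r^M |g|^(τ-M) = r^τ (|g|/r)^(τ-M), at most a constant times r^τ (|g|/r)⁻¹ since M ≥ τ + 1. Both
squares fit under the same integrable profile. -/
theorem IsShear.exists_norm_iterate_diffOp_le (hh : IsShear i₀ h) {D : ℕ → Rn n → ℂ} {e : Rn n}
    (he : ‖e‖ = 1) {A R τ : ℝ} {M : ℕ} (hτ : 0 ≤ τ) (hM : τ + 1 ≤ M)
    (hD : ∀ b < M, ∀ (x : Rn n) (s : ℝ), graphFun i₀ h (x + s • e) ≠ 0 →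
      HasDerivAt (fun s : ℝ => D b (x + s • e)) (D (b + 1) (x + s • e)) s)
    (h0 : ∀ x, ‖D 0 x‖ ≤ A * |graphFun i₀ h x| ^ τ) (hR : ∀ x, R < ‖x‖ → D 0 x = 0)
    (hDM : ∀ x, graphFun i₀ h x ≠ 0 → ‖D M x‖ ≤ A * |graphFun i₀ h x| ^ (τ - M)) :
    ∃ C : ℝ, 0 ≤ C ∧ ∀ r : ℝ, 0 < r → r ≤ 1 → ∀ x, ‖(diffOp (r • e))^[M] (D 0) x‖ ^ 2 ≤
      (Metric.closedBall (0 : Rn n) (R + M)).indicator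
        (fun x => C * r ^ (2 * τ) * (1 + (graphFun i₀ h x / r) ^ 2)⁻¹) x := by
  set g := graphFun i₀ h with hg
  obtain ⟨Λ, hΛ1, hΛ⟩ := exists_abs_sub_le_of_contDiff hh.contDiff_graphFun (R + M + M)
  have hM1 : (1 : ℝ) ≤ M := by linarith
  -- With Λ a Lipschitz constant of g, g varies by at most ΛMr = ar/2 along the segment.
  set a : ℝ := 2 * Λ * M with ha
  have ha2 : 2 ≤ a := by rw [ha]; nlinarith
  have hA : 0 ≤ A ∨ ∀ x, D 0 x = 0 := by
    by_cases hA : 0 ≤ A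
    · exact Or.inl hA
    · refine Or.inr fun x => norm_le_zero_iff.1 ((h0 x).trans ?_)
      exact mul_nonpos_of_nonpos_of_nonneg (not_le.1 hA).le (by positivity)
  rcases hA with hA | hA
  swap
  · refine ⟨0, le_rfl, fun r _ _ x => ?_⟩
    have := norm_iterate_diffOp_le_of_bound (r • e) M (f := D 0) (x := x) (B := 0)
      fun k _ => by rw [hA, norm_zero]
    rw [mul_zero] at this
    rw [norm_le_zero_iff.1 this]
    simp
  set C₁ : ℝ := A ^ 2 * 8 with hC₁
  set C₂ : ℝ := (2 ^ M * (A * (2 * a) ^ τ)) ^ 2 * (1 + a ^ 2) with hC₂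
  refine ⟨max C₁ C₂, le_max_of_le_left (by positivity), fun r hr hr1 x => ?_⟩
  have hstep : ∀ s : ℝ, 0 ≤ s → ‖s • e‖ = s := fun s hs => by
    rw [norm_smul, he, mul_one, Real.norm_of_nonneg hs]
  have hk : ∀ k : ℕ, k ≤ M → (k : ℝ) * r ≤ M * r ∧ M * r ≤ M := fun k hk =>
    ⟨mul_le_mul_of_nonneg_right (by exact_mod_cast hk) hr.le,
      mul_le_of_le_one_right (by positivity) hr1⟩
  have hMr : M * r ≤ M := (hk 0 (Nat.zero_le _)).2
  have hr2 : r ^ (2 * τ) = (r ^ τ) ^ 2 := by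
    rw [← Real.rpow_natCast, ← Real.rpow_mul hr.le, mul_comm]; norm_num
  by_cases hx : x ∈ Metric.closedBall (0 : Rn n) (R + M)
  swap
  · have := norm_iterate_diffOp_le_of_bound (r • e) M (f := D 0) (x := x) (B := 0)
      fun k hkM => by
        rw [hR, norm_zero]
        rw [mem_closedBall_zero_iff, not_le] at hx
        have h1 := norm_sub_le (x + (k : ℝ) • r • e) ((k : ℝ) • r • e)
        rw [add_sub_cancel_right, smul_smul, hstep _ (by positivity)] at h1
        rw [smul_smul]
        linarith [hk k hkM]
    rw [mul_zero] at this
    rw [norm_le_zero_iff.1 this, indicator_of_notMem hx]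
    simp
  rw [indicator_of_mem hx, hr2]
  have hseg : ∀ s ∈ Icc 0 (M * r), |g (x + s • e) - g x| ≤ Λ * M * r := fun s hs => by
    rw [mem_closedBall_zero_iff] at hx
    have h1 := hΛ x (by rw [mem_closedBall_zero_iff]; linarith) (x + s • e) (by
      rw [mem_closedBall_zero_iff]
      refine (norm_add_le _ _).trans ?_
      rw [hstep s hs.1]
      linarith [hs.2])
    rw [add_sub_cancel_left, hstep s hs.1] at h1
    refine h1.trans ?_
    rw [mul_assoc]
    exact mul_le_mul_of_nonneg_left hs.2 (by linarith)
  rcases le_or_gt (a * r) |g x| with hcase | hcase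
  · have hgx : 0 < |g x| := lt_of_lt_of_le (by positivity) hcase
    have hhalf : ∀ s ∈ Icc 0 (M * r), |g x| / 2 ≤ |g (x + s • e)| := fun s hs => by
      have h1 := hseg s hs
      have h2 := abs_sub_abs_le_abs_sub (g x) (g (x + s • e))
      rw [abs_sub_comm] at h2
      rw [ha] at hcase
      linarith
    have hne : ∀ s ∈ Icc 0 (M * r), g (x + s • e) ≠ 0 := fun s hs =>
      abs_pos.1 (lt_of_lt_of_le (by positivity) (hhalf s hs))
    have h1 := norm_iterate_diffOp_le_of_hasDerivAt e hr.le M D x (A * (|g x| / 2) ^ (τ - M))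
      (fun b hb s hs => hD b hb x s (hne s hs)) (fun s hs => (hDM _ (hne s hs)).trans
        (mul_le_mul_of_nonneg_left (Real.rpow_le_rpow_of_nonpos (by positivity) (hhalf s hs)
          (by linarith)) hA))
    set t : ℝ := |g x| / r with ht
    have ht2 : 2 ≤ t := by
      rw [ht, le_div_iff₀ hr]
      exact (mul_le_mul_of_nonneg_right ha2 hr.le).trans hcase
    have h2 : r ^ M * (A * (|g x| / 2) ^ (τ - M)) = A * r ^ τ * (t / 2) ^ (τ - M) := by
      rw [show |g x| / 2 = r * (t / 2) by rw [ht]; field_simp, Real.mul_rpow hr.le (by positivity),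
        Real.rpow_sub hr, Real.rpow_natCast]
      field_simp
    have h3 : (t / 2) ^ (τ - M) ≤ (t / 2)⁻¹ := by
      rw [← Real.rpow_neg_one]
      exact Real.rpow_le_rpow_of_exponent_le (by linarith) (by linarith)
    have h4 : (g x / r) ^ 2 = t ^ 2 := by rw [ht, div_pow, div_pow, sq_abs]
    rw [h4]
    calc ‖(diffOp (r • e))^[M] (D 0) x‖ ^ 2 ≤ (A * r ^ τ * (t / 2)⁻¹) ^ 2 := by
          refine pow_le_pow_left₀ (norm_nonneg _) ?_ 2
          rw [h2] at h1
          exact h1.trans (mul_le_mul_of_nonneg_left h3 (by positivity))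
      _ = A ^ 2 * (r ^ τ) ^ 2 * (4 / t ^ 2) := by field_simp; norm_num
      _ ≤ A ^ 2 * (r ^ τ) ^ 2 * (8 * (1 + t ^ 2)⁻¹) := by
          refine mul_le_mul_of_nonneg_left ?_ (by positivity)
          rw [← div_eq_mul_inv, div_le_div_iff₀ (by positivity) (by positivity)]
          nlinarith
      _ = C₁ * (r ^ τ) ^ 2 * (1 + t ^ 2)⁻¹ := by rw [hC₁]; ring
      _ ≤ _ := by gcongr; exact le_max_left _ _
  · have h1 := norm_iterate_diffOp_le_of_bound (r • e) M (f := D 0) (x := x)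
      (B := A * (2 * a * r) ^ τ) fun k hkM => by
        refine (h0 _).trans (mul_le_mul_of_nonneg_left (Real.rpow_le_rpow (abs_nonneg _) ?_ hτ) hA)
        rw [smul_smul]
        have h2 := hseg (k * r) ⟨by positivity, (hk k hkM).1⟩
        have h3 := abs_sub_abs_le_abs_sub (g (x + (k * r) • e)) (g x)
        have h4 : 0 ≤ a * r := by positivity
        have h5 : Λ * M * r = a * r / 2 := by rw [ha]; ring
        rw [h5] at h2
        linarith
    rw [Real.mul_rpow (by positivity) hr.le] at h1
    have h6 : (1 : ℝ) ≤ (1 + a ^ 2) * (1 + (g x / r) ^ 2)⁻¹ := by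
      rw [← div_eq_mul_inv, one_le_div (by positivity), ← sq_abs (g x / r), abs_div,
        abs_of_pos hr]
      have : |g x| / r ≤ a := (div_le_iff₀ hr).2 hcase.le
      gcongr
    calc ‖(diffOp (r • e))^[M] (D 0) x‖ ^ 2 ≤ (2 ^ M * (A * ((2 * a) ^ τ * r ^ τ))) ^ 2 * 1 := by
          rw [mul_one]
          exact pow_le_pow_left₀ (norm_nonneg _) h1 2
      _ ≤ (2 ^ M * (A * ((2 * a) ^ τ * r ^ τ))) ^ 2 * ((1 + a ^ 2) * (1 + (g x / r) ^ 2)⁻¹) :=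
          mul_le_mul_of_nonneg_left h6 (by positivity)
      _ = C₂ * (r ^ τ) ^ 2 * (1 + (g x / r) ^ 2)⁻¹ := by rw [hC₂]; ring
      _ ≤ _ := by gcongr; exact le_max_right _ _

end ShearVolume

/-! ### Iterated directional derivatives -/

section DirDeriv

/-- The `b`-th derivative of `F` in the direction `e`. -/
def dirDeriv (e : Rn n) (b : ℕ) (F : Rn n → ℂ) : Rn n → ℂ :=
  (fun G x => fderiv ℝ G x e)^[b] F

theorem dirDeriv_succ (e : Rn n) (b : ℕ) (F : Rn n → ℂ) (x : Rn n) :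
    dirDeriv e (b + 1) F x = fderiv ℝ (dirDeriv e b F) x e := by
  rw [dirDeriv, Function.iterate_succ_apply', ← dirDeriv]

theorem contDiffOn_dirDeriv {O : Set (Rn n)} (hO : IsOpen O) {F : Rn n → ℂ}
    (hF : ContDiffOn ℝ ∞ F O) (e : Rn n) (b : ℕ) : ContDiffOn ℝ ∞ (dirDeriv e b F) O := by
  induction b with
  | zero => exact hF
  | succ b ih =>
    have h1 : ContDiffOn ℝ ∞ (fderiv ℝ (dirDeriv e b F)) O :=
      ih.fderiv_of_isOpen hO (by simp)
    exact (h1.clm_apply contDiffOn_const).congr fun x _ => dirDeriv_succ e b F x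

theorem dirDeriv_eq_zero {O : Set (Rn n)} (hO : IsOpen O) {F : Rn n → ℂ}
    (hF : ∀ x ∈ O, F x = 0) (e : Rn n) (b : ℕ) : ∀ x ∈ O, dirDeriv e b F x = 0 := by
  induction b with
  | zero => exact hF
  | succ b ih =>
    intro x hx
    have h1 : dirDeriv e b F =ᶠ[nhds x] fun _ => 0 :=
      Filter.eventuallyEq_of_mem (hO.mem_nhds hx) ih
    rw [dirDeriv_succ, h1.fderiv_eq]
    simp

theorem hasDerivAt_dirDeriv {O : Set (Rn n)} (hO : IsOpen O) {F : Rn n → ℂ}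
    (hF : ContDiffOn ℝ ∞ F O) (e : Rn n) (b : ℕ) {x : Rn n} {s : ℝ} (hx : x + s • e ∈ O) :
    HasDerivAt (fun s : ℝ => dirDeriv e b F (x + s • e)) (dirDeriv e (b + 1) F (x + s • e)) s := by
  have h1 : HasDerivAt (fun s : ℝ => x + s • e) e s := by
    simpa using ((hasDerivAt_id s).smul_const e).const_add x
  rw [dirDeriv_succ]
  exact (((contDiffOn_dirDeriv hO hF e b).contDiffAt (hO.mem_nhds hx)).differentiableAt
    (by simp)).hasFDerivAt.comp_hasDerivAt s h1

/-- The commutation rule that trades normal derivatives, weighted by powers of g, for applications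
of the tangential field g ∂_e. -/
theorem fderiv_pow_mul_apply {g : Rn n → ℝ} {G : Rn n → ℂ} {x : Rn n} (hg : DifferentiableAt ℝ g x)
    (hG : DifferentiableAt ℝ G x) (b : ℕ) (e : Rn n) :
    (g x : ℂ) * fderiv ℝ (fun x => (g x : ℂ) ^ b * G x) x e =
      b * fderiv ℝ g x e * ((g x : ℂ) ^ b * G x) + (g x : ℂ) ^ (b + 1) * fderiv ℝ G x e := by
  have h1 : HasFDerivAt (fun x => (g x : ℂ)) (Complex.ofRealCLM ∘L fderiv ℝ g x) x :=
    Complex.ofRealCLM.hasFDerivAt.comp x hg.hasFDerivAt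
  rw [HasFDerivAt.fderiv (f := fun x => (g x : ℂ) ^ b * G x) ((h1.pow b).mul hG.hasFDerivAt)]
  cases b with
  | zero => simp
  | succ b =>
    simp [pow_succ]
    ring

end DirDeriv

/-! ### Normal derivatives of functions vanishing to a given order at the hypersurface -/

section Chart

open Asymptotics Topology

variable {S U : Set (Rn n)} {i₀ : Fin n} {h : Rn n → ℝ}

/-- The function `χ F`, set to zero on the graph of `h`. -/
def offGraph (i₀ : Fin n) (h : Rn n → ℝ) (χ : Rn n → ℝ) (F : Rn n → ℂ) (x : Rn n) : ℂ :=
  if graphFun i₀ h x = 0 then 0 else χ x * F x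

/-- A zero of g that is not in S lies outside U, where χ already vanishes. -/
theorem IsGraphChart.offGraph_eq (hc : IsGraphChart S U i₀ h) {χ : Rn n → ℝ}
    (hχ : tsupport χ ⊆ U) (F : Rn n → ℂ) {x : Rn n} (hx : x ∉ S) :
    offGraph i₀ h χ F x = χ x * F x := by
  rw [offGraph]
  split_ifs with h0
  · rw [image_eq_zero_of_notMem_tsupport fun hxχ => hx ((hc.mem_iff x (hχ hxχ)).2 h0)]
    simp
  · rfl

theorem offGraph_eq_zero {χ : Rn n → ℝ} (F : Rn n → ℂ) {x : Rn n} (hx : x ∉ tsupport χ) :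
    offGraph i₀ h χ F x = 0 := by
  rw [offGraph, image_eq_zero_of_notMem_tsupport hx]
  simp

theorem IsShear.offGraph_ae_eq (hh : IsShear i₀ h) (χ : Rn n → ℝ) (F : Rn n → ℂ) :
    offGraph i₀ h χ F =ᵐ[volume] fun x => χ x * F x := by
  filter_upwards [measure_eq_zero_iff_ae_notMem.1 hh.volume_graph] with x hx
  exact if_neg hx

theorem IsGraphChart.isOpen_union (hc : IsGraphChart S U i₀ h) (χ : Rn n → ℝ) :
    IsOpen ({x | graphFun i₀ h x ≠ 0} ∪ (tsupport χ)ᶜ) :=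
  (isOpen_ne_fun hc.contDiff_graphFun.continuous continuous_const).union
    (isClosed_tsupport χ).isOpen_compl

theorem IsGraphChart.mem_union (hc : IsGraphChart S U i₀ h) {χ : Rn n → ℝ}
    (hχ : tsupport χ ⊆ U) {x : Rn n} (hx : x ∉ S) :
    x ∈ {x | graphFun i₀ h x ≠ 0} ∪ (tsupport χ)ᶜ := by
  by_cases hxχ : x ∈ tsupport χ
  · exact Or.inl fun h0 => hx ((hc.mem_iff x (hχ hxχ)).2 h0)
  · exact Or.inr hxχ

theorem IsFlat.contDiffOn_offGraph {τ : ℝ} {F : Rn n → ℂ} (hF : IsFlat Ω S τ F)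
    (hS : IsHypersurface Ω S) (hc : IsGraphChart S U i₀ h) {χ : 𝓓(Ω, ℝ)} (hχ : tsupport χ ⊆ U) :
    ContDiffOn ℝ ∞ (offGraph i₀ h χ F) ({x | graphFun i₀ h x ≠ 0} ∪ (tsupport χ)ᶜ) := by
  intro x hx
  refine ContDiffAt.contDiffWithinAt ?_
  by_cases hxχ : x ∈ tsupport χ
  · have h0 : graphFun i₀ h x ≠ 0 := hx.resolve_right (not_not.2 hxχ)
    have hxS : x ∉ S := fun hxS => h0 ((hc.mem_iff x (hχ hxχ)).1 hxS)
    have hmem : x ∈ (Ω : Set (Rn n)) \ S := ⟨χ.tsupport_subset hxχ, hxS⟩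
    have h1 : ContDiffAt ℝ ∞ (fun x => (χ x : ℂ) * F x) x :=
      (Complex.ofRealCLM.contDiff.comp χ.contDiff).contDiffAt.mul
        (hF.contDiffOn.contDiffAt (hS.isOpen_diff.mem_nhds hmem))
    refine h1.congr_of_eventuallyEq ?_
    filter_upwards [hS.isOpen_diff.mem_nhds hmem] with y hy
    exact hc.offGraph_eq hχ F hy.2
  · refine (contDiffAt_const (c := (0 : ℂ))).congr_of_eventuallyEq ?_
    filter_upwards [(isClosed_tsupport χ).isOpen_compl.mem_nhds hxχ] with y hy
    exact offGraph_eq_zero F hy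

/-- Induction on b: g^(b+1) ∂_e^(b+1) = (g ∂_e - b ∂_e g) g^b ∂_e^b. The field g ∂_e is tangential
and ∂_e g is smooth, so the exponent is unchanged. -/
theorem IsFlat.pow_mul_dirDeriv (hS : IsHypersurface Ω S) {τ : ℝ} {F : Rn n → ℂ}
    (hF : IsFlat Ω S τ F) (hc : IsGraphChart S U i₀ h) {χ : 𝓓(Ω, ℝ)} (hχ : tsupport χ ⊆ U)
    (e : Rn n) (b : ℕ) : IsFlat Ω S τ
      (fun x => (graphFun i₀ h x : ℂ) ^ b * dirDeriv e b (offGraph i₀ h χ F) x) := by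
  set D := offGraph i₀ h χ F with hD
  induction b with
  | zero =>
    refine (hF.mul_contDiffOn hS (a := fun x => (χ x : ℂ))
      (Complex.ofRealCLM.contDiff.comp χ.contDiff).contDiffOn).congr hS fun x hx => ?_
    rw [pow_zero, one_mul, dirDeriv, Function.iterate_zero, id, hD, hc.offGraph_eq hχ F hx.2,
      mul_comm]
  | succ b ih =>
    -- κ is supported in the chart, which makes κ g e a field tangent to S, and equals 1 on the
    -- support of χ.
    obtain ⟨κ, hκ, hκU, hκ1⟩ := exists_cutoff (Ω := ⟨U, hc.isOpen⟩) ⟨tsupport χ, χ.hasCompactSupport⟩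
      hχ
    set E := fun x => (graphFun i₀ h x : ℂ) ^ b * dirDeriv e b D x with hE
    have hV := hc.isTangent_smulField (Ω := Ω) hκ (fun x hx => hκU (subset_tsupport κ hx)) e
    have h1 := ih.vact hV
    have h2 : ContDiffOn ℝ ∞ (fun x => ((-(b : ℝ) * fderiv ℝ (graphFun i₀ h) x e : ℝ) : ℂ)) Ω := by
      refine (Complex.ofRealCLM.contDiff.comp (contDiff_const.mul ?_)).contDiffOn
      exact (hc.contDiff_graphFun.fderiv_right (by simp)).clm_apply contDiff_const
    refine (h1.add hS (ih.mul_contDiffOn hS h2)).congr hS fun x hx => ?_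
    have hmem := hc.mem_union hχ hx.2
    have hdd := ((contDiffOn_dirDeriv (hc.isOpen_union χ) (hF.contDiffOn_offGraph hS hc hχ)
      e b).contDiffAt ((hc.isOpen_union χ).mem_nhds hmem)).differentiableAt (by simp)
    have h3 := fderiv_pow_mul_apply
      (hc.contDiff_graphFun.differentiable (by simp)).differentiableAt hdd b e
    have h4 : Conormal.vact (smulField Ω (fun x => κ x * graphFun i₀ h x)
        (hκ.mul hc.contDiff_graphFun) e) E x =
        κ x * ((graphFun i₀ h x : ℂ) * fderiv ℝ E x e) := by
      simp [Conormal.vact, smulField]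
      ring
    simp only [h4]
    rw [hE, hD, h3, ← dirDeriv_succ]
    by_cases hxχ : x ∈ tsupport χ
    · rw [hκ1 x hxχ]
      push_cast
      ring
    · have h5 : ∀ b, dirDeriv e b (offGraph i₀ h χ F) x = 0 := fun b =>
        dirDeriv_eq_zero (isClosed_tsupport χ).isOpen_compl
          (fun y hy => offGraph_eq_zero F hy) e b x hxχ
      simp [h5]

/-- Compactness glues the local bounds: at points of S they come from flatness, elsewhere from
continuity and g ≠ 0. -/
theorem IsFlat.exists_norm_le_on {τ : ℝ} (hτ : 0 ≤ τ) {E : Rn n → ℂ} (hE : IsFlat Ω S τ E)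
    (hS : IsHypersurface Ω S) (hc : IsGraphChart S U i₀ h) {K : Set (Rn n)} (hK : IsCompact K)
    (hKU : K ⊆ U) (hKΩ : K ⊆ Ω) :
    ∃ A : ℝ, ∀ x ∈ K, graphFun i₀ h x ≠ 0 → ‖E x‖ ≤ A * |graphFun i₀ h x| ^ τ := by
  refine hK.induction_on (p := fun K => ∃ A : ℝ, ∀ x ∈ K, graphFun i₀ h x ≠ 0 →
    ‖E x‖ ≤ A * |graphFun i₀ h x| ^ τ) ⟨0, by simp⟩ ?_ ?_ fun p hp => ?_
  · rintro s t hst ⟨A, hA⟩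
    exact ⟨A, fun x hx => hA x (hst hx)⟩
  · rintro s t ⟨A, hA⟩ ⟨B, hB⟩
    refine ⟨max A B, fun x hx h0 => ?_⟩
    rcases hx with hx | hx
    · exact (hA x hx h0).trans (by gcongr; exact le_max_left _ _)
    · exact (hB x hx h0).trans (by gcongr; exact le_max_right _ _)
  · have hpU := hKU hp
    by_cases hpS : p ∈ S
    · obtain ⟨A, hA⟩ := ((hE.isBigO hpS).trans (hc.infDist_rpow_isBigO hpU hpS hτ)).bound
      rw [eventually_nhdsWithin_iff] at hA
      refine ⟨_, mem_nhdsWithin_of_mem_nhds (hA.and (hc.isOpen.mem_nhds hpU)), A, fun x hx h0 => ?_⟩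
      have := hx.1 fun hxS => h0 ((hc.mem_iff x hx.2).1 hxS)
      rwa [Real.norm_of_nonneg (by positivity)] at this
    · have h0 : graphFun i₀ h p ≠ 0 := fun h0 => hpS ((hc.mem_iff p hpU).2 h0)
      have h1 : ContinuousAt (fun x => ‖E x‖ / |graphFun i₀ h x| ^ τ) p := by
        refine ((hE.contDiffOn.contDiffAt
          (hS.isOpen_diff.mem_nhds ⟨hKΩ hp, hpS⟩)).continuousAt.norm).div ?_ ?_
        · exact hc.contDiff_graphFun.continuous.continuousAt.abs.rpow_const (Or.inr hτ)
        · have := abs_pos.2 h0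
          positivity
      refine ⟨_, mem_nhdsWithin_of_mem_nhds (h1.eventually (gt_mem_nhds
        (lt_add_one (‖E p‖ / |graphFun i₀ h p| ^ τ)))), ‖E p‖ / |graphFun i₀ h p| ^ τ + 1,
        fun x hx hx0 => ?_⟩
      have := abs_pos.2 hx0
      exact (div_le_iff₀ (by positivity)).1 (le_of_lt hx)

theorem IsFlat.exists_norm_dirDeriv_le (hS : IsHypersurface Ω S) {τ : ℝ} (hτ : 0 ≤ τ)
    {F : Rn n → ℂ} (hF : IsFlat Ω S τ F) (hc : IsGraphChart S U i₀ h) {χ : 𝓓(Ω, ℝ)}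
    (hχ : tsupport χ ⊆ U) (e : Rn n) (b : ℕ) : ∃ A : ℝ, ∀ x, graphFun i₀ h x ≠ 0 →
      ‖dirDeriv e b (offGraph i₀ h χ F) x‖ ≤ A * |graphFun i₀ h x| ^ (τ - b) := by
  obtain ⟨A, hA⟩ := (hF.pow_mul_dirDeriv hS hc hχ e b).exists_norm_le_on hτ hS hc
    χ.hasCompactSupport hχ χ.tsupport_subset
  refine ⟨max A 0, fun x hx => ?_⟩
  have h0 := abs_pos.2 hx
  by_cases hxχ : x ∈ tsupport χ
  · have h1 := hA x hxχ hx
    rw [norm_mul, norm_pow, Complex.norm_real, Real.norm_eq_abs] at h1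
    rw [Real.rpow_sub h0, Real.rpow_natCast, ← mul_div_assoc, le_div_iff₀ (by positivity), mul_comm]
    exact h1.trans (by gcongr; exact le_max_left _ _)
  · rw [dirDeriv_eq_zero (isClosed_tsupport χ).isOpen_compl
      (fun y hy => offGraph_eq_zero F hy) e b x hxχ, norm_zero]
    positivity

end Chart

/-! ### Besov regularity of functions vanishing to a given order at the hypersurface -/

section Besov

open FourierTransform

variable {S U : Set (Rn n)} {i₀ : Fin n} {h : Rn n → ℝ}

theorem integrable_cutoff_mul {f : Rn n → ℂ} (hf : LocallyIntegrableOn f Ω) (χ : 𝓓(Ω, ℝ)) :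
    Integrable fun x => (χ x : ℂ) * f x := by
  simpa only [mul_comm] using (isTest_coe χ).integrable_mul hf

theorem norm_basisVec (i : Fin n) : ‖basisVec i‖ = 1 := by simp [basisVec]

theorem memLp_two_of_bound {D : Rn n → ℂ} (hD : Integrable D) {B : ℝ} (hB : ∀ x, ‖D x‖ ≤ B) :
    MemLp D 2 := by
  rw [memLp_two_iff_integrable_sq_norm hD.aestronglyMeasurable]
  refine (hD.norm.const_mul B).mono' (hD.aestronglyMeasurable.norm.pow 2)
    (Filter.Eventually.of_forall fun x => ?_)
  rw [Real.norm_of_nonneg (by positivity), sq]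
  exact mul_le_mul_of_nonneg_right (hB x) (norm_nonneg _)

/-- The squared M-th differences are at most C r^(2τ) times the profile (1 + (g/r)²)⁻¹, whose
integral over a ball is O(r), for a total of O(r^(2(τ + 1/2))). Setting χ F to zero on the graph
makes the bounds hold at every point, as the difference estimate requires. -/
theorem IsFlat.exists_shell_bound (hS : IsHypersurface Ω S) {τ : ℝ} (hτ : 0 ≤ τ) {F : Rn n → ℂ}
    (hF : IsFlat Ω S τ F) (hc : IsGraphChart S U i₀ h) {χ : 𝓓(Ω, ℝ)} (hχ : tsupport χ ⊆ U) :
    ∃ B : ℝ, ∀ j, ∫⁻ ξ in dyadicShell n j, ENNReal.ofReal ((1 + ‖ξ‖ ^ 2) ^ (τ + 1 / 2) *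
      ‖𝓕 (fun x => (χ x : ℂ) * F x) ((2 * Real.pi)⁻¹ • ξ)‖ ^ 2) ≤ ENNReal.ofReal B := by
  set D := offGraph i₀ h χ F with hD
  set g := graphFun i₀ h with hg
  have hae : D =ᵐ[volume] fun x => (χ x : ℂ) * F x := hc.toIsShear.offGraph_ae_eq χ F
  have hDi : Integrable D := (integrable_congr hae).2
    (integrable_cutoff_mul (hF.locallyIntegrableOn hS hτ) χ)
  have hfour : 𝓕 (fun x => (χ x : ℂ) * F x) = 𝓕 D := by
    ext ξ
    rw [Real.fourier_eq, Real.fourier_eq]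
    refine integral_congr_ae ?_
    filter_upwards [hae] with x hx
    rw [hx]
  obtain ⟨R, hR⟩ := χ.hasCompactSupport.isCompact.isBounded.exists_norm_le
  have hR0 : ∀ x, R < ‖x‖ → D x = 0 := fun x hx =>
    offGraph_eq_zero F fun hxχ => absurd (hR x hxχ) (not_le.2 hx)
  have hbound : ∀ (e : Rn n) (b : ℕ), ∃ A : ℝ, 0 ≤ A ∧ ∀ x, g x ≠ 0 →
      ‖dirDeriv e b D x‖ ≤ A * |g x| ^ (τ - b) := fun e b => by
    obtain ⟨A, hA⟩ := hF.exists_norm_dirDeriv_le hS hτ hc hχ e b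
    exact ⟨max A 0, le_max_right _ _, fun x hx =>
      (hA x hx).trans (by gcongr; exact le_max_left _ _)⟩
  have hzero : ∃ A : ℝ, 0 ≤ A ∧ ∀ x, ‖D x‖ ≤ A * |g x| ^ τ := by
    obtain ⟨A, hA0, hA⟩ := hbound 0 0
    refine ⟨A, hA0, fun x => ?_⟩
    by_cases hx : g x = 0
    · have : D x = 0 := if_pos hx
      rw [this, norm_zero]
      positivity
    · simpa [dirDeriv] using hA x hx
  obtain ⟨A₀, hA₀0, hA₀⟩ := hzero
  have hD2 : MemLp D 2 := by
    obtain ⟨G, hG⟩ := (isCompact_closedBall (0 : Rn n) R).exists_bound_of_continuousOn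
      hc.contDiff_graphFun.continuous.continuousOn
    refine memLp_two_of_bound hDi (B := A₀ * (max G 0) ^ τ) fun x => ?_
    by_cases hx : ‖x‖ ≤ R
    · refine (hA₀ x).trans (mul_le_mul_of_nonneg_left ?_ hA₀0)
      exact Real.rpow_le_rpow (abs_nonneg _)
        ((hG x (mem_closedBall_zero_iff.2 hx)).trans (le_max_left _ _)) hτ
    · rw [hR0 x (not_le.1 hx), norm_zero]
      positivity
  obtain ⟨M, hM⟩ := exists_nat_ge (τ + 1)
  have key : ∀ i : Fin n, ∃ C : ℝ, ∀ r : ℝ, 0 < r → r ≤ 1 →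
      ∫ x, ‖(diffOp (r • basisVec i))^[M] D x‖ ^ 2 ≤ C * r ^ (2 * (τ + 1 / 2)) := fun i => by
    obtain ⟨A, hA0, hA⟩ := hbound (basisVec i) M
    obtain ⟨C, hC0, hC⟩ := hc.toIsShear.exists_norm_iterate_diffOp_le
      (D := fun b => dirDeriv (basisVec i) b D) (A := max A₀ A) (R := R) (norm_basisVec i) hτ hM
      (fun b _ x s hx => hasDerivAt_dirDeriv (hc.isOpen_union χ)
        (hF.contDiffOn_offGraph hS hc hχ) _ b (Or.inl hx))
      (fun x => (hA₀ x).trans (by gcongr; exact le_max_left _ _)) hR0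
      (fun x hx => (hA x hx).trans (by gcongr; exact le_max_right _ _))
    obtain ⟨V, hV0, hV⟩ := hc.toIsShear.exists_integral_le (R + M)
    refine ⟨C * V, fun r hr hr1 => ?_⟩
    have hint : IntegrableOn (fun x => C * r ^ (2 * τ) * (1 + (g x / r) ^ 2)⁻¹)
        (Metric.closedBall (0 : Rn n) (R + M)) := by
      refine ContinuousOn.integrableOn_compact (isCompact_closedBall _ _) ?_
      refine (continuous_const.mul (Continuous.inv₀ ?_ fun x => ?_)).continuousOn
      · exact continuous_const.add ((hc.contDiff_graphFun.continuous.div_const r).pow 2)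
      · positivity
    calc ∫ x, ‖(diffOp (r • basisVec i))^[M] D x‖ ^ 2
        ≤ ∫ x, (Metric.closedBall (0 : Rn n) (R + M)).indicator
          (fun x => C * r ^ (2 * τ) * (1 + (g x / r) ^ 2)⁻¹) x :=
          integral_mono_of_nonneg (Filter.Eventually.of_forall fun x => by positivity)
            ((integrable_indicator_iff Metric.isClosed_closedBall.measurableSet).2 hint)
            (Filter.Eventually.of_forall fun x => hC r hr hr1 x)
      _ = C * r ^ (2 * τ) *
          ∫ x in Metric.closedBall (0 : Rn n) (R + M), (1 + (g x / r) ^ 2)⁻¹ := by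
          rw [integral_indicator Metric.isClosed_closedBall.measurableSet, integral_const_mul]
      _ ≤ C * r ^ (2 * τ) * (V * r) := mul_le_mul_of_nonneg_left (hV r hr) (by positivity)
      _ = C * V * r ^ (2 * (τ + 1 / 2)) := by
          rw [show 2 * (τ + 1 / 2) = 2 * τ + 1 by ring, Real.rpow_add hr, Real.rpow_one]
          ring
  choose C hC using key
  rw [hfour]
  refine exists_shell_bound_of_diffOp hDi hD2 (by positivity) M (C := ∑ i, |C i|)
    fun i r hr hr1 => (hC i r hr hr1).trans ?_
  gcongr
  exact (le_abs_self _).trans (Finset.single_le_sum (f := fun i => |C i|)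
    (fun _ _ => abs_nonneg _) (Finset.mem_univ i))

/-- With M ≥ e, the M-th difference of a smooth compactly supported function is O(r^M), hence O(r^e)
for r ≤ 1. -/
theorem exists_shell_bound_of_contDiff {D : Rn n → ℂ} (hD : ContDiff ℝ ∞ D)
    (hDc : HasCompactSupport D) {e : ℝ} (he : 0 ≤ e) :
    ∃ B : ℝ, ∀ j, ∫⁻ ξ in dyadicShell n j, ENNReal.ofReal ((1 + ‖ξ‖ ^ 2) ^ e *
      ‖𝓕 D ((2 * Real.pi)⁻¹ • ξ)‖ ^ 2) ≤ ENNReal.ofReal B := by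
  obtain ⟨R, hR⟩ := hDc.isCompact.isBounded.exists_norm_le
  have hR0 : ∀ x, R < ‖x‖ → D x = 0 := fun x hx =>
    image_eq_zero_of_notMem_tsupport fun hxχ => absurd (hR x hxχ) (not_le.2 hx)
  obtain ⟨M, hM⟩ := exists_nat_ge e
  have key : ∀ i : Fin n, ∃ C : ℝ, 0 ≤ C ∧ ∀ r : ℝ, 0 < r → r ≤ 1 →
      ∫ x, ‖(diffOp (r • basisVec i))^[M] D x‖ ^ 2 ≤ C * r ^ (2 * e) := fun i => by
    have hsm := contDiffOn_dirDeriv isOpen_univ hD.contDiffOn (basisVec i) M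
    obtain ⟨B, hB⟩ := (isCompact_closedBall (0 : Rn n) R).exists_bound_of_continuousOn
      (hsm.continuousOn.mono (subset_univ _))
    have hB' : ∀ x, ‖dirDeriv (basisVec i) M D x‖ ≤ max B 0 := fun x => by
      by_cases hx : ‖x‖ ≤ R
      · exact (hB x (mem_closedBall_zero_iff.2 hx)).trans (le_max_left _ _)
      · rw [dirDeriv_eq_zero (isOpen_lt continuous_const continuous_norm) hR0 _ _ x (not_le.1 hx),
          norm_zero]
        exact le_max_right _ _
    refine ⟨volume.real (Metric.closedBall (0 : Rn n) (R + M)) * max B 0 ^ 2, by positivity,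
      fun r hr hr1 => ?_⟩
    have hpt : ∀ x, ‖(diffOp (r • basisVec i))^[M] D x‖ ^ 2 ≤
        (Metric.closedBall (0 : Rn n) (R + M)).indicator
          (fun _ => r ^ (2 * e) * max B 0 ^ 2) x := fun x => by
      by_cases hx : x ∈ Metric.closedBall (0 : Rn n) (R + M)
      · rw [indicator_of_mem hx]
        have h1 := norm_iterate_diffOp_le_of_hasDerivAt (basisVec i) hr.le M
          (fun b => dirDeriv (basisVec i) b D) x (max B 0)
          (fun b _ s _ => hasDerivAt_dirDeriv isOpen_univ hD.contDiffOn _ b (mem_univ _))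
          (fun s _ => hB' _)
        have h2 : (r ^ M) ^ 2 ≤ r ^ (2 * e) := by
          rw [← pow_mul, ← Real.rpow_natCast]
          refine Real.rpow_le_rpow_of_exponent_ge hr hr1 ?_
          push_cast
          linarith
        refine (pow_le_pow_left₀ (norm_nonneg _) h1 2).trans ?_
        rw [mul_pow]
        gcongr
      · rw [indicator_of_notMem hx]
        have h1 := norm_iterate_diffOp_le_of_bound (r • basisVec i) M (f := D) (x := x) (B := 0)
          fun k hkM => by
            rw [hR0, norm_zero]
            rw [mem_closedBall_zero_iff, not_le] at hx
            have h1 := norm_sub_le (x + (k : ℝ) • r • basisVec i) ((k : ℝ) • r • basisVec i)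
            rw [add_sub_cancel_right, smul_smul, norm_smul, norm_basisVec, mul_one,
              Real.norm_of_nonneg (by positivity)] at h1
            rw [smul_smul]
            have h2 : (k : ℝ) * r ≤ M := (mul_le_of_le_one_right (by positivity) hr1).trans
              (by exact_mod_cast hkM)
            linarith
        rw [mul_zero] at h1
        rw [norm_le_zero_iff.1 h1]
        simp
    have hfin : IntegrableOn (fun _ : Rn n => r ^ (2 * e) * max B 0 ^ 2)
        (Metric.closedBall (0 : Rn n) (R + M)) :=
      integrableOn_const measure_closedBall_lt_top.ne
    refine (integral_mono_of_nonneg (Filter.Eventually.of_forall fun x => by positivity)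
      ((integrable_indicator_iff Metric.isClosed_closedBall.measurableSet).2 hfin)
      (Filter.Eventually.of_forall hpt)).trans_eq ?_
    rw [integral_indicator Metric.isClosed_closedBall.measurableSet, setIntegral_const, smul_eq_mul]
    ring
  choose C hC0 hC using key
  refine exists_shell_bound_of_diffOp (hD.continuous.integrable_of_hasCompactSupport hDc)
    (hD.continuous.memLp_of_hasCompactSupport hDc) he M (C := ∑ i, C i)
    fun i r hr hr1 => (hC i r hr hr1).trans ?_
  gcongr
  exact Finset.single_le_sum (fun i _ => hC0 i) (Finset.mem_univ i)

/-- A local bound on the dyadic shells gives local Besov regularity. -/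
theorem memBesovLoc_ofFunction {e : ℝ} {F : Rn n → ℂ} (hF : LocallyIntegrableOn F Ω)
    (hloc : ∀ p ∈ Ω, ∃ U : Set (Rn n), IsOpen U ∧ p ∈ U ∧ ∀ χ : 𝓓(Ω, ℝ), tsupport χ ⊆ U →
      ∃ B : ℝ, ∀ j, ∫⁻ ξ in dyadicShell n j, ENNReal.ofReal ((1 + ‖ξ‖ ^ 2) ^ e *
        ‖𝓕 (fun x => (χ x : ℂ) * F x) ((2 * Real.pi)⁻¹ • ξ)‖ ^ 2) ≤ ENNReal.ofReal B) :
    MemBesovLoc e (ofFunction Ω F) := by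
  intro χ
  have hcut : ∀ (χ : 𝓓(Ω, ℝ)) (ξ : Rn n), fourierCutoff (ofFunction Ω F) χ ξ =
      𝓕 (fun x => (χ x : ℂ) * F x) ((2 * Real.pi)⁻¹ • ξ) := fun χ ξ => by
    rw [← ft_ofFunction hF, ← fourierCutoff_smul, smul_inv_smul₀ (by positivity)]
  have hcont : ∀ χ : 𝓓(Ω, ℝ), Continuous (𝓕 (fun x => (χ x : ℂ) * F x)) := fun χ =>
    VectorFourier.fourierIntegral_continuous Real.continuous_fourierChar continuous_inner
      (integrable_cutoff_mul hF χ)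
  have hmain : ∃ B : ℝ, ∀ j, ∫⁻ ξ in dyadicShell n j, ENNReal.ofReal ((1 + ‖ξ‖ ^ 2) ^ e *
      ‖𝓕 (fun x => (χ x : ℂ) * F x) ((2 * Real.pi)⁻¹ • ξ)‖ ^ 2) ≤ ENNReal.ofReal B := by
    refine testFunction_induction (P := fun χ : 𝓓(Ω, ℝ) => ∃ B : ℝ, ∀ j,
      ∫⁻ ξ in dyadicShell n j, ENNReal.ofReal ((1 + ‖ξ‖ ^ 2) ^ e *
        ‖𝓕 (fun x => (χ x : ℂ) * F x) ((2 * Real.pi)⁻¹ • ξ)‖ ^ 2) ≤ ENNReal.ofReal B)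
      ⟨0, fun j => ?_⟩ ?_ hloc χ
    · simp [Real.fourier_eq]
    · rintro φ ψ ⟨A, hA⟩ ⟨B, hB⟩
      refine ⟨2 * max A 0 + 2 * max B 0, fun j => ?_⟩
      have hadd : ∀ ξ, 𝓕 (fun x => ((φ + ψ) x : ℂ) * F x) ξ =
          𝓕 (fun x => (φ x : ℂ) * F x) ξ + 𝓕 (fun x => (ψ x : ℂ) * F x) ξ := fun ξ => by
        have h1 : (fun x => ((φ + ψ) x : ℂ) * F x) =
            (fun x => (φ x : ℂ) * F x) + fun x => (ψ x : ℂ) * F x := by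
          ext x
          simp [add_mul]
        rw [h1]
        exact congrFun (VectorFourier.fourierIntegral_add Real.continuous_fourierChar
          continuous_inner (integrable_cutoff_mul hF φ) (integrable_cutoff_mul hF ψ)) ξ
      have hm : Measurable fun ξ : Rn n => ENNReal.ofReal (2 * ((1 + ‖ξ‖ ^ 2) ^ e *
          ‖𝓕 (fun x => (φ x : ℂ) * F x) ((2 * Real.pi)⁻¹ • ξ)‖ ^ 2)) := by
        refine (Continuous.measurable ?_).ennreal_ofReal
        refine continuous_const.mul ((Continuous.rpow_const (by fun_prop) fun ξ => Or.inl ?_).mul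
          (((hcont φ).comp (continuous_const_smul _)).norm.pow 2))
        positivity
      rw [ENNReal.ofReal_add (by positivity) (by positivity), ENNReal.ofReal_mul two_pos.le,
        ENNReal.ofReal_mul two_pos.le]
      calc _ ≤ ∫⁻ ξ in dyadicShell n j, (ENNReal.ofReal (2 * ((1 + ‖ξ‖ ^ 2) ^ e *
              ‖𝓕 (fun x => (φ x : ℂ) * F x) ((2 * Real.pi)⁻¹ • ξ)‖ ^ 2)) +
            ENNReal.ofReal (2 * ((1 + ‖ξ‖ ^ 2) ^ e *
              ‖𝓕 (fun x => (ψ x : ℂ) * F x) ((2 * Real.pi)⁻¹ • ξ)‖ ^ 2))) := by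
            refine lintegral_mono fun ξ => ?_
            rw [← ENNReal.ofReal_add (by positivity) (by positivity), hadd]
            refine ENNReal.ofReal_le_ofReal ?_
            rw [← mul_add, ← mul_add, mul_left_comm]
            refine mul_le_mul_of_nonneg_left ?_ (by positivity)
            exact sq_norm_le_two_mul _ _
        _ ≤ _ := by
            rw [lintegral_add_left hm]
            simp only [ENNReal.ofReal_mul two_pos.le]
            rw [lintegral_const_mul' _ _ ENNReal.ofReal_ne_top,
              lintegral_const_mul' _ _ ENNReal.ofReal_ne_top]
            gcongr
            · exact (hA j).trans (ENNReal.ofReal_le_ofReal (le_max_left _ _))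
            · exact (hB j).trans (ENNReal.ofReal_le_ofReal (le_max_left _ _))
  obtain ⟨B, hB⟩ := hmain
  refine lt_of_le_of_lt (iSup_le fun j => ?_)
    (ENNReal.rpow_lt_top_of_nonneg (by norm_num : (0 : ℝ) ≤ 1 / 2) (ENNReal.ofReal_ne_top (r := B)))
  simp only [hcut]
  exact ENNReal.rpow_le_rpow (hB j) (by norm_num)

theorem MemBesovLoc.mono {e e' : ℝ} (he : e ≤ e') {u : 𝓓'(Ω, ℂ)} (hu : MemBesovLoc e' u) :
    MemBesovLoc e u := fun χ => by
  refine lt_of_le_of_lt (iSup_mono fun j => ?_) (hu χ)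
  refine ENNReal.rpow_le_rpow (lintegral_mono fun ξ => ENNReal.ofReal_le_ofReal ?_) (by norm_num)
  gcongr
  nlinarith [norm_nonneg ξ]

theorem exists_shell_bound_of_contDiffOn {O : Set (Rn n)} (hO : IsOpen O) {F : Rn n → ℂ}
    (hF : ContDiffOn ℝ ∞ F O) {χ : 𝓓(Ω, ℝ)} (hχ : tsupport χ ⊆ O) {e : ℝ} (he : 0 ≤ e) :
    ∃ B : ℝ, ∀ j, ∫⁻ ξ in dyadicShell n j, ENNReal.ofReal ((1 + ‖ξ‖ ^ 2) ^ e *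
      ‖𝓕 (fun x => (χ x : ℂ) * F x) ((2 * Real.pi)⁻¹ • ξ)‖ ^ 2) ≤ ENNReal.ofReal B := by
  refine exists_shell_bound_of_contDiff ?_ ?_ he
  · rw [contDiff_iff_contDiffAt]
    intro x
    by_cases hx : x ∈ tsupport χ
    · exact (Complex.ofRealCLM.contDiff.comp χ.contDiff).contDiffAt.mul
        (hF.contDiffAt (hO.mem_nhds (hχ hx)))
    · refine (contDiffAt_const (c := (0 : ℂ))).congr_of_eventuallyEq ?_
      filter_upwards [(isClosed_tsupport χ).isOpen_compl.mem_nhds hx] with y hy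
      rw [image_eq_zero_of_notMem_tsupport hy]
      simp
  · exact (χ.hasCompactSupport.comp_left Complex.ofReal_zero).mul_right

theorem memBesovLoc_of_contDiffOn {F : Rn n → ℂ} (hF : ContDiffOn ℝ ∞ F Ω) (e : ℝ) :
    MemBesovLoc e (ofFunction Ω F) :=
  -- The shell bounds need a nonnegative order, so a negative e is first raised to 0.
  MemBesovLoc.mono (le_max_left e 0) <| memBesovLoc_ofFunction
    (hF.continuousOn.locallyIntegrableOn Ω.isOpen.measurableSet) fun _ hp =>
      ⟨Ω, Ω.isOpen, hp, fun _ hχ =>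
        exists_shell_bound_of_contDiffOn Ω.isOpen hF hχ (le_max_right e 0)⟩

theorem IsFlat.memBesovLoc (hS : IsHypersurface Ω S) {τ : ℝ} (hτ : 0 ≤ τ) {F : Rn n → ℂ}
    (hF : IsFlat Ω S τ F) : MemBesovLoc (τ + 1 / 2) (ofFunction Ω F) := by
  refine memBesovLoc_ofFunction (hF.locallyIntegrableOn hS hτ) fun p hp => ?_
  by_cases hpS : p ∈ S
  · obtain ⟨i₀, h, U, hpU, hc⟩ := hS.exists_chart hpS
    exact ⟨U, hc.isOpen, hpU, fun χ hχ => hF.exists_shell_bound hS hτ hc hχ⟩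
  · exact ⟨_, hS.isOpen_diff, ⟨hp, hpS⟩, fun χ hχ =>
      exists_shell_bound_of_contDiffOn hS.isOpen_diff hF.contDiffOn hχ (by positivity)⟩

end Besov

/-! ### Powers of functions in Piriou's spaces -/

section Powers

variable {S : Set (Rn n)}

theorem eqOn_of_ofFunction_eq {f g : Rn n → ℂ} (hf : ContinuousOn f Ω) (hg : ContinuousOn g Ω)
    (h : ofFunction Ω f = ofFunction Ω g) : EqOn f g Ω := by
  have hfi := hf.locallyIntegrableOn (μ := volume) Ω.isOpen.measurableSet
  have hgi := hg.locallyIntegrableOn (μ := volume) Ω.isOpen.measurableSet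
  have hae := Ω.isOpen.ae_eq_zero_of_integral_contDiff_smul_eq_zero (hfi.sub hgi)
    fun φ hφ hφc hφΩ => by
      have h1 := DFunLike.congr_fun h (⟨φ, hφ, hφc, hφΩ⟩ : 𝓓(Ω, ℝ))
      rw [ofFunction_apply hf, ofFunction_apply hg] at h1
      simp only [Pi.sub_apply, smul_sub]
      rw [integral_sub]
      · exact sub_eq_zero.2 h1
      · exact integrable_cutoff_mul hfi ⟨φ, hφ, hφc, hφΩ⟩
      · exact integrable_cutoff_mul hgi ⟨φ, hφ, hφc, hφΩ⟩
  refine Measure.eqOn_open_of_ae_eq (μ := volume) ?_ Ω.isOpen hf hg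
  refine (ae_restrict_iff' Ω.isOpen.measurableSet).2 ?_
  filter_upwards [hae] with x hx hxΩ
  exact sub_eq_zero.1 (hx hxΩ)

theorem ofFunction_congr {f g : Rn n → ℂ} (hf : ContinuousOn f Ω) (h : EqOn f g Ω) :
    ofFunction Ω f = ofFunction Ω g := by
  ext φ
  rw [ofFunction_apply hf, ofFunction_apply (hf.congr h.symm)]
  refine integral_congr_ae (Filter.Eventually.of_forall fun x => ?_)
  by_cases hx : x ∈ tsupport φ
  · simp only [h (φ.tsupport_subset hx)]
  · simp [image_eq_zero_of_notMem_tsupport hx]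

theorem IsFlat.ofFunction_mem_conormal (hS : IsHypersurface Ω S) {τ μ : ℝ} (hτ : 0 ≤ τ)
    {F : Rn n → ℂ} (hF : IsFlat Ω S τ F) (hμ : -μ - (n : ℝ) / 4 ≤ τ + 1 / 2) :
    ofFunction Ω F ∈ conormal Ω S μ := fun L hL => by
  rw [hF.foldr_act_ofFunction hS hτ L hL]
  exact ((hF.foldr_vact L hL).memBesovLoc hS hτ).mono hμ

theorem ofFunction_mem_conormal_of_contDiffOn (hS : IsHypersurface Ω S) {F : Rn n → ℂ}
    (hF : ContDiffOn ℝ ∞ F Ω) (μ : ℝ) : ofFunction Ω F ∈ conormal Ω S μ := fun L hL => by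
  have hflat : IsFlat Ω S 0 F := fun N => isFlatOrder_of_contDiffOn hS hF
  rw [hflat.foldr_act_ofFunction hS le_rfl L hL]
  exact memBesovLoc_of_contDiffOn (contDiffOn_foldr_vact Ω.isOpen Subset.rfl hF L) _

/-- Any exponent strictly between k and -m - 1 would do; the midpoint is the least one for which the
square has the required order. -/
theorem isFlat_of_mem_conormal (hS : IsHypersurface Ω S) {m : ℝ} (hm : m < -1) {f : Rn n → ℂ}
    (hf : ContDiffOn ℝ (piriouIndex m) f Ω)
    (hu : ofFunction Ω f ∈ conormal Ω S (m - (n : ℝ) / 4 + 1 / 2))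
    (hjet : ∀ p ∈ S, ∀ i ≤ piriouIndex m, iteratedFDeriv ℝ i f p = 0) :
    IsFlat Ω S ((-m - 1 + piriouIndex m) / 2) f := by
  obtain ⟨h1, h2⟩ := (piriouIndex_eq_iff hm _).1 rfl
  have hcf : IsConormalFun Ω S (-m - 1 / 2) f :=
    ⟨hS, by linarith, hf.continuousOn, fun L hL => by
      convert hu L hL using 1
      ring⟩
  -- τ' only needs to lie strictly between τ and -m - 1, which is at most k + 1.
  exact hcf.isFlat (k := piriouIndex m) (τ' := ((-m - 1 + piriouIndex m) / 2 + (-m - 1)) / 2)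
    (by linarith) (by linarith) (by linarith) (by linarith) hf hjet

/-- The exponent of f^j is jτ with τ the midpoint of k and -m - 1. This reaches the required -m - 1
+ (j - 1)k exactly at j = 2, and with room for larger j. At j = 1 it would fall short, so membership
is taken from the hypothesis there. -/
theorem ofFunction_pow_mem_conormal (hS : IsHypersurface Ω S) {m : ℝ} (hm : m < -1)
    {f : Rn n → ℂ} (hf : ContDiffOn ℝ (piriouIndex m) f Ω)
    (hu : ofFunction Ω f ∈ conormal Ω S (m - (n : ℝ) / 4 + 1 / 2))
    (hjet : ∀ p ∈ S, ∀ i ≤ piriouIndex m, iteratedFDeriv ℝ i f p = 0) (j : ℕ) :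
    ofFunction Ω (fun x => f x ^ j) ∈ conormal Ω S
      (m - ((j : ℝ) - 1) * (piriouIndex m : ℝ) - (n : ℝ) / 4 + 1 / 2) := by
  obtain ⟨-, h2⟩ := (piriouIndex_eq_iff hm _).1 rfl
  have hk : (0 : ℝ) ≤ piriouIndex m := Nat.cast_nonneg _
  rcases j with _ | _ | j
  · simp only [pow_zero]
    exact ofFunction_mem_conormal_of_contDiffOn hS contDiffOn_const _
  · simpa using hu
  · have hτ : 0 ≤ (-m - 1 + piriouIndex m) / 2 := by linarith
    refine ((isFlat_of_mem_conormal hS hm hf hu hjet).pow hS (j + 2)).ofFunction_mem_conormal hS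
      (by positivity) ?_
    push_cast
    -- The excess is (j/2)(-m - 1 - k), j now counting from the square.
    nlinarith [mul_nonneg (Nat.cast_nonneg (α := ℝ) j) (sub_nonneg.2 h2.le)]

end Powers

end Conormal

end

theorem proposition2p4 {n : ℕ} (Ω : TopologicalSpace.Opens (Conormal.Rn n))
    (hΩ : Bornology.IsBounded (Ω : Set (Conormal.Rn n)))
    (S : Set (Conormal.Rn n)) (hS : Conormal.IsHypersurface Ω S)
    (m : ℝ) (hm : m < -1)
    (u : 𝓓'(Ω, ℂ)) (hu : u ∈ Conormal.piriou Ω S m) :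
    (∃ f : Conormal.Rn n → ℂ, ContinuousOn f Ω ∧ u = Conormal.ofFunction Ω f) ∧
      ∀ f : Conormal.Rn n → ℂ, ContinuousOn f Ω → u = Conormal.ofFunction Ω f →
        ∀ j : ℕ, Conormal.ofFunction Ω (fun x => f x ^ j) ∈
          Conormal.conormal Ω S
            (m - ((j : ℝ) - 1) * (Conormal.piriouIndex m : ℝ) - (n : ℝ) / 4 + 1 / 2) := by
  obtain ⟨hcon, f₀, hf₀, rfl, hjet⟩ := hu
  refine ⟨⟨f₀, hf₀.continuousOn, rfl⟩, fun f hf hff₀ j => ?_⟩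
  -- The continuous function is determined by u on Ω, so the given f may be replaced by the one with
  -- vanishing derivatives.
  have heq := Conormal.eqOn_of_ofFunction_eq hf hf₀.continuousOn hff₀.symm
  rw [Conormal.ofFunction_congr (f := fun x => f x ^ j) (hf.pow j) (g := fun x => f₀ x ^ j) fun x hx => by
    simp only [heq hx]]
  exact Conormal.ofFunction_pow_mem_conormal hS hm hf₀ hcon hjet j
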